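/- Let $N\ge 2$ be an integer, $s\in(0,1)$ and $p\in(1,\infty)$. Write $B_r$ for the open ball of radius $r$ centred at $0$ in $\mathbb R^N$, and $a^{p-1}:=|a|^{p-2}a$ for $a\in\mathbb R$ (with value $0$ at $a=0$). For $V\subseteq\mathbb R^N$ open, $W^{s,p}(V)$ is the space of $u\in L^p(V)$ with $\int_{V\times V}\frac{|u(x)-u(y)|^p}{|x-y|^{N+ps}}\,dx\,dy<\infty$. For $U\subset\mathbb R^N$ bounded and open, $W^{s,p}_0(U)$ is the space of $\varphi\in W^{s,p}(\mathbb R^N)$ with $\varphi=0$ a.e. in $\mathbb R^N\setminus U$, and $\widetilde W^{s,p}(U)$ is the space of $u\in L^p_{\rm loc}(\mathbb R^N)$ such that $u\in W^{s,p}(V)$ for some open $V\supset\overline U$ and $\int_{\mathbb R^N}\frac{|u(x)|^{p-1}}{(1+|x|)^{N+ps}}\,dx<\infty$. For $u\in\widetilde W^{s,p}(U)$ and $K\ge0$, we say that $|(-\Delta)^s_pu|\le K$ weakly in $U$ if $$-K\int_U\varphi\,dx\;\le\;\int_{\mathbb R^N\times\mathbb R^N}\frac{(u(x)-u(y))^{p-1}(\varphi(x)-\varphi(y))}{|x-y|^{N+ps}}\,dx\,dy\;\le\;K\int_U\varphi\,dx$$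 for all $\varphi\in W^{s,p}_0(U)$ with $\varphi\ge0$ a.e. in $U$. Put $$\mathrm{Tail}(u;x,R)=\Big(R^{ps}\int_{\mathbb R^N\setminus B_R(x)}\frac{|u(y)|^{p-1}}{|x-y|^{N+ps}}\,dy\Big)^{\frac1{p-1}}.$$ **Theorem (local Hölder regularity).** There exist $\alpha\in(0,s]$ and $C>0$, depending only on $N,s,p$, such that for all $R>0$, all $K\ge0$ and every $u\in\widetilde W^{s,p}(B_{2R})\cap L^\infty(B_{2R})$ with $|(-\Delta)^s_pu|\le K$ weakly in $B_{2R}$, the function $u$ agrees a.e. in $B_R$ with a function (still denoted $u$) satisfying $$[u]_{C^\alpha(B_R)}:=\sup_{x\ne y\in B_R}\frac{|u(x)-u(y)|}{|x-y|^\alpha}\le C\Big((KR^{ps})^{\frac1{p-1}}+\|u\|_{L^\infty(B_{2R})}+\mathrm{Tail}(u;0,2R)\Big)R^{-\alpha}.$$ -/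

import Mathlib

open MeasureTheory Set Metric
open scoped ENNReal

noncomputable section

namespace FracPLaplacian

/-- Euclidean space `ℝ^N`. -/
abbrev E (N : ℕ) : Type := EuclideanSpace ℝ (Fin N)

/-- The signed power `a ↦ |a|^{p-2} a`, written `a^{p-1}` in the literature. It vanishes at
`a = 0` for every `p`. -/
def signedPow (p a : ℝ) : ℝ := |a| ^ (p - 2) * a

/-- The `p`-th power of the Gagliardo seminorm of `u` on `V`,
`∫_{V × V} |u(x) - u(y)|^p / |x - y|^{N + ps} dx dy`, with values in `[0, ∞]`. -/
def gagliardo {N : ℕ} (s p : ℝ) (V : Set (E N)) (u : E N → ℝ) : ℝ≥0∞ :=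
  ∫⁻ z in V ×ˢ V,
    ENNReal.ofReal (|u z.1 - u z.2| ^ p / ‖z.1 - z.2‖ ^ ((N : ℝ) + p * s))

/-- `u ∈ W^{s,p}(V)`. -/
def MemW {N : ℕ} (s p : ℝ) (V : Set (E N)) (u : E N → ℝ) : Prop :=
  MemLp u (ENNReal.ofReal p) (volume.restrict V) ∧ gagliardo s p V u < ∞

/-- `u ∈ W^{s,p}_0(U)`: `u ∈ W^{s,p}(ℝ^N)` and `u = 0` a.e. outside `U`. -/
def MemW0 {N : ℕ} (s p : ℝ) (U : Set (E N)) (u : E N → ℝ) : Prop :=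
  MemW s p univ u ∧ ∀ᵐ x ∂(volume.restrict Uᶜ), u x = 0

/-- `u ∈ W̃^{s,p}(U)` for a bounded set `U`: `u ∈ L^p_loc(ℝ^N)`, `u ∈ W^{s,p}(V)` for some open `V`
with `U ⋐ V`, and `∫ |u(x)|^{p-1} / (1 + |x|)^{N + ps} dx < ∞`. -/
structure MemWTilde {N : ℕ} (s p : ℝ) (U : Set (E N)) (u : E N → ℝ) : Prop where
  memLp_loc : ∀ A : Set (E N), IsCompact A → MemLp u (ENNReal.ofReal p) (volume.restrict A)
  memW_nhds : ∃ V : Set (E N), IsOpen V ∧ IsCompact (closure U) ∧ closure U ⊆ V ∧ MemW s p V u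
  tail_lt_top :
    ∫⁻ x : E N, ENNReal.ofReal (|u x| ^ (p - 1) / (1 + ‖x‖) ^ ((N : ℝ) + p * s)) < ∞

/-- The non-local tail
`Tail(u; x, R) = (R^{ps} ∫_{B_R(x)^c} |u(y)|^{p-1} / |x - y|^{N + ps} dy)^{1/(p-1)}`,
with values in `[0, ∞]`. -/
def tail {N : ℕ} (s p : ℝ) (u : E N → ℝ) (x : E N) (R : ℝ) : ℝ≥0∞ :=
  (ENNReal.ofReal (R ^ (p * s)) *
    ∫⁻ y in (ball x R)ᶜ,
      ENNReal.ofReal (|u y| ^ (p - 1) / ‖x - y‖ ^ ((N : ℝ) + p * s))) ^ (1 / (p - 1))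

/-- The weak form of the `s`-fractional `p`-Laplacian,
`∫_{ℝ^N × ℝ^N} (u(x) - u(y))^{p-1} (φ(x) - φ(y)) / |x - y|^{N + ps} dx dy`.
The integrand is integrable when `u ∈ W̃^{s,p}(U)` and `φ ∈ W^{s,p}_0(U)`. -/
def weakForm {N : ℕ} (s p : ℝ) (u φ : E N → ℝ) : ℝ :=
  ∫ z : E N × E N,
    signedPow p (u z.1 - u z.2) * (φ z.1 - φ z.2) / ‖z.1 - z.2‖ ^ ((N : ℝ) + p * s)

/-- `(-Δ)_p^s u ≥ c` weakly in the bounded open set `U`, for a constant `c`. -/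
def WeakGE {N : ℕ} (s p : ℝ) (U : Set (E N)) (u : E N → ℝ) (c : ℝ) : Prop :=
  MemWTilde s p U u ∧
    ∀ φ : E N → ℝ, MemW0 s p U φ → (∀ᵐ x ∂(volume.restrict U), 0 ≤ φ x) →
      c * ∫ x in U, φ x ≤ weakForm s p u φ

/-- `(-Δ)_p^s u ≤ c` weakly in the bounded open set `U`, for a constant `c`. -/
def WeakLE {N : ℕ} (s p : ℝ) (U : Set (E N)) (u : E N → ℝ) (c : ℝ) : Prop :=
  MemWTilde s p U u ∧
    ∀ φ : E N → ℝ, MemW0 s p U φ → (∀ᵐ x ∂(volume.restrict U), 0 ≤ φ x) →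
      weakForm s p u φ ≤ c * ∫ x in U, φ x

/-- `|(-Δ)_p^s u| ≤ K` weakly in the bounded open set `U`. -/
def WeakAbsLE {N : ℕ} (s p : ℝ) (U : Set (E N)) (u : E N → ℝ) (K : ℝ) : Prop :=
  WeakGE s p U u (-K) ∧ WeakLE s p U u K

/-- The Hölder seminorm `[v]_{C^α(S)} = sup_{x ≠ y ∈ S} |v(x) - v(y)| / |x - y|^α`, with values in
`[0, ∞]`. -/
def holderSeminorm {N : ℕ} (α : ℝ) (S : Set (E N)) (v : E N → ℝ) : ℝ≥0∞ :=
  ⨆ x ∈ S, ⨆ y ∈ S, ⨆ _ : x ≠ y, ENNReal.ofReal (|v x - v y| / ‖x - y‖ ^ α)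

end FracPLaplacian

end

noncomputable section

namespace FracPLaplacian

/-! ### Elementary inequalities for signed powers. -/

section RealInequalities

variable {p : ℝ}

/-! The proof compares `u` with an explicit barrier; no Caccioppoli or logarithmic estimate is used.
The core is a growth lemma, `exists_growth`. Suppose `u ≥ m` on `B_{4r}`, `(-Δ)_p^s u ≥ -K`, and `u
≥ m + lam` on half of the annulus `B_{2r} \ B_r`. Test the equation with `ψ = (m + l φ - u)_+` on
`B_r`, where `φ` is a bump supported in `B_r` and `l` is a small multiple of `lam`. Monotonicity of
the signed power bounds the form of `u` by `l^{p-1}` times the form of `φ`, up to interactions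
between `B_r` and the rest. The annulus contributes a negative term of order `lam^{p-1} r^{-ps} ∫
ψ`. If `l`, `K` and the exterior tail are small relative to `lam`, this term beats all the others,
so `∫ ψ = 0`, that is, `u ≥ m + l φ` in `B_r`.

The barrier must satisfy `(-Δ)_p^s φ ≤ C r^{-ps}` weakly (`exists_weakForm_scaledBump_le`). Up to an
integrable remainder, the increment of the profile `1 - |z|^{2(m+1)}` contributes an odd function of
`h`, which integrates to zero on symmetric domains. For `p ≥ 2` the remainder is of order `|h|^p`.
For `p < 2` the derivative of the signed power is singular where the linear part vanishes. A large
exponent `2(m+1)` handles the critical point `z = 0`, and the remaining directional singularity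
`|⟨e, h⟩|^{p-2}` is integrable against `|h|^{2-N-ps}`, uniformly in `e`
(`exists_integral_inner_rpow_le`).

Oscillation decay follows by induction over the balls of radius `R 8^{-j}` (`exists_oscBound`).
Either `u` or `-u` lies above the midpoint of its range on half of the annulus, so the growth lemma
shortens the range by a fixed factor. The bounds from earlier steps let the negative part of `u - m`
grow at most like `(8|y - x₀|/r_j)^α - 1` inside `B_{2R}`. The corresponding tail is small when `α`
is small (`exists_tail_weight_le`), while the data outside `B_{2R}` and `K` are absorbed by starting
from a large multiple of the right-hand side. Decay at every centre gives a modulus of continuity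
there, and `exists_holder_representative` turns these moduli into one Hölder function. -/

theorem signedPow_neg (p a : ℝ) : signedPow p (-a) = -signedPow p a := by simp [signedPow]

theorem signedPow_of_nonneg (hp : 1 < p) {a : ℝ} (ha : 0 ≤ a) : signedPow p a = a ^ (p - 1) := by
  rcases ha.eq_or_lt with rfl | ha
  · simp [signedPow, Real.zero_rpow (by linarith : p - 1 ≠ 0)]
  · rw [signedPow, abs_of_pos ha]
    nth_rw 2 [← Real.rpow_one a]
    rw [← Real.rpow_add ha]
    congr 1
    ring

theorem signedPow_nonneg {a : ℝ} (ha : 0 ≤ a) : 0 ≤ signedPow p a := by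
  unfold signedPow; positivity

theorem abs_signedPow (hp : 1 < p) (a : ℝ) : |signedPow p a| = |a| ^ (p - 1) := by
  rcases le_total 0 a with ha | ha
  · rw [abs_of_nonneg ha, signedPow_of_nonneg hp ha, abs_of_nonneg (by positivity)]
  · have h := signedPow_of_nonneg hp (neg_nonneg.2 ha)
    rw [signedPow_neg] at h
    rw [abs_of_nonpos ha, ← h, abs_of_nonpos]
    rw [← neg_nonneg, h]
    exact Real.rpow_nonneg (neg_nonneg.2 ha) _

theorem signedPow_mono (hp : 1 < p) : Monotone (signedPow p) := by
  have key : ∀ a b : ℝ, 0 ≤ a → a ≤ b → signedPow p a ≤ signedPow p b := fun a b ha hab ↦ by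
    rw [signedPow_of_nonneg hp ha, signedPow_of_nonneg hp (ha.trans hab)]
    exact Real.rpow_le_rpow ha hab (by linarith)
  intro a b hab
  rcases le_total 0 a with ha | ha
  · exact key a b ha hab
  · rcases le_total 0 b with hb | hb
    · have h1 := signedPow_nonneg (p := p) (neg_nonneg.2 ha)
      rw [signedPow_neg] at h1
      linarith [signedPow_nonneg (p := p) hb]
    · have := key (-b) (-a) (by linarith) (by linarith)
      rw [signedPow_neg, signedPow_neg] at this
      linarith

theorem measurable_signedPow (p : ℝ) : Measurable (signedPow p) := by
  unfold signedPow
  fun_prop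

theorem signedPow_mul {c : ℝ} (hp : 1 < p) (hc : 0 ≤ c) (a : ℝ) :
    signedPow p (c * a) = c ^ (p - 1) * signedPow p a := by
  rw [← signedPow_of_nonneg hp hc]
  simp only [signedPow, abs_mul]
  rw [Real.mul_rpow (abs_nonneg _) (abs_nonneg _)]
  ring

/-- The sum is at most twice the maximum. This crude route covers all `q ≥ 0`, so convex and concave
powers need no separate treatment. -/
theorem add_rpow_le_two_rpow {q a b : ℝ} (hq : 0 ≤ q) (ha : 0 ≤ a) (hb : 0 ≤ b) :
    (a + b) ^ q ≤ 2 ^ q * (a ^ q + b ^ q) := by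
  have h1 : (a + b) ^ q ≤ (2 * max a b) ^ q :=
    Real.rpow_le_rpow (by positivity)
      (by linarith [le_max_left a b, le_max_right a b]) hq
  rw [Real.mul_rpow (by norm_num) (by positivity)] at h1
  refine h1.trans (mul_le_mul_of_nonneg_left ?_ (by positivity))
  rcases le_total a b with h | h
  · rw [max_eq_right h]; linarith [Real.rpow_nonneg ha q]
  · rw [max_eq_left h]; linarith [Real.rpow_nonneg hb q]

/-- Bernoulli's inequality at the ratio `y / x`, i.e. the tangent line bound for a convex power. -/
theorem rpow_sub_rpow_le {q x y : ℝ} (hq : 1 ≤ q) (hy : 0 ≤ y) (hyx : y ≤ x) :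
    x ^ q - y ^ q ≤ q * x ^ (q - 1) * (x - y) := by
  rcases (hy.trans hyx).eq_or_lt with rfl | hx
  · have : y = 0 := le_antisymm hyx hy
    simp [this]
  have h := one_add_mul_self_le_rpow_one_add (s := (y - x) / x) (p := q)
    (by rw [le_div_iff₀ hx]; linarith) hq
  have e : 1 + (y - x) / x = y / x := by field_simp; ring
  rw [e, Real.div_rpow hy hx.le, le_div_iff₀ (by positivity)] at h
  have e2 : x ^ q = x ^ (q - 1) * x := by
    nth_rw 3 [← Real.rpow_one x]
    rw [← Real.rpow_add hx]; congr 1; ring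
  have e3 : (1 + q * ((y - x) / x)) * x ^ q = x ^ q - q * x ^ (q - 1) * (x - y) := by
    rw [e2]; field_simp; ring
  linarith

/-- Increment bound for the signed power in the degenerate range. -/
theorem signedPow_add_le_of_two_le (hp : 2 ≤ p) {b d M : ℝ} (hd : 0 ≤ d) (hM : |b| + d ≤ M) :
    signedPow p (b + d) ≤ signedPow p b + (p - 1) * M ^ (p - 2) * d := by
  have hp1 : 1 < p := by linarith
  have hM0 : 0 ≤ M := by linarith [abs_nonneg b]
  have key : ∀ x y : ℝ, 0 ≤ y → y ≤ x → x ≤ M →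
      x ^ (p - 1) - y ^ (p - 1) ≤ (p - 1) * M ^ (p - 2) * (x - y) := fun x y hy hyx hxM ↦ by
    refine (rpow_sub_rpow_le (by linarith) hy hyx).trans ?_
    have : x ^ (p - 1 - 1) ≤ M ^ (p - 2) := by
      rw [show p - 1 - 1 = p - 2 by ring]
      exact Real.rpow_le_rpow (hy.trans hyx) hxM (by linarith)
    have h1 : (0 : ℝ) ≤ p - 1 := by linarith
    have h2 : 0 ≤ x - y := by linarith
    gcongr
  rcases le_total 0 b with hb | hb
  · rw [signedPow_of_nonneg hp1 (by linarith), signedPow_of_nonneg hp1 hb]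
    have := key (b + d) b hb (by linarith) (by rwa [abs_of_nonneg hb] at hM)
    rw [add_sub_cancel_left] at this
    linarith
  rw [abs_of_nonpos hb] at hM
  have e : signedPow p b = -(-b) ^ (p - 1) := by
    rw [← signedPow_of_nonneg hp1 (neg_nonneg.2 hb), signedPow_neg, neg_neg]
  rcases le_total 0 (b + d) with hbd | hbd
  · have h1 := key (b + d) 0 le_rfl hbd (by linarith)
    have h2 := key (-b) 0 le_rfl (by linarith) (by linarith)
    rw [Real.zero_rpow (by linarith)] at h1 h2
    rw [signedPow_of_nonneg hp1 hbd, e]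
    linarith
  · have e' : signedPow p (b + d) = -(-(b + d)) ^ (p - 1) := by
      rw [← signedPow_of_nonneg hp1 (neg_nonneg.2 hbd), signedPow_neg, neg_neg]
    have h1 := key (-b) (-(b + d)) (by linarith) (by linarith) (by linarith)
    rw [e, e']
    linarith

theorem rpow_le_one_add {q t : ℝ} (hq0 : 0 < q) (hq1 : q ≤ 1) (ht : 0 ≤ t) : t ^ q ≤ max 1 t := by
  rcases le_total t 1 with h | h
  · exact (Real.rpow_le_one ht h hq0.le).trans (le_max_left _ _)
  · refine le_trans ?_ (le_max_right _ _)
    calc t ^ q ≤ t ^ (1 : ℝ) := Real.rpow_le_rpow_of_exponent_le h hq1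
      _ = t := Real.rpow_one t

/-- Increment bound for the signed power in the singular range. -/
theorem signedPow_add_le_of_le_two (hp1 : 1 < p) (hp : p ≤ 2) {b d : ℝ} (hd : 0 ≤ d)
    (hb : b ≠ 0) :
    signedPow p (b + d) ≤ signedPow p b + 2 * |b| ^ (p - 2) * d := by
  have hq0 : 0 < p - 1 := by linarith
  have hq1 : p - 1 ≤ 1 := by linarith
  -- By homogeneity only the base points `1` and `-1` matter.
  have unit : ∀ t : ℝ, 0 ≤ t → signedPow p (1 + t) ≤ 1 + 2 * t ∧
      signedPow p (-1 + t) ≤ -1 + 2 * t := fun t ht ↦ by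
    constructor
    · rw [signedPow_of_nonneg hp1 (by linarith)]
      have := rpow_le_one_add hq0 hq1 (by linarith : 0 ≤ 1 + t)
      rw [max_eq_right (by linarith)] at this
      linarith
    · rcases le_total 1 t with h | h
      · rw [signedPow_of_nonneg hp1 (by linarith)]
        have := rpow_le_one_add hq0 hq1 (by linarith : 0 ≤ -1 + t)
        have h3 : max 1 (-1 + t) ≤ t := max_le h (by linarith)
        linarith
      · have h1 : signedPow p (-1 + t) = -(1 - t) ^ (p - 1) := by
          rw [← signedPow_of_nonneg hp1 (by linarith), ← signedPow_neg]; congr 1; ring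
        have h2 : (1 - t) ^ (1 : ℝ) ≤ (1 - t) ^ (p - 1) :=
          Real.rpow_le_rpow_of_exponent_ge' (by linarith) (by linarith) hq0.le hq1
        rw [Real.rpow_one] at h2
        rw [h1]; linarith
  have hb0 : 0 < |b| := abs_pos.2 hb
  have e1 : |b| ^ (p - 1) = |b| ^ (p - 2) * |b| := by
    nth_rw 3 [← Real.rpow_one |b|]
    rw [← Real.rpow_add hb0]; congr 1; ring
  have hs : |b| * (b / |b|) = b := by field_simp
  have hd' : |b| * (d / |b|) = d := by field_simp
  have e2 : signedPow p (b + d) = |b| ^ (p - 1) * signedPow p (b / |b| + d / |b|) := by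
    rw [← signedPow_mul hp1 hb0.le, mul_add, hs, hd']
  have e3 : signedPow p b = |b| ^ (p - 1) * signedPow p (b / |b|) := by
    rw [← signedPow_mul hp1 hb0.le, hs]
  have e4 : 2 * |b| ^ (p - 2) * d = |b| ^ (p - 1) * (2 * (d / |b|)) := by
    rw [e1]; field_simp
  rw [e2, e3, e4, ← mul_add]
  refine mul_le_mul_of_nonneg_left ?_ (by positivity)
  have hu := unit (d / |b|) (by positivity)
  have hone : signedPow p 1 = 1 := by simp [signedPow]
  rcases lt_or_gt_of_ne hb with h | h
  · have : b / |b| = -1 := by rw [abs_of_neg h]; field_simp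
    rw [this, signedPow_neg, hone]; exact hu.2
  · have : b / |b| = 1 := by rw [abs_of_pos h]; field_simp
    rw [this, hone]; exact hu.1

/-- One-sided second order Taylor bound for a natural power. -/
theorem exists_add_pow_le (n : ℕ) : ∃ C : ℝ, 0 ≤ C ∧ ∀ t : ℝ, 0 ≤ 1 + t → t ≤ 3 →
    (1 + t) ^ n ≤ 1 + n * t + C * t ^ 2 := by
  induction n with
  | zero => exact ⟨0, le_rfl, fun t _ _ ↦ by simp⟩
  | succ m ih =>
    obtain ⟨C, hC, h⟩ := ih
    -- Multiplying the inductive bound by `1 + t` produces `m t ^ 2` and `C t ^ 2 (1 + t)`, and `1 +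
    -- t ≤ 4`.
    refine ⟨m + 4 * C, by positivity, fun t h0 h3 ↦ ?_⟩
    have h1 := mul_le_mul_of_nonneg_right (h t h0 h3) h0
    rw [pow_succ]
    push_cast
    have h2 : C * t ^ 2 * (1 + t) ≤ C * t ^ 2 * 4 :=
      mul_le_mul_of_nonneg_left (by linarith) (by positivity)
    nlinarith

end RealInequalities

/-! ### Integrability and scaling of the singular kernel. -/

section Kernels

variable {N : ℕ} {s p : ℝ}

theorem kernel_exponent_pos (hs : s ∈ Ioo (0 : ℝ) 1) (hp : 1 < p) : 0 < (N : ℝ) + p * s := by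
  have := mul_pos (by linarith : 0 < p) hs.1
  positivity

theorem finrank_E : Module.finrank ℝ (E N) = N := by simp

/-- The kernel is integrable away from the origin. -/
theorem integrableOn_kernel_compl_ball (hs : s ∈ Ioo (0 : ℝ) 1) (hp : 1 < p) {ε : ℝ} (hε : 0 < ε) :
    IntegrableOn (fun h : E N ↦ 1 / ‖h‖ ^ ((N : ℝ) + p * s)) (ball 0 ε)ᶜ := by
  have hD := kernel_exponent_pos (N := N) hs hp
  have h1 : Integrable (fun h : E N ↦ (1 + ‖h‖) ^ (-((N : ℝ) + p * s))) := by
    refine integrable_one_add_norm ?_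
    rw [finrank_E]
    linarith [mul_pos (by linarith : 0 < p) hs.1]
  have h2 := (h1.const_mul ((ε / (1 + ε)) ^ (-((N : ℝ) + p * s)))).integrableOn (s := (ball 0 ε)ᶜ)
  refine Integrable.mono' h2 (Measurable.aestronglyMeasurable (by fun_prop)) ?_
  filter_upwards [ae_restrict_mem measurableSet_ball.compl] with h hh
  have hh : ε ≤ ‖h‖ := by simpa using hh
  have hpos : 0 < ‖h‖ := by linarith
  rw [Real.norm_of_nonneg (by positivity), ← Real.mul_rpow (by positivity) (by positivity),
    one_div, ← Real.rpow_neg hpos.le]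
  refine Real.rpow_le_rpow_of_nonpos (by positivity) ?_ (by linarith)
  rw [div_mul_eq_mul_div, div_le_iff₀ (by positivity)]
  nlinarith

theorem integrableOn_rpow_ball (hN : 1 < N) (hs : s ∈ Ioo (0 : ℝ) 1) (hp : 1 < p) (ρ : ℝ) :
    IntegrableOn (fun h : E N ↦ ‖h‖ ^ p / ‖h‖ ^ ((N : ℝ) + p * s)) (ball 0 ρ) := by
  refine integrableOn_ball_of_norm_le_rpow (C := 1) (α := (N : ℝ) + p * s - p) ?_ ?_ ?_
    (Measurable.aestronglyMeasurable (by fun_prop))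
  · rw [finrank_E]; omega
  · rw [finrank_E]; nlinarith [hs.1, hs.2]
  · refine Filter.Eventually.of_forall fun h ↦ ?_
    rw [Real.norm_of_nonneg (by positivity), one_mul]
    rcases (norm_nonneg h).eq_or_lt with h0 | h0
    · rw [← h0, Real.zero_rpow (by linarith : p ≠ 0), zero_div]
      positivity
    · rw [← Real.rpow_sub h0]
      exact le_of_eq (by congr 1; ring)

/-- The integrand is dominated by a product of one-variable powers. The factor `‖h‖ ^ (-(N + ps -
2))` is shared among the coordinates, each share being bounded through `|h i| ≤ ‖h‖`. Integrability
then requires every one-dimensional exponent to exceed `-1`. -/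
theorem integrableOn_coordinate_rpow_ball (hN : 1 < N) (hs : s ∈ Ioo (0 : ℝ) 1) (hp : 1 < p)
    (hp2 : p < 2) (i₀ : Fin N) :
    IntegrableOn (fun h : E N ↦ ‖h‖ ^ (2 : ℝ) * |h i₀| ^ (p - 2) / ‖h‖ ^ ((N : ℝ) + p * s))
      (ball 0 1) := by
  have hps : 0 < p * s := mul_pos (by linarith) hs.1
  have hpsp : p * s < p := by nlinarith [hs.2]
  have hN1 : (1 : ℝ) ≤ (N : ℝ) - 1 := by
    have : (2 : ℝ) ≤ N := by exact_mod_cast hN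
    linarith
  -- The coordinate `i₀` receives the share `γ₀` and each other coordinate `γ`. The lower bounds on
  -- `τ` give `γ₀ > 0` and `γ < 1`; the upper bounds give `γ > 0` and `p - 2 - γ₀ > -1`. The
  -- interval is nonempty because `0 < ps < p` and `p > 1`.
  obtain ⟨τ, hτ1, hτ2⟩ : ∃ τ, max 0 (1 - p * s) < τ ∧ τ < min 1 (p - p * s) :=
    exists_between (by simp only [max_lt_iff, lt_min_iff]; refine ⟨⟨?_, ?_⟩, ?_, ?_⟩ <;> linarith)
  rw [max_lt_iff] at hτ1
  rw [lt_min_iff] at hτ2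
  set γ₀ : ℝ := p * s - 1 + τ with hγ₀
  set γ : ℝ := 1 - τ / ((N : ℝ) - 1) with hγ
  have hτN : τ / ((N : ℝ) - 1) ≤ τ := div_le_self hτ1.1.le hN1
  have hτN0 : 0 < τ / ((N : ℝ) - 1) := div_pos hτ1.1 (by linarith)
  have hsum : γ₀ + ((N : ℝ) - 1) * γ = N + p * s - 2 := by
    rw [hγ₀, hγ]; field_simp; ring
  let w : Fin N → ℝ → ℝ := fun i t ↦
    (Ioo (-1 : ℝ) 1).indicator (fun t ↦ |t| ^ (if i = i₀ then p - 2 - γ₀ else -γ)) t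
  have hw : ∀ i, Integrable (w i) := fun i ↦ by
    rw [integrable_indicator_iff measurableSet_Ioo]
    have h1 := integrableOn_ball_of_norm_le_rpow (E := ℝ) (μ := volume) (r := 1) (C := 1)
      (α := -(if i = i₀ then p - 2 - γ₀ else -γ))
      (f := fun t ↦ |t| ^ (if i = i₀ then p - 2 - γ₀ else -γ)) (by simp)
      (by rw [Module.finrank_self]; split_ifs <;> push_cast <;> linarith)
      (Filter.Eventually.of_forall fun t ↦ by
        rw [Real.norm_of_nonneg (by positivity)]; simp)
      (Measurable.aestronglyMeasurable (by fun_prop))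
    rwa [Real.ball_eq_Ioo, zero_sub, zero_add] at h1
  have hprod : Integrable (fun x : Fin N → ℝ ↦ ∏ i, w i (x i)) := Integrable.fintype_prod hw
  have hprod' : Integrable (fun x : E N ↦ ∏ i, w i (x i)) :=
    ((PiLp.volume_preserving_ofLp (Fin N)).integrable_comp_emb
      (MeasurableEquiv.toLp 2 (Fin N → ℝ)).symm.measurableEmbedding).2 hprod
  refine Integrable.mono' hprod'.integrableOn (Measurable.aestronglyMeasurable (by fun_prop)) ?_
  -- Monotonicity of negative powers needs positive bases, so the coordinate hyperplanes are
  -- discarded.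
  have hne : ∀ᵐ h : E N, ∀ i, h i ≠ 0 := by
    rw [ae_all_iff]
    intro i
    have h1 : ∀ᵐ x : Fin N → ℝ, x i ≠ 0 := by
      have h3 : volume (Function.eval i ⁻¹' {(0 : ℝ)} : Set (Fin N → ℝ)) = 0 :=
        (Measure.quasiMeasurePreserving_eval (fun _ : Fin N ↦ (volume : Measure ℝ)) i).preimage_null
          (by simp)
      rw [ae_iff]
      convert h3 using 2
      ext x; simp
    exact (PiLp.volume_preserving_ofLp (Fin N)).quasiMeasurePreserving.ae h1
  filter_upwards [ae_restrict_mem measurableSet_ball, ae_restrict_of_ae hne] with h hh hh0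
  have hh : ‖h‖ < 1 := by simpa using hh
  have hle : ∀ i, |h i| ≤ ‖h‖ := fun i ↦ PiLp.norm_apply_le h i
  have hpos : ∀ i, 0 < |h i| := fun i ↦ abs_pos.2 (hh0 i)
  have hnpos : 0 < ‖h‖ := (hpos i₀).trans_le (hle i₀)
  rw [Real.norm_of_nonneg (by positivity)]
  have hval : ∀ i, w i (h i) = |h i| ^ (if i = i₀ then p - 2 - γ₀ else -γ) := fun i ↦
    indicator_of_mem (by rw [mem_Ioo, ← abs_lt]; exact (hle i).trans_lt hh) _
  simp only [hval]
  rw [← Finset.mul_prod_erase _ _ (Finset.mem_univ i₀), if_pos rfl]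
  have hpr : ∏ i ∈ Finset.univ.erase i₀, ‖h‖ ^ (-γ) ≤
      ∏ i ∈ Finset.univ.erase i₀, |h i| ^ (if i = i₀ then p - 2 - γ₀ else -γ) := by
    refine Finset.prod_le_prod (fun i _ ↦ by positivity) fun i hi ↦ ?_
    rw [if_neg (Finset.ne_of_mem_erase hi)]
    exact Real.rpow_le_rpow_of_nonpos (hpos i) (hle i) (by linarith)
  rw [Finset.prod_const, Finset.card_erase_of_mem (Finset.mem_univ _), Finset.card_univ,
    Fintype.card_fin, ← Real.rpow_mul_natCast hnpos.le, Nat.cast_sub hN.le, Nat.cast_one] at hpr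
  have h0 : ‖h‖ ^ (-γ₀) ≤ |h i₀| ^ (-γ₀) :=
    Real.rpow_le_rpow_of_nonpos (hpos i₀) (hle i₀) (by linarith)
  have e1 : ‖h‖ ^ (2 : ℝ) * |h i₀| ^ (p - 2) / ‖h‖ ^ ((N : ℝ) + p * s)
      = |h i₀| ^ (p - 2) * (‖h‖ ^ (-γ₀) * ‖h‖ ^ (-γ * ((N : ℝ) - 1))) := by
    rw [mul_comm, mul_div_assoc, ← Real.rpow_sub hnpos, ← Real.rpow_add hnpos]
    congr 2
    linarith
  have e2 : |h i₀| ^ (p - 2 - γ₀) = |h i₀| ^ (p - 2) * |h i₀| ^ (-γ₀) := by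
    rw [← Real.rpow_add (hpos i₀)]; congr 1
  rw [e1, e2, mul_assoc]
  gcongr

theorem exists_linearIsometryEquiv_apply_eq (e f : E N) (h : ‖e‖ = ‖f‖) :
    ∃ U : E N ≃ₗᵢ[ℝ] E N, U e = f :=
  ⟨_, Submodule.reflection_sub h⟩

/-- The directional singular weight has an integral that is bounded uniformly in the direction. -/
theorem exists_integral_inner_rpow_le (hN : 1 < N) (hs : s ∈ Ioo (0 : ℝ) 1) (hp : 1 < p)
    (hp2 : p < 2) : ∃ C : ℝ, 0 ≤ C ∧ ∀ e : E N, ‖e‖ = 1 →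
      IntegrableOn (fun h : E N ↦ ‖h‖ ^ (2 : ℝ) * |inner ℝ e h| ^ (p - 2) /
        ‖h‖ ^ ((N : ℝ) + p * s)) (ball 0 1) ∧
      ∫ h in ball (0 : E N) 1, ‖h‖ ^ (2 : ℝ) * |inner ℝ e h| ^ (p - 2) /
        ‖h‖ ^ ((N : ℝ) + p * s) ≤ C := by
  let i₀ : Fin N := ⟨0, by omega⟩
  have hint := integrableOn_coordinate_rpow_ball hN hs hp hp2 i₀
  refine ⟨∫ h in ball (0 : E N) 1, ‖h‖ ^ (2 : ℝ) * |h i₀| ^ (p - 2) / ‖h‖ ^ ((N : ℝ) + p * s),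
    integral_nonneg fun h ↦ by simp only [Pi.zero_apply]; positivity, fun e he ↦ ?_⟩
  · obtain ⟨U, hU⟩ := exists_linearIsometryEquiv_apply_eq e (EuclideanSpace.single i₀ (1 : ℝ))
      (by simp [he])
    have hpre : U ⁻¹' ball (0 : E N) 1 = ball 0 1 := by ext; simp
    have hinn : ∀ h, inner ℝ e h = (U h) i₀ := fun h ↦ by
      rw [← U.inner_map_map, hU, EuclideanSpace.inner_single_left]; simp
    have h1 := (U.measurePreserving.integrableOn_comp_preimage
      U.toHomeomorph.measurableEmbedding).2 hint
    have h2 := U.measurePreserving.setIntegral_preimage_emb U.toHomeomorph.measurableEmbedding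
      (fun h : E N ↦ ‖h‖ ^ (2 : ℝ) * |h i₀| ^ (p - 2) / ‖h‖ ^ ((N : ℝ) + p * s)) (ball 0 1)
    rw [hpre] at h1 h2
    simp only [Function.comp_def, LinearIsometryEquiv.norm_map, ← hinn] at h1 h2
    exact ⟨h1, h2.le⟩

/-- Scaling of weighted kernel integrals over complements of balls. -/
theorem lintegral_compl_ball_kernel_scale (f : ℝ → ℝ≥0∞) (x₀ : E N) {ρ : ℝ} (hρ : 0 < ρ) :
    ∫⁻ y in (ball x₀ ρ)ᶜ, f (‖y - x₀‖ / ρ) * ENNReal.ofReal (1 / ‖y - x₀‖ ^ ((N : ℝ) + p * s)) =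
      ENNReal.ofReal (ρ ^ (-(p * s))) *
        ∫⁻ h in (ball (0 : E N) 1)ᶜ, f ‖h‖ * ENNReal.ofReal (1 / ‖h‖ ^ ((N : ℝ) + p * s)) := by
  set G : E N → ℝ≥0∞ := (ball (0 : E N) ρ)ᶜ.indicator
    (fun y ↦ f (‖y‖ / ρ) * ENNReal.ofReal (1 / ‖y‖ ^ ((N : ℝ) + p * s))) with hG
  have h1 : ∫⁻ y in (ball x₀ ρ)ᶜ, f (‖y - x₀‖ / ρ) *
      ENNReal.ofReal (1 / ‖y - x₀‖ ^ ((N : ℝ) + p * s)) = ∫⁻ y, G y := by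
    rw [← lintegral_sub_right_eq_self G x₀, ← lintegral_indicator measurableSet_ball.compl]
    congr 1; ext y
    simp only [hG, indicator, mem_compl_iff, mem_ball, dist_eq_norm, sub_zero]
  have h2 : ∫⁻ h, G (ρ • h) = ENNReal.ofReal (|(ρ ^ N)⁻¹|) * ∫⁻ y, G y := by
    have := Measure.map_addHaar_smul (volume : Measure (E N)) hρ.ne'
    rw [finrank_E] at this
    rw [← smul_eq_mul, ← lintegral_smul_measure, ← this]
    exact (lintegral_map_equiv G (Homeomorph.smulOfNeZero ρ hρ.ne').toMeasurableEquiv).symm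
  have h3 : ∀ h : E N, G (ρ • h) = ENNReal.ofReal (ρ ^ (-((N : ℝ) + p * s))) *
      (ball (0 : E N) 1)ᶜ.indicator
        (fun h ↦ f ‖h‖ * ENNReal.ofReal (1 / ‖h‖ ^ ((N : ℝ) + p * s))) h := fun h ↦ by
    have hn : ‖ρ • h‖ = ρ * ‖h‖ := by rw [norm_smul, Real.norm_of_nonneg hρ.le]
    simp only [hG, indicator, mem_compl_iff, mem_ball, dist_eq_norm, sub_zero, hn]
    have : ρ * ‖h‖ < ρ ↔ ‖h‖ < 1 := by
      constructor <;> intro h <;> nlinarith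
    simp only [this]
    split_ifs with hc
    · simp
    · rw [mul_div_cancel_left₀ _ hρ.ne', Real.mul_rpow hρ.le (norm_nonneg _), Real.rpow_neg hρ.le,
        one_div, mul_inv, ENNReal.ofReal_mul (by positivity), one_div]
      ring
  rw [h1]
  simp only [h3] at h2
  rw [lintegral_const_mul' _ _ ENNReal.ofReal_ne_top,
    lintegral_indicator measurableSet_ball.compl] at h2
  have hρN : 0 < ρ ^ N := by positivity
  have h4 : ∫⁻ y, G y = ENNReal.ofReal (ρ ^ N) * (ENNReal.ofReal |(ρ ^ N)⁻¹| * ∫⁻ y, G y) := by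
    rw [← mul_assoc, ← ENNReal.ofReal_mul hρN.le, abs_of_pos (by positivity),
      mul_inv_cancel₀ hρN.ne', ENNReal.ofReal_one, one_mul]
  rw [h4, ← h2, ← mul_assoc, ← ENNReal.ofReal_mul hρN.le]
  congr 2
  rw [← Real.rpow_natCast, ← Real.rpow_add hρ]
  congr 1; ring

end Kernels

/-! ### The barrier profile and its truncated fractional p-Laplacian. -/

section Bump

variable {N : ℕ} {s p : ℝ}

/-- The barrier profile `1 - |z|^{2(m+1)}`, truncated at `0`. -/
def bump (m : ℕ) (z : E N) : ℝ := 1 - min 1 ‖z‖ ^ (2 * (m + 1))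

theorem bump_nonneg (m : ℕ) (z : E N) : 0 ≤ bump m z :=
  sub_nonneg.2 (pow_le_one₀ (by positivity) (min_le_left _ _))

theorem bump_le_one (m : ℕ) (z : E N) : bump m z ≤ 1 :=
  sub_le_self _ (by positivity)

theorem bump_eq_zero (m : ℕ) {z : E N} (hz : 1 ≤ ‖z‖) : bump m z = 0 := by
  simp [bump, min_eq_left hz]

theorem bump_of_norm_le (m : ℕ) {z : E N} (hz : ‖z‖ ≤ 1) :
    bump m z = 1 - ‖z‖ ^ (2 * (m + 1)) := by
  simp [bump, min_eq_right hz]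

theorem one_sub_norm_pow_le_bump (m : ℕ) (z : E N) : 1 - ‖z‖ ^ (2 * (m + 1)) ≤ bump m z := by
  have : min 1 ‖z‖ ^ (2 * (m + 1)) ≤ ‖z‖ ^ (2 * (m + 1)) :=
    pow_le_pow_left₀ (by positivity) (min_le_right _ _) _
  unfold bump; linarith

theorem half_le_bump (m : ℕ) {z : E N} (hz : ‖z‖ ≤ 1 / 2) : 1 / 2 ≤ bump m z := by
  have h1 : ‖z‖ ^ (2 * (m + 1)) ≤ ‖z‖ ^ 1 :=
    pow_le_pow_of_le_one (norm_nonneg _) (by linarith) (by omega)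
  have := one_sub_norm_pow_le_bump m z
  rw [pow_one] at h1
  linarith

theorem abs_pow_sub_pow_le_of_le_one (k : ℕ) {a b : ℝ} (ha : 0 ≤ a) (ha1 : a ≤ 1) (hb : 0 ≤ b)
    (hb1 : b ≤ 1) : |a ^ k - b ^ k| ≤ k * |a - b| := by
  induction k with
  | zero => simp
  | succ k ih =>
    have e : a ^ (k + 1) - b ^ (k + 1) = a * (a ^ k - b ^ k) + (a - b) * b ^ k := by ring
    rw [e]
    refine (abs_add_le _ _).trans ?_
    rw [abs_mul, abs_mul, abs_of_nonneg ha, abs_of_nonneg (by positivity : 0 ≤ b ^ k)]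
    have h1 : a * |a ^ k - b ^ k| ≤ |a ^ k - b ^ k| := mul_le_of_le_one_left (abs_nonneg _) ha1
    have h2 : |a - b| * b ^ k ≤ |a - b| :=
      mul_le_of_le_one_right (abs_nonneg _) (pow_le_one₀ hb hb1)
    push_cast
    linarith

theorem abs_bump_sub_le (m : ℕ) (z w : E N) :
    |bump m z - bump m w| ≤ (2 * (m + 1) : ℕ) * ‖z - w‖ := by
  have h := abs_pow_sub_pow_le_of_le_one (2 * (m + 1)) (a := min 1 ‖w‖) (b := min 1 ‖z‖)
    (by positivity) (min_le_left _ _) (by positivity) (min_le_left _ _)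
  have e : bump m z - bump m w = min 1 ‖w‖ ^ (2 * (m + 1)) - min 1 ‖z‖ ^ (2 * (m + 1)) := by
    unfold bump; ring
  rw [e]
  refine h.trans (mul_le_mul_of_nonneg_left ?_ (by positivity))
  have h2 : |min 1 ‖w‖ - min 1 ‖z‖| ≤ max |1 - 1| |‖w‖ - ‖z‖| := abs_min_sub_min_le_max _ _ _ _
  rw [sub_self, abs_zero, max_eq_right (abs_nonneg _)] at h2
  exact h2.trans ((abs_norm_sub_norm_le w z).trans (norm_sub_rev w z).le)

theorem measurable_bump (m : ℕ) : Measurable (bump m : E N → ℝ) := by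
  unfold bump; fun_prop

/-- Second order upper bound for the increments of `|z|^{2(m+1)}` away from the origin. -/
theorem exists_norm_add_pow_sub_le (m : ℕ) : ∃ C : ℝ, 0 ≤ C ∧ ∀ z h : E N, ‖h‖ < ‖z‖ →
    ‖z + h‖ ^ (2 * (m + 1)) - ‖z‖ ^ (2 * (m + 1)) ≤
      2 * (m + 1) * ‖z‖ ^ (2 * m) * inner ℝ z h + C * ‖z‖ ^ (2 * m) * ‖h‖ ^ 2 := by
  obtain ⟨C, hC, hpow⟩ := exists_add_pow_le (m + 1)
  -- With `T = ‖z + h‖² - ‖z‖²`, the term `m + 1` comes from the `‖h‖²` contained in `T`, and `9 C`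
  -- from `T² ≤ 9 ‖z‖² ‖h‖²`. The hypothesis `‖h‖ < ‖z‖` keeps `T / ‖z‖²` below `3`.
  refine ⟨(m + 1) + 9 * C, by positivity, fun z h hh ↦ ?_⟩
  have hz : 0 < ‖z‖ := (norm_nonneg h).trans_lt hh
  set T := 2 * inner ℝ z h + ‖h‖ ^ 2 with hT
  have hsq : ‖z + h‖ ^ 2 = ‖z‖ ^ 2 + T := by rw [norm_add_sq_real]; ring
  have hcs := abs_le.1 (abs_real_inner_le_norm z h)
  have hT1 : T ≤ 3 * (‖z‖ * ‖h‖) := by nlinarith [norm_nonneg h]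
  have hT2 : -(3 * (‖z‖ * ‖h‖)) ≤ T := by nlinarith [norm_nonneg h, sq_nonneg ‖h‖]
  have hTsq : T ^ 2 ≤ 9 * (‖z‖ ^ 2 * ‖h‖ ^ 2) := by
    have := abs_le_abs (a := T) (b := 3 * (‖z‖ * ‖h‖)) hT1 (by linarith)
    have := sq_le_sq.2 this
    nlinarith
  have hone : 1 + T / ‖z‖ ^ 2 = ‖z + h‖ ^ 2 / ‖z‖ ^ 2 := by rw [hsq]; field_simp
  have h1 := hpow (T / ‖z‖ ^ 2) (by rw [hone]; positivity)
    (by rw [div_le_iff₀ (by positivity)]; nlinarith)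
  rw [hone, div_pow, ← pow_mul, ← pow_mul, div_le_iff₀ (by positivity)] at h1
  have e1 : (1 + ((m + 1 : ℕ) : ℝ) * (T / ‖z‖ ^ 2) + C * (T / ‖z‖ ^ 2) ^ 2) * ‖z‖ ^ (2 * (m + 1))
      = ‖z‖ ^ (2 * (m + 1)) + (m + 1) * ‖z‖ ^ (2 * m) * T
        + C * ‖z‖ ^ (2 * m) * (T ^ 2 / ‖z‖ ^ 2) := by
    rw [show 2 * (m + 1) = 2 * m + 2 by ring, pow_add]
    push_cast
    field_simp
  have h2 : T ^ 2 / ‖z‖ ^ 2 ≤ 9 * ‖h‖ ^ 2 := by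
    rw [div_le_iff₀ (by positivity)]; linarith
  have h3 : C * ‖z‖ ^ (2 * m) * (T ^ 2 / ‖z‖ ^ 2) ≤ C * ‖z‖ ^ (2 * m) * (9 * ‖h‖ ^ 2) :=
    mul_le_mul_of_nonneg_left h2 (by positivity)
  rw [e1] at h1
  rw [hT] at h1
  linarith

/-- Truncation can only raise the bump at `z + h`, so upper bounds for the increment may use the
untruncated polynomial. -/
theorem bump_sub_bump_le (m : ℕ) {z : E N} (hz : ‖z‖ < 1) (h : E N) :
    bump m z - bump m (z + h) ≤ ‖z + h‖ ^ (2 * (m + 1)) - ‖z‖ ^ (2 * (m + 1)) := by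
  rw [bump_of_norm_le m hz.le]
  linarith [one_sub_norm_pow_le_bump m (z + h)]

/-- Near the critical point `z = 0` no expansion is needed: the increment is at most
`(2‖h‖)^{2(m+1)}`, and `hm` says precisely that its `(p-1)`-th power decays at least as fast as
`‖h‖^p`. -/
theorem signedPow_bump_sub_le_far (hp : 1 < p) {m : ℕ}
    (hm : p ≤ (2 * (m + 1) : ℕ) * (p - 1)) {z h : E N} (hz : ‖z‖ < 1) (hh : ‖h‖ < 1)
    (hzh : ‖z‖ ≤ ‖h‖) :
    signedPow p (bump m z - bump m (z + h)) ≤ (2 ^ (2 * (m + 1)) : ℝ) ^ (p - 1) * ‖h‖ ^ p := by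
  have h1 : bump m z - bump m (z + h) ≤ 2 ^ (2 * (m + 1)) * ‖h‖ ^ (2 * (m + 1)) := by
    refine (bump_sub_bump_le m hz h).trans ?_
    have : ‖z + h‖ ^ (2 * (m + 1)) ≤ (2 * ‖h‖) ^ (2 * (m + 1)) :=
      pow_le_pow_left₀ (norm_nonneg _) ((norm_add_le z h).trans (by linarith)) _
    rw [mul_pow] at this
    have h0 : 0 ≤ ‖z‖ ^ (2 * (m + 1)) := by positivity
    linarith
  refine (signedPow_mono hp h1).trans ?_
  rw [signedPow_mul hp (by positivity), signedPow_of_nonneg hp (by positivity)]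
  refine mul_le_mul_of_nonneg_left ?_ (by positivity)
  rw [← Real.rpow_natCast, ← Real.rpow_mul (norm_nonneg _)]
  exact Real.rpow_le_rpow_of_exponent_ge_of_imp (norm_nonneg _) hh.le hm
    fun _ ↦ by intro h; linarith

/-- For `‖h‖ < ‖z‖` the increment is at most a linear term of size `‖h‖` plus an error of size
`‖h‖²`. The signed power has slope of order `‖h‖^{p-2}` on that scale, so the error becomes `‖h‖^p`.
The linear term is kept intact because it is odd in `h`. -/
theorem exists_bump_pointwise_of_two_le (hp : 2 ≤ p) {m : ℕ}
    (hm : p ≤ (2 * (m + 1) : ℕ) * (p - 1)) : ∃ C : ℝ, 0 ≤ C ∧ ∀ z h : E N, ‖z‖ < 1 → ‖h‖ < 1 →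
      signedPow p (bump m z - bump m (z + h)) ≤
        (if ‖h‖ < ‖z‖ then signedPow p (2 * (m + 1) * ‖z‖ ^ (2 * m) * inner ℝ z h) else 0)
          + C * ‖h‖ ^ p := by
  have hp1 : 1 < p := by linarith
  obtain ⟨C, hC, hT⟩ := exists_norm_add_pow_sub_le (N := N) m
  set C₁ : ℝ := (p - 1) * (2 * (m + 1) + C) ^ (p - 2) * C with hC₁
  set C₂ : ℝ := (2 ^ (2 * (m + 1)) : ℝ) ^ (p - 1) with hC₂
  have hC₁0 : 0 ≤ C₁ := by
    have : (0 : ℝ) ≤ p - 1 := by linarith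
    positivity
  have hC₂0 : 0 ≤ C₂ := by positivity
  refine ⟨C₁ + C₂, by positivity, fun z h hz hh ↦ ?_⟩
  have hhp : 0 ≤ ‖h‖ ^ p := by positivity
  split_ifs with hzh
  · refine (signedPow_mono hp1 ((bump_sub_bump_le m hz h).trans (hT z h hzh))).trans ?_
    have hz2 : ‖z‖ ^ (2 * m) ≤ 1 := pow_le_one₀ (norm_nonneg _) hz.le
    have hcs := abs_real_inner_le_norm z h
    have hcs' : |inner ℝ z h| ≤ ‖h‖ :=
      hcs.trans (mul_le_of_le_one_left (norm_nonneg _) hz.le)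
    have hb : |2 * (m + 1) * ‖z‖ ^ (2 * m) * inner ℝ z h| ≤ 2 * (m + 1) * ‖h‖ := by
      rw [abs_mul, abs_of_nonneg (by positivity : (0 : ℝ) ≤ 2 * (m + 1) * ‖z‖ ^ (2 * m))]
      have : 2 * (m + 1) * ‖z‖ ^ (2 * m) ≤ 2 * ((m : ℝ) + 1) :=
        mul_le_of_le_one_right (by positivity) hz2
      exact mul_le_mul this hcs' (abs_nonneg _) (by positivity)
    have hd : C * ‖z‖ ^ (2 * m) * ‖h‖ ^ 2 ≤ C * ‖h‖ ^ 2 := by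
      have : C * ‖z‖ ^ (2 * m) ≤ C := mul_le_of_le_one_right hC hz2
      gcongr
    have hd' : C * ‖h‖ ^ 2 ≤ C * ‖h‖ :=
      mul_le_mul_of_nonneg_left (pow_le_of_le_one (norm_nonneg _) hh.le (by norm_num)) hC
    refine (signedPow_add_le_of_two_le hp (M := (2 * (m + 1) + C) * ‖h‖) (by positivity)
      (by linarith)).trans ?_
    have hmain : (p - 1) * ((2 * (m + 1) + C) * ‖h‖) ^ (p - 2) * (C * ‖z‖ ^ (2 * m) * ‖h‖ ^ 2) ≤
        C₁ * ‖h‖ ^ p := by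
      have e : C₁ * ‖h‖ ^ p = (p - 1) * ((2 * (m + 1) + C) * ‖h‖) ^ (p - 2) * (C * ‖h‖ ^ 2) := by
        rw [Real.mul_rpow (by positivity) (norm_nonneg _), hC₁]
        rcases (norm_nonneg h).eq_or_lt with h0 | h0
        · rw [← h0, Real.zero_rpow (by linarith : p ≠ 0)]; ring
        · have : ‖h‖ ^ p = ‖h‖ ^ (p - 2) * ‖h‖ ^ 2 := by
            rw [← Real.rpow_natCast, ← Real.rpow_add h0]; congr 1; push_cast; ring
          rw [this]; ring
      rw [e]
      have : (0 : ℝ) ≤ p - 1 := by linarith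
      gcongr
    have := mul_nonneg hC₂0 hhp
    linarith
  · have := signedPow_bump_sub_le_far hp1 hm hz hh (not_lt.1 hzh)
    have := mul_nonneg hC₁0 hhp
    linarith

/-- Here the slope of the signed power at the linear term is of order `(‖z‖^{2m+1} |⟨e, h⟩|)^{p-2}`,
which is unbounded. The factor `‖z‖^{2m}` of the second order error compensates for the negative
power of `‖z‖`, leaving only the directional weight. The unit direction is a separate variable `e`
so that `z = 0` is allowed. -/
theorem exists_bump_pointwise_of_lt_two (hp1 : 1 < p) (hp : p < 2) {m : ℕ}
    (hm : p ≤ (2 * (m + 1) : ℕ) * (p - 1)) : ∃ C : ℝ, 0 ≤ C ∧ ∀ z h e : E N, ‖z‖ < 1 → ‖h‖ < 1 →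
      z = ‖z‖ • e → inner ℝ e h ≠ 0 →
      signedPow p (bump m z - bump m (z + h)) ≤
        (if ‖h‖ < ‖z‖ then signedPow p (2 * (m + 1) * ‖z‖ ^ (2 * m) * inner ℝ z h) else 0)
          + (C * ‖h‖ ^ p + C * (‖h‖ ^ (2 : ℝ) * |inner ℝ e h| ^ (p - 2))) := by
  obtain ⟨C, hC, hT⟩ := exists_norm_add_pow_sub_le (N := N) m
  set C₂ : ℝ := (2 ^ (2 * (m + 1)) : ℝ) ^ (p - 1) with hC₂
  have hC₂0 : 0 ≤ C₂ := by positivity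
  refine ⟨2 * C + C₂, by positivity, fun z h e hz hh he hne ↦ ?_⟩
  have hhp : 0 ≤ ‖h‖ ^ p := by positivity
  have hhe : 0 ≤ ‖h‖ ^ (2 : ℝ) * |inner ℝ e h| ^ (p - 2) := by positivity
  split_ifs with hzh
  · refine (signedPow_mono hp1 ((bump_sub_bump_le m hz h).trans (hT z h hzh))).trans ?_
    have hz0 : 0 < ‖z‖ := (norm_nonneg h).trans_lt hzh
    have hin : inner ℝ z h = ‖z‖ * inner ℝ e h := by
      nth_rw 1 [he]; rw [real_inner_smul_left]
    have hb : 2 * (m + 1) * ‖z‖ ^ (2 * m) * inner ℝ z h ≠ 0 := by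
      rw [hin]; positivity
    refine (signedPow_add_le_of_le_two hp1 hp.le (by positivity) hb).trans ?_
    have hbe : |2 * (m + 1) * ‖z‖ ^ (2 * m) * inner ℝ z h| =
        (2 * (m + 1)) * (‖z‖ ^ (2 * m + 1) * |inner ℝ e h|) := by
      rw [hin, ← mul_assoc, abs_mul, abs_of_nonneg (by positivity)]; ring
    have hpw : |2 * (m + 1) * ‖z‖ ^ (2 * m) * inner ℝ z h| ^ (p - 2) * ‖z‖ ^ (2 * m) ≤
        |inner ℝ e h| ^ (p - 2) := by
      rw [hbe, Real.mul_rpow (x := 2 * ((m : ℝ) + 1)) (by positivity) (by positivity),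
        Real.mul_rpow (x := ‖z‖ ^ (2 * m + 1)) (by positivity) (by positivity)]
      have h1 : (2 * ((m : ℝ) + 1)) ^ (p - 2) ≤ 1 :=
        Real.rpow_le_one_of_one_le_of_nonpos (by linarith [(Nat.cast_nonneg m : (0 : ℝ) ≤ m)])
          (by linarith)
      -- The total exponent `(2m+1)(p-2) + 2m` is nonnegative exactly by `hm`.
      have h2 : (‖z‖ ^ (2 * m + 1)) ^ (p - 2) * ‖z‖ ^ (2 * m) ≤ 1 := by
        rw [← Real.rpow_natCast, ← Real.rpow_natCast, ← Real.rpow_mul hz0.le,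
          ← Real.rpow_add hz0]
        refine Real.rpow_le_one hz0.le hz.le ?_
        push_cast at hm ⊢
        linarith
      calc _ = (2 * ((m : ℝ) + 1)) ^ (p - 2) * ((‖z‖ ^ (2 * m + 1)) ^ (p - 2) * ‖z‖ ^ (2 * m))
            * |inner ℝ e h| ^ (p - 2) := by ring
        _ ≤ 1 * 1 * |inner ℝ e h| ^ (p - 2) := by gcongr
        _ = _ := by ring
    have hmain : 2 * |2 * (m + 1) * ‖z‖ ^ (2 * m) * inner ℝ z h| ^ (p - 2) *
        (C * ‖z‖ ^ (2 * m) * ‖h‖ ^ 2) ≤ 2 * C * (‖h‖ ^ (2 : ℝ) * |inner ℝ e h| ^ (p - 2)) := by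
      rw [Real.rpow_two]
      have := mul_le_mul_of_nonneg_left hpw (by positivity : 0 ≤ 2 * C * ‖h‖ ^ 2)
      linarith
    have := mul_nonneg hC₂0 hhp
    have := mul_nonneg hC₂0 hhe
    have := mul_nonneg hC hhp
    linarith
  · have := signedPow_bump_sub_le_far hp1 hm hz hh (not_lt.1 hzh)
    have := mul_nonneg hC₂0 hhe
    have := mul_nonneg hC hhp
    have := mul_nonneg hC hhe
    linarith

theorem ae_inner_ne_zero {e : E N} (he : e ≠ 0) : ∀ᵐ h : E N, inner ℝ e h ≠ 0 := by
  have h1 : volume ((LinearMap.ker (innerSL ℝ e).toLinearMap : Submodule ℝ (E N)) :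
      Set (E N)) = 0 := by
    refine Measure.addHaar_submodule _ _ fun h ↦ he ?_
    have : e ∈ LinearMap.ker (innerSL ℝ e).toLinearMap := by rw [h]; trivial
    simpa using this
  rw [ae_iff]
  convert h1 using 2
  ext x; simp

/-- The increments of the bump are bounded by an odd function plus an integrable remainder. -/
theorem exists_bump_odd_add_integrable (hN : 1 < N) (hs : s ∈ Ioo (0 : ℝ) 1) (hp : 1 < p) {m : ℕ}
    (hm : p ≤ (2 * (m + 1) : ℕ) * (p - 1)) : ∃ C : ℝ, 0 ≤ C ∧ ∀ z : E N, ‖z‖ < 1 →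
      ∃ w : E N → ℝ, (∀ h, 0 ≤ w h) ∧ IntegrableOn w (ball 0 1) ∧ ∫ h in ball 0 1, w h ≤ C ∧
        ∀ᵐ h : E N, ‖h‖ < 1 →
          signedPow p (bump m z - bump m (z + h)) / ‖h‖ ^ ((N : ℝ) + p * s) ≤
            (if ‖h‖ < ‖z‖ then signedPow p (2 * (m + 1) * ‖z‖ ^ (2 * m) * inner ℝ z h) else 0)
              / ‖h‖ ^ ((N : ℝ) + p * s) + w h := by
  have hint := integrableOn_rpow_ball (N := N) hN hs hp 1
  have hI0 : 0 ≤ ∫ h in ball (0 : E N) 1, ‖h‖ ^ p / ‖h‖ ^ ((N : ℝ) + p * s) :=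
    integral_nonneg fun h ↦ by simp only [Pi.zero_apply]; positivity
  rcases le_or_gt 2 p with hp2 | hp2
  · obtain ⟨C, hC, h⟩ := exists_bump_pointwise_of_two_le (N := N) hp2 hm
    refine ⟨C * ∫ h in ball (0 : E N) 1, ‖h‖ ^ p / ‖h‖ ^ ((N : ℝ) + p * s), by positivity,
      fun z hz ↦ ⟨fun h ↦ C * (‖h‖ ^ p / ‖h‖ ^ ((N : ℝ) + p * s)), fun h ↦ by positivity,
        hint.const_mul C, (integral_const_mul _ _).le, Filter.Eventually.of_forall fun x hx ↦ ?_⟩⟩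
    beta_reduce
    rw [← mul_div_assoc, ← add_div]
    exact div_le_div_of_nonneg_right (h z x hz hx) (by positivity)
  · obtain ⟨C, hC, h⟩ := exists_bump_pointwise_of_lt_two (N := N) hp hp2 hm
    obtain ⟨C', hC', hdir⟩ := exists_integral_inner_rpow_le (N := N) hN hs hp hp2
    refine ⟨C * (∫ h in ball (0 : E N) 1, ‖h‖ ^ p / ‖h‖ ^ ((N : ℝ) + p * s)) + C * C',
      by positivity, fun z hz ↦ ?_⟩
    -- For `z = 0` any unit vector serves.
    obtain ⟨e, he, hze⟩ : ∃ e : E N, ‖e‖ = 1 ∧ z = ‖z‖ • e := by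
      rcases eq_or_ne z 0 with rfl | hz0
      · exact ⟨EuclideanSpace.single ⟨0, by omega⟩ 1, by simp, by simp⟩
      · exact ⟨‖z‖⁻¹ • z, norm_smul_inv_norm hz0, by
          rw [smul_smul, mul_inv_cancel₀ (norm_ne_zero_iff.2 hz0), one_smul]⟩
    obtain ⟨hi, hb⟩ := hdir e he
    refine ⟨fun h ↦ C * (‖h‖ ^ p / ‖h‖ ^ ((N : ℝ) + p * s)) +
      C * (‖h‖ ^ (2 : ℝ) * |inner ℝ e h| ^ (p - 2) / ‖h‖ ^ ((N : ℝ) + p * s)),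
      fun h ↦ by positivity, (hint.const_mul C).add (hi.const_mul C), ?_, ?_⟩
    · rw [integral_add (hint.const_mul C) (hi.const_mul C), integral_const_mul, integral_const_mul]
      gcongr
    · have he0 : e ≠ 0 := by rintro rfl; simp at he
      filter_upwards [ae_inner_ne_zero he0] with x hx hx1
      beta_reduce
      rw [← mul_div_assoc, ← mul_div_assoc, ← add_div, ← add_div]
      exact div_le_div_of_nonneg_right (h z x e hz hx1 hze hx) (by positivity)

theorem abs_signedPow_le_one (hp : 1 < p) {a : ℝ} (ha : |a| ≤ 1) : |signedPow p a| ≤ 1 := by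
  rw [abs_signedPow hp]
  exact Real.rpow_le_one (abs_nonneg _) ha (by linarith)

theorem abs_bump_sub_le_one (m : ℕ) (z w : E N) : |bump m z - bump m w| ≤ 1 := by
  rw [abs_le]
  constructor <;> linarith [bump_nonneg m z, bump_nonneg m w, bump_le_one m z, bump_le_one m w]

theorem integrableOn_bump_kernel (hs : s ∈ Ioo (0 : ℝ) 1) (hp : 1 < p) (m : ℕ) (z : E N) {ε : ℝ}
    (hε : 0 < ε) : IntegrableOn (fun h ↦ signedPow p (bump m z - bump m (z + h)) /
      ‖h‖ ^ ((N : ℝ) + p * s)) (ball 0 ε)ᶜ := by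
  have hP := measurable_signedPow p
  have hb := measurable_bump (N := N) m
  refine Integrable.mono' (integrableOn_kernel_compl_ball hs hp hε)
    (Measurable.aestronglyMeasurable (by fun_prop)) (Filter.Eventually.of_forall fun h ↦ ?_)
  rw [norm_div, Real.norm_eq_abs, Real.norm_of_nonneg (by positivity)]
  exact div_le_div_of_nonneg_right (abs_signedPow_le_one hp (abs_bump_sub_le_one m _ _))
    (by positivity)

/-- Uniform upper bound for the truncated operator applied to the bump. -/
theorem exists_integral_bump_truncated_le (hN : 1 < N) (hs : s ∈ Ioo (0 : ℝ) 1) (hp : 1 < p)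
    {m : ℕ} (hm : p ≤ (2 * (m + 1) : ℕ) * (p - 1)) : ∃ C : ℝ, 0 ≤ C ∧ ∀ z : E N, ‖z‖ < 1 →
      ∀ ε : ℝ, 0 < ε → ∫ h in (ball (0 : E N) ε)ᶜ,
        signedPow p (bump m z - bump m (z + h)) / ‖h‖ ^ ((N : ℝ) + p * s) ≤ C := by
  obtain ⟨C, hC, hbump⟩ := exists_bump_odd_add_integrable (N := N) hN hs hp hm
  have hP := measurable_signedPow p
  have hfar := integrableOn_kernel_compl_ball (N := N) hs hp one_pos
  have hfar0 : 0 ≤ ∫ h in (ball (0 : E N) 1)ᶜ, 1 / ‖h‖ ^ ((N : ℝ) + p * s) :=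
    integral_nonneg fun h ↦ by simp only [Pi.zero_apply]; positivity
  refine ⟨C + ∫ h in (ball (0 : E N) 1)ᶜ, 1 / ‖h‖ ^ ((N : ℝ) + p * s), by positivity,
    fun z hz ε hε ↦ ?_⟩
  obtain ⟨w, hw0, hwi, hwC, hle⟩ := hbump z hz
  -- `O` is the odd part, cut off on a set symmetric under `h ↦ -h`, so its integral vanishes for
  -- every `ε`. `W` is a nonnegative majorant of the rest that does not depend on `ε`, which makes
  -- the final bound uniform in the truncation.
  set O : E N → ℝ := (ball (0 : E N) ε)ᶜ.indicator fun h ↦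
    (if ‖h‖ < ‖z‖ then signedPow p (2 * (m + 1) * ‖z‖ ^ (2 * m) * inner ℝ z h) else 0)
      / ‖h‖ ^ ((N : ℝ) + p * s) with hO
  set W : E N → ℝ := fun h ↦ (ball (0 : E N) 1).indicator w h +
    (ball (0 : E N) 1)ᶜ.indicator (fun h ↦ 1 / ‖h‖ ^ ((N : ℝ) + p * s)) h with hW
  have hW0 : ∀ h, 0 ≤ W h := fun h ↦
    add_nonneg (indicator_nonneg (fun h _ ↦ hw0 h) _)
      (indicator_nonneg (fun h _ ↦ by positivity) _)
  have hWi : Integrable W :=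
    ((integrable_indicator_iff measurableSet_ball).2 hwi).add
      ((integrable_indicator_iff measurableSet_ball.compl).2 hfar)
  have hOi : Integrable O := by
    rw [hO, integrable_indicator_iff measurableSet_ball.compl]
    have hmeas : Measurable fun h : E N ↦
        (if ‖h‖ < ‖z‖ then signedPow p (2 * (m + 1) * ‖z‖ ^ (2 * m) * inner ℝ z h) else 0)
          / ‖h‖ ^ ((N : ℝ) + p * s) :=
      (Measurable.ite (measurableSet_lt (by fun_prop) (by fun_prop)) (by fun_prop)
        (by fun_prop)).div (by fun_prop)
    refine Integrable.mono' ((integrableOn_kernel_compl_ball hs hp hε).const_mul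
      ((2 * (m + 1) * ‖z‖ ^ (2 * m) * (‖z‖ * ‖z‖)) ^ (p - 1))) hmeas.aestronglyMeasurable
      (Filter.Eventually.of_forall fun h ↦ ?_)
    rw [norm_div, Real.norm_eq_abs, Real.norm_of_nonneg (by positivity), mul_one_div]
    refine div_le_div_of_nonneg_right ?_ (by positivity)
    split_ifs with hlt
    · rw [abs_signedPow hp, abs_mul, abs_of_nonneg (by positivity)]
      refine Real.rpow_le_rpow (by positivity) ?_ (by linarith)
      refine mul_le_mul_of_nonneg_left ((abs_real_inner_le_norm z h).trans ?_) (by positivity)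
      gcongr
    · rw [abs_zero]; positivity
  have hOodd : ∫ h, O h = 0 := by
    have h1 : ∫ h, O (-h) = ∫ h, O h := integral_neg_eq_self O volume
    have h2 : ∀ h, O (-h) = -O h := fun h ↦ by
      simp only [hO, indicator, mem_compl_iff, mem_ball, dist_zero_right, norm_neg,
        inner_neg_right, mul_neg, signedPow_neg]
      split_ifs <;> ring
    simp only [h2, integral_neg] at h1
    linarith
  have hWle : ∫ h, W h ≤ C + ∫ h in (ball (0 : E N) 1)ᶜ, 1 / ‖h‖ ^ ((N : ℝ) + p * s) := by
    rw [hW, integral_add ((integrable_indicator_iff measurableSet_ball).2 hwi)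
      ((integrable_indicator_iff measurableSet_ball.compl).2 hfar),
      integral_indicator measurableSet_ball, integral_indicator measurableSet_ball.compl]
    gcongr
  refine le_trans ?_ hWle
  rw [← zero_add (∫ h, W h), ← hOodd, ← integral_add hOi hWi,
    ← integral_indicator measurableSet_ball.compl]
  refine integral_mono_ae ((integrable_indicator_iff measurableSet_ball.compl).2
    (integrableOn_bump_kernel hs hp m z hε)) (hOi.add hWi) ?_
  filter_upwards [hle] with h hh
  by_cases hε' : h ∈ (ball (0 : E N) ε)ᶜ
  · rw [indicator_of_mem hε']
    simp only [hO, hW]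
    rw [indicator_of_mem hε']
    by_cases h1 : h ∈ ball (0 : E N) 1
    · rw [indicator_of_mem h1, indicator_of_notMem (by simpa using h1), add_zero]
      exact hh (by simpa using h1)
    · rw [indicator_of_notMem h1, indicator_of_mem (by simpa using h1), zero_add]
      have h1' : 1 ≤ ‖h‖ := by simpa using h1
      rw [if_neg (by linarith), zero_div, zero_add]
      exact div_le_div_of_nonneg_right
        ((le_abs_self _).trans (abs_signedPow_le_one hp (abs_bump_sub_le_one m _ _)))
        (by positivity)
  · rw [indicator_of_notMem hε']
    simp only [hO]
    rw [indicator_of_notMem hε', zero_add]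
    exact hW0 h

end Bump

/-! ### The scaled bump as a weak subsolution. -/

section WeakBump

variable {N : ℕ} {s p : ℝ}

/-- The bump centred at `x₀` at scale `r`. -/
def scaledBump (m : ℕ) (x₀ : E N) (r : ℝ) (x : E N) : ℝ := bump m (r⁻¹ • (x - x₀))

theorem measurable_scaledBump (m : ℕ) (x₀ : E N) (r : ℝ) : Measurable (scaledBump m x₀ r) :=
  (measurable_bump m).comp (by fun_prop)

theorem scaledBump_nonneg (m : ℕ) (x₀ : E N) (r : ℝ) (x : E N) : 0 ≤ scaledBump m x₀ r x :=
  bump_nonneg _ _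

theorem scaledBump_le_one (m : ℕ) (x₀ : E N) (r : ℝ) (x : E N) : scaledBump m x₀ r x ≤ 1 :=
  bump_le_one _ _

theorem norm_inv_smul_sub {x₀ x : E N} {r : ℝ} (hr : 0 < r) :
    ‖r⁻¹ • (x - x₀)‖ = dist x x₀ / r := by
  rw [norm_smul, norm_inv, Real.norm_of_nonneg hr.le, dist_eq_norm, div_eq_inv_mul]

theorem scaledBump_eq_zero (m : ℕ) {x₀ x : E N} {r : ℝ} (hr : 0 < r) (hx : x ∉ ball x₀ r) :
    scaledBump m x₀ r x = 0 := by
  refine bump_eq_zero m ?_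
  rw [norm_inv_smul_sub hr, le_div_iff₀ hr, one_mul]
  simpa using hx

theorem half_le_scaledBump (m : ℕ) {x₀ x : E N} {r : ℝ} (hr : 0 < r) (hx : x ∈ ball x₀ (r / 2)) :
    1 / 2 ≤ scaledBump m x₀ r x := by
  refine half_le_bump m ?_
  rw [norm_inv_smul_sub hr, div_le_iff₀ hr]
  have : dist x x₀ < r / 2 := hx
  linarith

theorem abs_scaledBump_sub_le (m : ℕ) (x₀ : E N) {r : ℝ} (hr : 0 < r) (x y : E N) :
    |scaledBump m x₀ r x - scaledBump m x₀ r y| ≤ (2 * (m + 1) : ℕ) / r * ‖x - y‖ := by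
  refine (abs_bump_sub_le m _ _).trans (le_of_eq ?_)
  rw [← smul_sub, sub_sub_sub_cancel_right, norm_smul, norm_inv, Real.norm_of_nonneg hr.le]
  ring

/-- Scale invariant upper bound for the truncated operator applied to the scaled bump. -/
theorem exists_integral_scaledBump_truncated_le (hN : 1 < N) (hs : s ∈ Ioo (0 : ℝ) 1)
    (hp : 1 < p) {m : ℕ} (hm : p ≤ (2 * (m + 1) : ℕ) * (p - 1)) :
    ∃ C : ℝ, 0 ≤ C ∧ ∀ (x₀ : E N) (r : ℝ), 0 < r → ∀ x ∈ ball x₀ r, ∀ ε : ℝ, 0 < ε →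
      ∫ y in (ball x ε)ᶜ, signedPow p (scaledBump m x₀ r x - scaledBump m x₀ r y) /
        ‖x - y‖ ^ ((N : ℝ) + p * s) ≤ C * r ^ (-(p * s)) := by
  obtain ⟨C, hC, hC'⟩ := exists_integral_bump_truncated_le (N := N) hN hs hp hm
  refine ⟨C, hC, fun x₀ r hr x hx ε hε ↦ ?_⟩
  set z : E N := r⁻¹ • (x - x₀) with hz
  have hz1 : ‖z‖ < 1 := by
    rw [hz, norm_inv_smul_sub hr, div_lt_one hr]; exact hx
  have h0 := hC' z hz1 (ε / r) (by positivity)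
  set F : E N → ℝ := (ball x ε)ᶜ.indicator fun y ↦
    signedPow p (scaledBump m x₀ r x - scaledBump m x₀ r y) / ‖x - y‖ ^ ((N : ℝ) + p * s) with hF
  set G : E N → ℝ := (ball (0 : E N) (ε / r))ᶜ.indicator fun h ↦
    signedPow p (bump m z - bump m (z + h)) / ‖h‖ ^ ((N : ℝ) + p * s) with hG
  rw [← integral_indicator measurableSet_ball.compl] at h0 ⊢
  have h1 : ∀ h, F (x + r • h) = r ^ (-((N : ℝ) + p * s)) * G h := fun h ↦ by
    have hn : ‖x - (x + r • h)‖ = r * ‖h‖ := by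
      rw [sub_add_cancel_left, norm_neg, norm_smul, Real.norm_of_nonneg hr.le]
    have hn' : dist (x + r • h) x = r * ‖h‖ := by rw [dist_eq_norm', hn]
    have harg : r⁻¹ • (x + r • h - x₀) = z + h := by
      rw [add_sub_right_comm, smul_add, smul_smul, inv_mul_cancel₀ hr.ne', one_smul]
    have hiff : r * ‖h‖ < ε ↔ ‖h‖ < ε / r := by rw [lt_div_iff₀ hr, mul_comm]
    simp only [hF, hG, indicator, mem_compl_iff, mem_ball, hn', dist_zero_right, hiff, hn,
      scaledBump, harg]
    split_ifs with hc
    · simp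
    · rw [← hz, Real.mul_rpow hr.le (norm_nonneg _), Real.rpow_neg hr.le]
      field_simp
  have h2 : ∫ y, F y = r ^ (-(p * s)) * ∫ h, G h := by
    have h3 := Measure.integral_comp_smul (volume : Measure (E N)) (fun h ↦ F (x + h)) r
    rw [integral_add_left_eq_self F x, finrank_E, smul_eq_mul, abs_of_nonneg (by positivity)] at h3
    simp only [h1, integral_const_mul] at h3
    have h4 : ∫ y, F y = r ^ N * ((r ^ N)⁻¹ * ∫ y, F y) := by field_simp
    rw [h4, ← h3, ← mul_assoc, ← Real.rpow_natCast, ← Real.rpow_add hr]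
    congr 2; ring
  rw [h2, mul_comm]
  exact mul_le_mul_of_nonneg_right h0 (by positivity)

/-- Product functions `ψ(x) κ(x - y)` with integrable factors are integrable. -/
theorem integrable_prod_translate {ψ κ : E N → ℝ} (hψ : Integrable ψ) (hκ : Integrable κ) :
    Integrable fun z : E N × E N ↦ ψ z.1 * κ (-z.1 + z.2) :=
  (measurePreserving_prod_neg_add (volume : Measure (E N)) (volume : Measure (E N))
    |>.integrable_comp_of_integrable (hψ.mul_prod hκ))

theorem integral_prod_swap_add {g : E N × E N → ℝ} (hg : Integrable g) :
    Integrable (fun z ↦ g z + g z.swap) ∧ ∫ z, (g z + g z.swap) = 2 * ∫ z, g z := by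
  have h1 : Integrable fun z : E N × E N ↦ g z.swap := hg.swap
  refine ⟨hg.add h1, ?_⟩
  rw [integral_add hg h1, two_mul]
  congr 1
  exact integral_prod_swap g

/-- The scaled bump is a weak subsolution up to a constant of the natural size. -/
theorem exists_weakForm_scaledBump_le (hN : 1 < N) (hs : s ∈ Ioo (0 : ℝ) 1)
    (hp : 1 < p) {m : ℕ} (hm : p ≤ (2 * (m + 1) : ℕ) * (p - 1)) :
    ∃ C : ℝ, 0 ≤ C ∧ ∀ (x₀ : E N) (r : ℝ), 0 < r → ∀ ψ : E N → ℝ, Integrable ψ → (∀ x, 0 ≤ ψ x) →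
      (∀ x ∉ ball x₀ r, ψ x = 0) →
      Integrable (fun z : E N × E N ↦ signedPow p (scaledBump m x₀ r z.1 - scaledBump m x₀ r z.2) *
        (ψ z.1 - ψ z.2) / ‖z.1 - z.2‖ ^ ((N : ℝ) + p * s)) →
      weakForm s p (scaledBump m x₀ r) ψ ≤ C * r ^ (-(p * s)) * ∫ x, ψ x := by
  obtain ⟨C, hC, hC'⟩ := exists_integral_scaledBump_truncated_le (N := N) hN hs hp hm
  refine ⟨2 * C, by positivity, fun x₀ r hr ψ hψ hψ0 hψs hF ↦ ?_⟩
  set φ := scaledBump m x₀ r with hφ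
  have hφm : Measurable φ := measurable_scaledBump m x₀ r
  have hP := measurable_signedPow p
  set F : E N × E N → ℝ := fun z ↦ signedPow p (φ z.1 - φ z.2) * (ψ z.1 - ψ z.2) /
    ‖z.1 - z.2‖ ^ ((N : ℝ) + p * s) with hFdef
  -- The integrand of the form is integrable only as a whole; splitting `ψ z.1 - ψ z.2` requires
  -- removing the diagonal first. The set `A ε` is symmetric under swapping the two points, so the
  -- two halves remain mirror images.
  let A : ℝ → Set (E N × E N) := fun ε ↦ {z | ε ≤ ‖z.1 - z.2‖}
  have hA : ∀ ε, MeasurableSet (A ε) := fun ε ↦ measurableSet_le (by fun_prop) (by fun_prop)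
  have hlim : Filter.Tendsto (fun n : ℕ ↦ ∫ z, (A (1 / ((n : ℝ) + 1))).indicator F z) Filter.atTop
      (nhds (∫ z, F z)) := by
    refine tendsto_integral_of_dominated_convergence (fun z ↦ ‖F z‖)
      (fun n ↦ hF.aestronglyMeasurable.indicator (hA _)) hF.norm
      (fun n ↦ Filter.Eventually.of_forall fun z ↦ norm_indicator_le_norm_self _ _)
      (Filter.Eventually.of_forall fun z ↦ ?_)
    rcases eq_or_ne z.1 z.2 with hz | hz
    · have hF0 : F z = 0 := by simp [hFdef, hz]
      have : ∀ n : ℕ, (A (1 / ((n : ℝ) + 1))).indicator F z = 0 := fun n ↦ by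
        simp [indicator, hF0]
      simp only [this, hF0]
      exact tendsto_const_nhds
    · have hpos : 0 < ‖z.1 - z.2‖ := norm_sub_pos_iff.2 hz
      have hev : ∀ᶠ n : ℕ in Filter.atTop, 1 / ((n : ℝ) + 1) < ‖z.1 - z.2‖ :=
        tendsto_one_div_add_atTop_nhds_zero_nat.eventually_lt_const hpos
      refine tendsto_const_nhds.congr' ?_
      filter_upwards [hev] with n hn
      exact (indicator_of_mem (show z ∈ A _ from hn.le) F).symm
  have hmain : ∀ ε : ℝ, 0 < ε → ∫ z, (A ε).indicator F z ≤ 2 * C * r ^ (-(p * s)) * ∫ x, ψ x := by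
    intro ε hε
    set κ : E N → ℝ := (ball (0 : E N) ε)ᶜ.indicator fun h ↦ 1 / ‖h‖ ^ ((N : ℝ) + p * s) with hκ
    have hκi : Integrable κ := (integrable_indicator_iff measurableSet_ball.compl).2
      (integrableOn_kernel_compl_ball hs hp hε)
    set g : E N × E N → ℝ := (A ε).indicator fun z ↦
      ψ z.1 * (signedPow p (φ z.1 - φ z.2) / ‖z.1 - z.2‖ ^ ((N : ℝ) + p * s)) with hg
    have hgi : Integrable g := by
      refine Integrable.mono (integrable_prod_translate hψ hκi) ?_
        (Filter.Eventually.of_forall fun z ↦ ?_)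
      · refine AEStronglyMeasurable.indicator ?_ (hA ε)
        exact hψ.aestronglyMeasurable.comp_fst.mul
          (Measurable.aestronglyMeasurable (by fun_prop))
      · by_cases hz : z ∈ A ε
        · have hmem : -z.1 + z.2 ∈ (ball (0 : E N) ε)ᶜ := by
            have : ε ≤ ‖z.1 - z.2‖ := hz
            simpa [neg_add_eq_sub, norm_sub_rev] using this
          rw [hg, indicator_of_mem hz, hκ, indicator_of_mem hmem, norm_mul, norm_mul]
          refine mul_le_mul_of_nonneg_left ?_ (norm_nonneg _)
          rw [norm_div, norm_div, norm_one, Real.norm_eq_abs, neg_add_eq_sub, norm_sub_rev z.2 z.1]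
          exact div_le_div_of_nonneg_right
            (abs_signedPow_le_one hp (abs_bump_sub_le_one m _ _)) (norm_nonneg _)
        · rw [hg, indicator_of_notMem hz, norm_zero]
          exact norm_nonneg _
    -- By oddness of the signed power, the truncated form is twice the integral of `ψ` against the
    -- truncated operator, to which the pointwise bound applies.
    have hsum : (A ε).indicator F = fun z ↦ g z + g z.swap := by
      ext z
      have hsw : z.swap ∈ A ε ↔ z ∈ A ε := by
        simp only [A, mem_ofPred_eq, Prod.fst_swap, Prod.snd_swap, norm_sub_rev]
      by_cases hz : z ∈ A ε
      · rw [hg, indicator_of_mem hz, indicator_of_mem hz, indicator_of_mem (hsw.2 hz)]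
        simp only [hFdef, Prod.fst_swap, Prod.snd_swap]
        rw [norm_sub_rev z.2 z.1, ← neg_sub (φ z.1) (φ z.2), signedPow_neg]
        ring
      · rw [hg, indicator_of_notMem hz, indicator_of_notMem hz,
          indicator_of_notMem (fun h ↦ hz (hsw.1 h)), add_zero]
    rw [hsum, (integral_prod_swap_add hgi).2, mul_assoc, mul_assoc]
    refine mul_le_mul_of_nonneg_left ?_ (by norm_num)
    rw [Measure.volume_eq_prod, integral_prod g hgi, ← mul_assoc, ← integral_const_mul]
    refine integral_mono hgi.integral_prod_left (hψ.const_mul _) fun x ↦ ?_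
    have hinner : ∫ y, g (x, y) = ψ x * ∫ y in (ball x ε)ᶜ, signedPow p (φ x - φ y) /
        ‖x - y‖ ^ ((N : ℝ) + p * s) := by
      rw [← integral_indicator measurableSet_ball.compl, ← integral_const_mul]
      congr 1; ext y
      simp only [hg, indicator, A, mem_ofPred_eq, mem_compl_iff, mem_ball, not_lt, dist_eq_norm',
        mul_ite, mul_zero]
    simp only [hinner]
    by_cases hx : x ∈ ball x₀ r
    · rw [mul_comm]
      exact mul_le_mul_of_nonneg_right (hC' x₀ r hr x hx ε hε) (hψ0 x)
    · simp [hψs x hx]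
  exact le_of_tendsto' hlim fun n ↦ hmain _ (by positivity)

end WeakBump

/-! ### Integrability of the weak form and admissibility of test functions. -/

section Energy

variable {N : ℕ} {s p : ℝ}

theorem integrableOn_kernel_compl_ball_center (hs : s ∈ Ioo (0 : ℝ) 1) (hp : 1 < p) (x₀ : E N)
    {ρ : ℝ} (hρ : 0 < ρ) :
    IntegrableOn (fun y : E N ↦ 1 / ‖y - x₀‖ ^ ((N : ℝ) + p * s)) (ball x₀ ρ)ᶜ := by
  have h1 := ((integrable_indicator_iff measurableSet_ball.compl).2
    (integrableOn_kernel_compl_ball (N := N) hs hp hρ)).comp_sub_right x₀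
  rw [← integrable_indicator_iff measurableSet_ball.compl]
  refine h1.congr (Filter.Eventually.of_forall fun y ↦ ?_)
  simp only [indicator, mem_compl_iff, mem_ball, dist_eq_norm, sub_zero]

theorem kernel_le_of_mem_ball (hs : s ∈ Ioo (0 : ℝ) 1) (hp : 1 < p) {x₀ x y : E N} {r : ℝ}
    (hr : 0 < r) (hx : x ∈ ball x₀ r) (hy : y ∉ ball x₀ (4 * r)) :
    1 / ‖x - y‖ ^ ((N : ℝ) + p * s) ≤
      (4 / 3) ^ ((N : ℝ) + p * s) * (1 / ‖y - x₀‖ ^ ((N : ℝ) + p * s)) := by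
  have hD := kernel_exponent_pos (N := N) hs hp
  rw [mem_ball, dist_eq_norm] at hx hy
  rw [not_lt] at hy
  have h1 : ‖y - x₀‖ ≤ ‖x - y‖ + ‖x - x₀‖ := by
    rw [← norm_sub_rev y x]; exact norm_sub_le_norm_sub_add_norm_sub y x x₀
  have hpos : 0 < ‖x - y‖ := by linarith
  have hpos' : 0 < ‖y - x₀‖ := by linarith
  have h2 : ‖y - x₀‖ ≤ 4 / 3 * ‖x - y‖ := by linarith
  have h3 := Real.rpow_le_rpow hpos'.le h2 hD.le
  rw [Real.mul_rpow (by norm_num) hpos.le] at h3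
  rw [mul_one_div, div_le_div_iff₀ (by positivity) (by positivity)]
  linarith

/-- The energy density of `u` on pairs of points. -/
def energyDensity (s p : ℝ) (u : E N → ℝ) (z : E N × E N) : ℝ :=
  |u z.1 - u z.2| ^ p / ‖z.1 - z.2‖ ^ ((N : ℝ) + p * s)

theorem energyDensity_nonneg (u : E N → ℝ) (z : E N × E N) : 0 ≤ energyDensity s p u z := by
  unfold energyDensity; positivity

theorem aestronglyMeasurable_energyDensity {u : E N → ℝ} (hu : AEStronglyMeasurable u volume) :
    AEStronglyMeasurable (energyDensity s p u) volume := by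
  have h1 : AEStronglyMeasurable (fun z : E N × E N ↦ u z.1 - u z.2) volume :=
    hu.comp_fst.sub hu.comp_snd
  have h2 : Measurable fun t : ℝ ↦ |t| ^ p := by fun_prop
  exact ((h2.comp_aemeasurable h1.aemeasurable).div
    (Measurable.aemeasurable (by fun_prop))).aestronglyMeasurable

theorem gagliardo_lt_top_iff {u : E N → ℝ} (hu : AEStronglyMeasurable u volume) (V : Set (E N)) :
    gagliardo s p V u < ∞ ↔ IntegrableOn (energyDensity s p u) (V ×ˢ V) := by
  rw [IntegrableOn, Integrable, and_iff_right (aestronglyMeasurable_energyDensity hu).restrict,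
    hasFiniteIntegral_iff_ofReal (Filter.Eventually.of_forall fun z ↦ energyDensity_nonneg u z)]
  rfl

/-- Integrability on the product space of a symmetric quantity that vanishes when both points are
away from a small ball. -/
theorem integrable_of_near_far {x₀ : E N} {r : ℝ} {F : E N × E N → ℝ} {G : E N → ℝ}
    (hF : AEStronglyMeasurable F volume) (hsymm : ∀ z, |F z.swap| = |F z|)
    (hnear : IntegrableOn F (ball x₀ (4 * r) ×ˢ ball x₀ (4 * r)))
    (hG : IntegrableOn G (ball x₀ (4 * r))ᶜ)
    (hfar : ∀ᵐ z : E N × E N, z.1 ∈ ball x₀ r → z.2 ∉ ball x₀ (4 * r) → |F z| ≤ G z.2)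
    (hzero : ∀ z : E N × E N, z.1 ∉ ball x₀ r → z.2 ∉ ball x₀ r → F z = 0) (hr : 0 < r) :
    Integrable F := by
  have hsub : ball x₀ r ⊆ ball x₀ (4 * r) := ball_subset_ball (by linarith)
  set f : E N × E N → ℝ := fun z ↦ (ball x₀ r).indicator (fun _ ↦ (1 : ℝ)) z.1 *
    (ball x₀ (4 * r))ᶜ.indicator (fun y ↦ |G y|) z.2 with hf
  have hf0 : ∀ z, 0 ≤ f z := fun z ↦ mul_nonneg (indicator_nonneg (fun _ _ ↦ zero_le_one) _)
    (indicator_nonneg (fun _ _ ↦ abs_nonneg _) _)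
  have hfi : Integrable f := Integrable.mul_prod
    ((integrable_indicator_iff measurableSet_ball).2
      (integrableOn_const (measure_ball_lt_top.ne)))
    ((integrable_indicator_iff measurableSet_ball.compl).2 hG.abs)
  have hni : Integrable ((ball x₀ (4 * r) ×ˢ ball x₀ (4 * r)).indicator fun z ↦ |F z|) :=
    (integrable_indicator_iff (measurableSet_ball.prod measurableSet_ball)).2 hnear.abs
  have hfs : Integrable fun z : E N × E N ↦ f z.swap := hfi.swap
  have hfar' : ∀ᵐ z : E N × E N, z.2 ∈ ball x₀ r → z.1 ∉ ball x₀ (4 * r) → |F z| ≤ G z.1 := by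
    have h1 : ∀ᵐ z : E N × E N, z.swap.1 ∈ ball x₀ r → z.swap.2 ∉ ball x₀ (4 * r) →
        |F z.swap| ≤ G z.swap.2 :=
      (Measure.measurePreserving_swap (μ := (volume : Measure (E N)))
        (ν := (volume : Measure (E N)))).quasiMeasurePreserving.ae hfar
    filter_upwards [h1] with z hz
    rw [hsymm] at hz
    exact hz
  refine Integrable.mono' ((hni.add hfi).add hfs) hF ?_
  filter_upwards [hfar, hfar'] with z hz hz'
  rw [Real.norm_eq_abs]
  simp only [Pi.add_apply]
  have hn0 : 0 ≤ (ball x₀ (4 * r) ×ˢ ball x₀ (4 * r)).indicator (fun z ↦ |F z|) z :=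
    indicator_nonneg (fun _ _ ↦ abs_nonneg _) _
  have hs0 := hf0 z.swap
  have hs1 := hf0 z
  by_cases h1 : z.1 ∈ ball x₀ (4 * r)
  · by_cases h2 : z.2 ∈ ball x₀ (4 * r)
    · rw [indicator_of_mem (mk_mem_prod h1 h2)]
      linarith
    · by_cases h3 : z.1 ∈ ball x₀ r
      · have : f z = |G z.2| := by
          simp only [hf]; rw [indicator_of_mem h3, indicator_of_mem h2, one_mul]
        have := hz h3 h2
        have := le_abs_self (G z.2)
        linarith
      · rw [hzero z h3 (fun h ↦ h2 (hsub h)), abs_zero]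
        linarith
  · by_cases h3 : z.2 ∈ ball x₀ r
    · have : f z.swap = |G z.1| := by
        simp only [hf, Prod.fst_swap, Prod.snd_swap]
        rw [indicator_of_mem h3, indicator_of_mem h1, one_mul]
      have := hz' h3 h1
      have := le_abs_self (G z.1)
      linarith
    · rw [hzero z (fun h ↦ h1 (hsub h)) h3, abs_zero]
      linarith

/-- A crude Young inequality, obtained by replacing the smaller of the two numbers by the larger. It
dominates the weak form by the two energies. -/
theorem rpow_sub_one_mul_le (hp : 1 < p) {a b : ℝ} (ha : 0 ≤ a) (hb : 0 ≤ b) :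
    a ^ (p - 1) * b ≤ a ^ p + b ^ p := by
  have key : ∀ c : ℝ, 0 ≤ c → c ^ (p - 1) * c = c ^ p := fun c hc ↦ by
    nth_rw 2 [← Real.rpow_one c]
    rw [← Real.rpow_add_of_nonneg hc (by linarith) zero_le_one, sub_add_cancel]
  rcases le_total b a with h | h
  · calc a ^ (p - 1) * b ≤ a ^ (p - 1) * a := by gcongr
      _ = a ^ p := key a ha
      _ ≤ _ := le_add_of_nonneg_right (by positivity)
  · calc a ^ (p - 1) * b ≤ b ^ (p - 1) * b := by
          gcongr
      _ = b ^ p := key b hb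
      _ ≤ _ := le_add_of_nonneg_left (by positivity)

/-- Integrability of the integrand of the weak form against a test function supported in a ball. -/
theorem integrable_weakForm_integrand (hs : s ∈ Ioo (0 : ℝ) 1) (hp : 1 < p) {x₀ : E N} {r : ℝ}
    (hr : 0 < r) {u ψ : E N → ℝ} {M M' : ℝ} (hu : AEStronglyMeasurable u volume)
    (hub : ∀ᵐ x, x ∈ ball x₀ r → |u x| ≤ M)
    (hue : IntegrableOn (energyDensity s p u) (ball x₀ (4 * r) ×ˢ ball x₀ (4 * r)))
    (hut : IntegrableOn (fun y ↦ |u y| ^ (p - 1) * (1 / ‖y - x₀‖ ^ ((N : ℝ) + p * s)))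
      (ball x₀ (4 * r))ᶜ)
    (hψ : AEStronglyMeasurable ψ volume) (hψb : ∀ᵐ x, |ψ x| ≤ M') (hψ0 : ∀ x ∉ ball x₀ r, ψ x = 0)
    (hψe : IntegrableOn (energyDensity s p ψ) (ball x₀ (4 * r) ×ˢ ball x₀ (4 * r))) :
    Integrable fun z : E N × E N ↦ signedPow p (u z.1 - u z.2) * (ψ z.1 - ψ z.2) /
      ‖z.1 - z.2‖ ^ ((N : ℝ) + p * s) := by
  have hudiff : AEStronglyMeasurable (fun z : E N × E N ↦ u z.1 - u z.2) volume :=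
    hu.comp_fst.sub hu.comp_snd
  have hψdiff : AEStronglyMeasurable (fun z : E N × E N ↦ ψ z.1 - ψ z.2) volume :=
    hψ.comp_fst.sub hψ.comp_snd
  have hmeas : AEStronglyMeasurable (fun z : E N × E N ↦ signedPow p (u z.1 - u z.2) *
      (ψ z.1 - ψ z.2) / ‖z.1 - z.2‖ ^ ((N : ℝ) + p * s)) volume :=
    ((((measurable_signedPow p).comp_aemeasurable hudiff.aemeasurable).mul
      hψdiff.aemeasurable).div (Measurable.aemeasurable (by fun_prop))).aestronglyMeasurable
  have habs : ∀ z : E N × E N, |signedPow p (u z.1 - u z.2) * (ψ z.1 - ψ z.2) /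
      ‖z.1 - z.2‖ ^ ((N : ℝ) + p * s)| = |u z.1 - u z.2| ^ (p - 1) * |ψ z.1 - ψ z.2| /
      ‖z.1 - z.2‖ ^ ((N : ℝ) + p * s) := fun z ↦ by
    rw [abs_div, abs_mul, abs_signedPow hp, abs_of_nonneg (by positivity :
      0 ≤ ‖z.1 - z.2‖ ^ ((N : ℝ) + p * s))]
  have hGi := ((((integrableOn_kernel_compl_ball_center hs hp x₀ (by linarith : 0 < 4 * r))
    |>.const_mul (|M| ^ (p - 1))).add hut).const_mul (2 ^ (p - 1) * |M'| * (4 / 3) ^ ((N : ℝ) + p * s)))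
  refine integrable_of_near_far (x₀ := x₀) (r := r) hmeas (fun z ↦ ?_) ?_ hGi ?_ ?_ hr
  · rw [habs, habs]
    simp only [Prod.fst_swap, Prod.snd_swap]
    rw [abs_sub_comm (u z.2), abs_sub_comm (ψ z.2), norm_sub_rev z.2]
  · refine Integrable.mono' (hue.add hψe) hmeas.restrict (Filter.Eventually.of_forall fun z ↦ ?_)
    rw [Real.norm_eq_abs, habs, Pi.add_apply]
    unfold energyDensity
    rw [← add_div]
    exact div_le_div_of_nonneg_right (rpow_sub_one_mul_le hp (abs_nonneg _) (abs_nonneg _))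
      (by positivity)
  · have hub' : ∀ᵐ z : E N × E N, z.1 ∈ ball x₀ r → |u z.1| ≤ M :=
      Measure.quasiMeasurePreserving_fst.ae hub
    filter_upwards [hub', Measure.quasiMeasurePreserving_fst.ae hψb] with z hz hψz h1 h2
    have hM : |u z.1| ≤ |M| := (hz h1).trans (le_abs_self M)
    have hψ2 : ψ z.2 = 0 := hψ0 _ fun h ↦ h2 (ball_subset_ball (by linarith) h)
    rw [habs, hψ2, sub_zero, div_eq_mul_one_div]
    have e1 : |u z.1 - u z.2| ^ (p - 1) ≤ 2 ^ (p - 1) * (|M| ^ (p - 1) + |u z.2| ^ (p - 1)) := by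
      refine (Real.rpow_le_rpow (abs_nonneg _) ?_ (by linarith)).trans
        (add_rpow_le_two_rpow (by linarith) (abs_nonneg _) (abs_nonneg _))
      exact (abs_sub _ _).trans (by linarith)
    have e2 := kernel_le_of_mem_ball hs hp hr h1 h2
    have e3 : |ψ z.1| ≤ |M'| := hψz.trans (le_abs_self _)
    have hpos : (0 : ℝ) ≤ 1 / ‖z.1 - z.2‖ ^ ((N : ℝ) + p * s) := by positivity
    calc _ ≤ (2 ^ (p - 1) * (|M| ^ (p - 1) + |u z.2| ^ (p - 1))) * |M'| *
          ((4 / 3) ^ ((N : ℝ) + p * s) * (1 / ‖z.2 - x₀‖ ^ ((N : ℝ) + p * s))) := by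
          gcongr
      _ = _ := by simp only [Pi.add_apply]; ring
  · intro z h1 h2
    simp [hψ0 _ h1, hψ0 _ h2]

/-- A bounded function supported in `B_r` with finite energy on `B_{4r} × B_{4r}` is in
`W^{s,p}(ℝ^N)`. -/
theorem memW_univ_of_energy (hs : s ∈ Ioo (0 : ℝ) 1) (hp : 1 < p) {x₀ : E N} {r : ℝ}
    (hr : 0 < r) {ψ : E N → ℝ} {M : ℝ}
    (hψ : AEStronglyMeasurable ψ volume) (hψb : ∀ᵐ x, |ψ x| ≤ M) (hψ0 : ∀ x ∉ ball x₀ r, ψ x = 0)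
    (hψe : IntegrableOn (energyDensity s p ψ) (ball x₀ (4 * r) ×ˢ ball x₀ (4 * r))) :
    MemW s p univ ψ := by
  obtain ⟨y, hy⟩ := hψb.exists
  have hM : 0 ≤ M := (abs_nonneg _).trans hy
  constructor
  · rw [Measure.restrict_univ]
    have h1 : MemLp ((ball x₀ r).indicator ψ) (ENNReal.ofReal p) volume := by
      rw [memLp_indicator_iff_restrict measurableSet_ball]
      have : IsFiniteMeasure (volume.restrict (ball x₀ r)) := ⟨by simp [measure_ball_lt_top]⟩
      exact MemLp.of_bound hψ.restrict M (ae_restrict_of_ae hψb)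
    rwa [indicator_eq_self.2] at h1
    intro x hx
    by_contra hx'
    exact hx (hψ0 x hx')
  · rw [gagliardo_lt_top_iff hψ, univ_prod_univ, integrableOn_univ]
    have hGi := (integrableOn_kernel_compl_ball_center (N := N) hs hp x₀
      (by linarith : 0 < 4 * r)).const_mul (M ^ p * (4 / 3) ^ ((N : ℝ) + p * s))
    refine integrable_of_near_far (x₀ := x₀) (r := r) (aestronglyMeasurable_energyDensity hψ)
      (fun z ↦ ?_) hψe hGi ?_ (fun z h1 h2 ↦ ?_) hr
    · unfold energyDensity
      simp only [Prod.fst_swap, Prod.snd_swap]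
      rw [abs_sub_comm (ψ z.2), norm_sub_rev z.2]
    · filter_upwards [Measure.quasiMeasurePreserving_fst.ae hψb] with z hψz h1 h2
      have hψ2 : ψ z.2 = 0 := hψ0 _ fun h ↦ h2 (ball_subset_ball (by linarith) h)
      rw [abs_of_nonneg (energyDensity_nonneg _ _)]
      unfold energyDensity
      rw [hψ2, sub_zero, div_eq_mul_one_div, mul_assoc]
      exact mul_le_mul (Real.rpow_le_rpow (abs_nonneg _) hψz (by linarith))
        (kernel_le_of_mem_ball hs hp hr h1 h2) (by positivity) (by positivity)
    · simp [energyDensity, hψ0 _ h1, hψ0 _ h2, Real.zero_rpow (by linarith : p ≠ 0)]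

/-- Lipschitz functions have finite energy on balls. -/
theorem integrableOn_energyDensity_of_lipschitz (hN : 1 < N) (hs : s ∈ Ioo (0 : ℝ) 1) (hp : 1 < p)
    {f : E N → ℝ} (hf : AEStronglyMeasurable f volume) {L : ℝ} (hL : 0 ≤ L)
    (hfL : ∀ x y, |f x - f y| ≤ L * ‖x - y‖) (x₀ : E N) (ρ : ℝ) :
    IntegrableOn (energyDensity s p f) (ball x₀ ρ ×ˢ ball x₀ ρ) := by
  set κ : E N → ℝ := (ball (0 : E N) (2 * ρ)).indicator fun h ↦
    ‖h‖ ^ p / ‖h‖ ^ ((N : ℝ) + p * s) with hκ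
  have hκi : Integrable κ := (integrable_indicator_iff measurableSet_ball).2
    (integrableOn_rpow_ball hN hs hp _)
  have h1i : Integrable ((ball x₀ ρ).indicator fun _ ↦ L ^ p) :=
    (integrable_indicator_iff measurableSet_ball).2 (integrableOn_const measure_ball_lt_top.ne)
  refine Integrable.mono' (integrable_prod_translate h1i hκi).integrableOn
    (aestronglyMeasurable_energyDensity hf).restrict ?_
  filter_upwards [ae_restrict_mem (measurableSet_ball.prod measurableSet_ball)] with z hz
  rw [Real.norm_of_nonneg (energyDensity_nonneg _ _), indicator_of_mem hz.1]
  have hz' : -z.1 + z.2 ∈ ball (0 : E N) (2 * ρ) := by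
    rw [mem_ball_zero_iff, neg_add_eq_sub, ← dist_eq_norm]
    have h1 : dist z.1 x₀ < ρ := hz.1
    have h2 : dist z.2 x₀ < ρ := hz.2
    linarith [dist_triangle_right z.2 z.1 x₀]
  rw [hκ, indicator_of_mem hz', neg_add_eq_sub, norm_sub_rev z.2 z.1]
  unfold energyDensity
  rw [← mul_div_assoc, ← Real.mul_rpow hL (norm_nonneg _)]
  exact div_le_div_of_nonneg_right (Real.rpow_le_rpow (abs_nonneg _) (hfL _ _) (by linarith))
    (by positivity)

theorem MemWTilde.aestronglyMeasurable {U : Set (E N)} {u : E N → ℝ} (h : MemWTilde s p U u) :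
    AEStronglyMeasurable u volume := by
  have h1 : AEStronglyMeasurable u (volume.restrict (⋃ n : ℕ, closedBall (0 : E N) n)) :=
    aestronglyMeasurable_iUnion_iff.2 fun n ↦
      (h.memLp_loc _ (isCompact_closedBall _ _)).aestronglyMeasurable
  rwa [iUnion_closedBall_nat, Measure.restrict_univ] at h1

theorem MemWTilde.integrableOn_energyDensity {U : Set (E N)} {u : E N → ℝ}
    (h : MemWTilde s p U u) : IntegrableOn (energyDensity s p u) (U ×ˢ U) := by
  obtain ⟨V, -, -, hV, -, hg⟩ := h.memW_nhds
  have hUV : U ⊆ V := subset_closure.trans hV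
  exact ((gagliardo_lt_top_iff h.aestronglyMeasurable V).1 hg).mono_set (prod_mono hUV hUV)

theorem MemWTilde.integrableOn_tail (hs : s ∈ Ioo (0 : ℝ) 1) (hp : 1 < p) {U : Set (E N)}
    {u : E N → ℝ} (h : MemWTilde s p U u) (x₀ : E N) {ρ : ℝ} (hρ : 0 < ρ) :
    IntegrableOn (fun y ↦ |u y| ^ (p - 1) * (1 / ‖y - x₀‖ ^ ((N : ℝ) + p * s))) (ball x₀ ρ)ᶜ := by
  have hD := kernel_exponent_pos (N := N) hs hp
  have hm : AEMeasurable (fun y ↦ |u y| ^ (p - 1)) volume :=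
    (by fun_prop : Measurable fun t : ℝ ↦ |t| ^ (p - 1)).comp_aemeasurable
      h.aestronglyMeasurable.aemeasurable
  have h1 : Integrable fun x : E N ↦ |u x| ^ (p - 1) / (1 + ‖x‖) ^ ((N : ℝ) + p * s) := by
    refine ⟨(hm.div (Measurable.aemeasurable (by fun_prop))).aestronglyMeasurable, ?_⟩
    rw [hasFiniteIntegral_iff_ofReal (Filter.Eventually.of_forall fun z ↦ by
      simp only [Pi.zero_apply]; positivity)]
    exact h.tail_lt_top
  -- This constant gives `1 + ‖y‖ ≤ c ‖y - x₀‖` off the ball.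
  set c : ℝ := (1 + ‖x₀‖) / ρ + 1 with hc
  refine Integrable.mono' (h1.const_mul (c ^ ((N : ℝ) + p * s))).integrableOn
    (hm.mul (Measurable.aemeasurable (by fun_prop))).aestronglyMeasurable.restrict ?_
  filter_upwards [ae_restrict_mem measurableSet_ball.compl] with y hy
  have hy : ρ ≤ ‖y - x₀‖ := by simpa [dist_eq_norm] using hy
  have hpos : 0 < ‖y - x₀‖ := by linarith
  rw [Real.norm_of_nonneg (by positivity), mul_one_div, mul_div_assoc', mul_comm (c ^ _),
    div_le_div_iff₀ (by positivity) (by positivity), mul_assoc, ← Real.mul_rpow (by positivity)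
    (by positivity)]
  refine mul_le_mul_of_nonneg_left (Real.rpow_le_rpow (by positivity) ?_ hD.le) (by positivity)
  have h2 : ‖y‖ ≤ ‖y - x₀‖ + ‖x₀‖ := by
    simpa using norm_add_le (y - x₀) x₀
  have h3 : 1 + ‖x₀‖ ≤ (1 + ‖x₀‖) / ρ * ‖y - x₀‖ := by
    rw [div_mul_eq_mul_div, le_div_iff₀ hρ]
    gcongr
  rw [hc]
  linarith

end Energy

/-! ### The growth lemma. -/

section Growth

variable {N : ℕ} {s p : ℝ}

/-- Monotonicity of the operator tested with the positive part of a difference. -/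
theorem signedPow_mul_posPart_sub_le (hp : 1 < p) (m a b f g : ℝ) :
    signedPow p (a - b) * (max (m + f - a) 0 - max (m + g - b) 0) ≤
      signedPow p (f - g) * (max (m + f - a) 0 - max (m + g - b) 0) := by
  rcases le_total (f - g) (a - b) with h | h
  · have h1 := signedPow_mono hp h
    have h2 : max (m + f - a) 0 ≤ max (m + g - b) 0 := max_le_max_right _ (by linarith)
    nlinarith
  · have h1 := signedPow_mono hp h
    have h2 : max (m + g - b) 0 ≤ max (m + f - a) 0 := max_le_max_right _ (by linarith)
    nlinarith

/-- Where the positive part is nonzero, `a < m + f ≤ m + lam / 2`, hence `a - b < -lam / 2`. This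
gap is the source of the good negative term on the annulus. -/
theorem signedPow_mul_posPart_le_of_gap (hp : 1 < p) {m lam a b f l : ℝ} (hl : 0 ≤ lam) (hf : 0 ≤ f)
    (hfl : f ≤ l) (hl2 : l ≤ lam / 2) (hb : m + lam ≤ b) :
    signedPow p (a - b) * max (m + f - a) 0 ≤
      signedPow p f * max (m + f - a) 0 - (lam / 2) ^ (p - 1) * max (m + f - a) 0 := by
  rcases le_or_gt (m + f - a) 0 with h | h
  · rw [max_eq_right h]; simp
  · rw [max_eq_left h.le, ← sub_mul]
    refine mul_le_mul_of_nonneg_right ?_ h.le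
    have h1 : signedPow p (a - b) ≤ signedPow p (-(lam / 2)) := signedPow_mono hp (by linarith)
    rw [signedPow_neg, signedPow_of_nonneg hp (a := lam / 2) (by linarith)] at h1
    linarith [signedPow_nonneg (p := p) hf]

/-- Where the positive part is nonzero, `a - b < l + (m - b)_+`. Only the part of `u` below `m` is
charged at long range. -/
theorem signedPow_mul_posPart_le_far (hp : 1 < p) {m a b f l : ℝ} (hf : 0 ≤ f) (hfl : f ≤ l) :
    signedPow p (a - b) * max (m + f - a) 0 ≤
      2 ^ (p - 1) * (l ^ (p - 1) + max (m - b) 0 ^ (p - 1)) * max (m + f - a) 0 := by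
  rcases le_or_gt (m + f - a) 0 with h | h
  · rw [max_eq_right h]; simp
  · rw [max_eq_left h.le]
    refine mul_le_mul_of_nonneg_right ?_ h.le
    have hmax := le_max_left (m - b) 0
    have hmax0 := le_max_right (m - b) 0
    have h1 : signedPow p (a - b) ≤ signedPow p (l + max (m - b) 0) :=
      signedPow_mono hp (by linarith)
    rw [signedPow_of_nonneg hp (a := l + max (m - b) 0) (by linarith)] at h1
    exact h1.trans (add_rpow_le_two_rpow (by linarith) (by linarith) hmax0)

theorem exists_integral_kernel_compl_ball_le (N : ℕ) (s p : ℝ) :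
    ∃ J : ℝ, 0 ≤ J ∧ ∀ (x₀ : E N) (ρ : ℝ), 0 < ρ →
      ∫ y in (ball x₀ ρ)ᶜ, 1 / ‖y - x₀‖ ^ ((N : ℝ) + p * s) ≤ J * ρ ^ (-(p * s)) := by
  refine ⟨(∫⁻ h in (ball (0 : E N) 1)ᶜ, ENNReal.ofReal (1 / ‖h‖ ^ ((N : ℝ) + p * s))).toReal,
    ENNReal.toReal_nonneg, fun x₀ ρ hρ ↦ ?_⟩
  have h1 := lintegral_compl_ball_kernel_scale (s := s) (p := p) (fun _ ↦ 1) x₀ hρ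
  simp only [one_mul] at h1
  rw [integral_eq_lintegral_of_nonneg_ae (Filter.Eventually.of_forall fun y ↦ by
    simp only [Pi.zero_apply]; positivity) (Measurable.aestronglyMeasurable (by fun_prop)), h1,
    ENNReal.toReal_mul, ENNReal.toReal_ofReal (by positivity), mul_comm]

/-- The ratio of the two volumes is `2 ^ N - 1 ≥ 1`. -/
theorem volume_real_annulus (hN : 1 < N) (x₀ : E N) {r : ℝ} (hr : 0 < r) :
    volume.real (ball (0 : E N) 1) * r ^ N ≤ volume.real (ball x₀ (2 * r) \ ball x₀ r) := by
  have hball : ∀ ρ : ℝ, 0 ≤ ρ → volume.real (ball x₀ ρ) =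
      ρ ^ N * volume.real (ball (0 : E N) 1) := fun ρ hρ ↦ by
    have : Nontrivial (E N) := Module.nontrivial_of_finrank_pos (R := ℝ) (by rw [finrank_E]; omega)
    rw [measureReal_def, Measure.addHaar_ball _ _ hρ, ENNReal.toReal_mul, finrank_E,
      ENNReal.toReal_ofReal (by positivity), measureReal_def]
  rw [measureReal_sdiff (ball_subset_ball (by linarith)) measurableSet_ball, hball _ (by positivity),
    hball _ hr.le, mul_pow]
  have h2 : (2 : ℝ) ≤ 2 ^ N := le_self_pow₀ (by norm_num) (by omega)
  have h3 : 0 ≤ r ^ N * volume.real (ball (0 : E N) 1) := by positivity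
  nlinarith

/-- Comparison with the barrier on pairs of points of which the first is in the small ball. -/
theorem weakForm_integrand_le_barrier (hs : s ∈ Ioo (0 : ℝ) 1) (hp : 1 < p) {x₀ : E N} {r : ℝ}
    (hr : 0 < r) {u φ ψ H : E N → ℝ} {m lam l : ℝ} (hlam : 0 ≤ lam) (hl : 0 ≤ l)
    (hl2 : l ≤ lam / 2)
    (hφ0 : ∀ x, 0 ≤ φ x) (hφ1 : ∀ x, φ x ≤ 1) (hφs : ∀ x ∉ ball x₀ r, φ x = 0)
    (hψ : ψ = (ball x₀ r).indicator fun x ↦ max (m + l * φ x - u x) 0)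
    (hH : H = ({x | m + lam ≤ u x} ∩ (ball x₀ (2 * r) \ ball x₀ r)).indicator
        (fun _ ↦ -((lam / 2) ^ (p - 1) * (1 / (3 * r) ^ ((N : ℝ) + p * s)))) +
      (ball x₀ (4 * r))ᶜ.indicator (fun y ↦ 2 ^ (p - 1) * (4 / 3) ^ ((N : ℝ) + p * s) *
        (l ^ (p - 1) * (1 / ‖y - x₀‖ ^ ((N : ℝ) + p * s)) +
          max (m - u y) 0 ^ (p - 1) * (1 / ‖y - x₀‖ ^ ((N : ℝ) + p * s)))))
    {x y : E N} (hx : x ∈ ball x₀ r) (hmy : y ∈ ball x₀ (4 * r) → m ≤ u y) :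
    signedPow p (u x - u y) * (ψ x - ψ y) / ‖x - y‖ ^ ((N : ℝ) + p * s) ≤
      l ^ (p - 1) * (signedPow p (φ x - φ y) * (ψ x - ψ y) / ‖x - y‖ ^ ((N : ℝ) + p * s))
        + ψ x * H y ∧ H x = 0 := by
  have hD := kernel_exponent_pos (N := N) hs hp
  have hsub1 : ball x₀ r ⊆ ball x₀ (4 * r) := ball_subset_ball (by linarith)
  have hsub2 : ball x₀ (2 * r) ⊆ ball x₀ (4 * r) := ball_subset_ball (by linarith)
  have hHx : H x = 0 := by
    rw [hH, Pi.add_apply, indicator_of_notMem (fun h ↦ h.2.2 hx),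
      indicator_of_notMem (notMem_compl_iff.2 (hsub1 hx)), add_zero]
  refine ⟨?_, hHx⟩
  have hψx : ψ x = max (m + l * φ x - u x) 0 := by rw [hψ, indicator_of_mem hx]
  have hψx0 : 0 ≤ ψ x := hψx ▸ le_max_right _ _
  have hlφ0 : 0 ≤ l * φ x := mul_nonneg hl (hφ0 x)
  have hlφ : l * φ x ≤ l := mul_le_of_le_one_right hl (hφ1 x)
  have hscale : ∀ a, l ^ (p - 1) * signedPow p a = signedPow p (l * a) := fun a ↦
    (signedPow_mul hp hl a).symm
  rw [← mul_div_assoc, ← mul_assoc, hscale, mul_sub l]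
  by_cases hy : y ∈ ball x₀ (4 * r)
  · have hψy : ψ y = max (m + l * φ y - u y) 0 := by
      by_cases hy1 : y ∈ ball x₀ r
      · rw [hψ, indicator_of_mem hy1]
      · rw [hψ, indicator_of_notMem hy1, hφs y hy1, max_eq_right]
        linarith [hmy hy]
    by_cases hA : y ∈ {x | m + lam ≤ u x} ∩ (ball x₀ (2 * r) \ ball x₀ r)
    · have hHy : H y = -((lam / 2) ^ (p - 1) * (1 / (3 * r) ^ ((N : ℝ) + p * s))) := by
        rw [hH, Pi.add_apply, indicator_of_mem hA, indicator_of_notMem (notMem_compl_iff.2 hy),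
          add_zero]
      have hyφ : φ y = 0 := hφs y hA.2.2
      have hyψ : ψ y = 0 := by rw [hψ, indicator_of_notMem hA.2.2]
      have hgap := signedPow_mul_posPart_le_of_gap hp (a := u x) hlam hlφ0 hlφ hl2 hA.1
      rw [← hψx] at hgap
      rw [hHy, hyφ, hyψ, mul_zero, sub_zero, sub_zero]
      have hxy : 0 < ‖x - y‖ := by
        rw [norm_sub_pos_iff]; rintro rfl; exact hA.2.2 hx
      have hxy3 : ‖x - y‖ ≤ 3 * r := by
        have h1 : dist x x₀ < r := hx
        have h2 : dist y x₀ < 2 * r := hA.2.1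
        rw [← dist_eq_norm]
        linarith [dist_triangle_right x y x₀]
      have hk : 1 / (3 * r) ^ ((N : ℝ) + p * s) ≤ 1 / ‖x - y‖ ^ ((N : ℝ) + p * s) :=
        one_div_le_one_div_of_le (by positivity) (Real.rpow_le_rpow hxy.le hxy3 hD.le)
      have h1 := div_le_div_of_nonneg_right hgap
        (by positivity : 0 ≤ ‖x - y‖ ^ ((N : ℝ) + p * s))
      have h2 : (lam / 2) ^ (p - 1) * ψ x * (1 / (3 * r) ^ ((N : ℝ) + p * s)) ≤
          (lam / 2) ^ (p - 1) * ψ x * (1 / ‖x - y‖ ^ ((N : ℝ) + p * s)) :=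
        mul_le_mul_of_nonneg_left hk (by positivity)
      rw [mul_one_div _ (‖x - y‖ ^ _)] at h2
      rw [sub_div] at h1
      linarith
    · have hHy : H y = 0 := by
        rw [hH, Pi.add_apply, indicator_of_notMem hA, indicator_of_notMem (notMem_compl_iff.2 hy),
          add_zero]
      rw [hHy, mul_zero, add_zero, hψx, hψy]
      exact div_le_div_of_nonneg_right (signedPow_mul_posPart_sub_le hp m _ _ _ _) (by positivity)
  · have hy1 : y ∉ ball x₀ r := fun h ↦ hy (hsub1 h)
    have hyψ : ψ y = 0 := by rw [hψ, indicator_of_notMem hy1]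
    have hHy : H y = 2 ^ (p - 1) * (4 / 3) ^ ((N : ℝ) + p * s) *
        (l ^ (p - 1) * (1 / ‖y - x₀‖ ^ ((N : ℝ) + p * s)) +
          max (m - u y) 0 ^ (p - 1) * (1 / ‖y - x₀‖ ^ ((N : ℝ) + p * s))) := by
      rw [hH, Pi.add_apply, indicator_of_notMem (fun h ↦ hy (hsub2 h.2.1)),
        indicator_of_mem (show y ∈ (ball x₀ (4 * r))ᶜ from hy), zero_add]
    have hfar := signedPow_mul_posPart_le_far hp (a := u x) (b := u y) (m := m) hlφ0 hlφ
    rw [← hψx] at hfar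
    rw [hHy, hyψ, hφs y hy1, mul_zero, sub_zero, sub_zero]
    have hk := kernel_le_of_mem_ball hs hp hr hx hy
    have hmax : 0 ≤ max (m - u y) 0 := le_max_right _ _
    have h1 : signedPow p (u x - u y) * ψ x / ‖x - y‖ ^ ((N : ℝ) + p * s) ≤
        2 ^ (p - 1) * (l ^ (p - 1) + max (m - u y) 0 ^ (p - 1)) * ψ x *
          ((4 / 3) ^ ((N : ℝ) + p * s) * (1 / ‖y - x₀‖ ^ ((N : ℝ) + p * s))) := by
      rw [div_eq_mul_one_div]
      exact mul_le_mul hfar hk (by positivity) (by positivity)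
    have h2 : 0 ≤ signedPow p (l * φ x) * ψ x / ‖x - y‖ ^ ((N : ℝ) + p * s) :=
      div_nonneg (mul_nonneg (signedPow_nonneg hlφ0) hψx0) (by positivity)
    linarith

/-- Growth lemma: a weak supersolution that is large on half of an annulus is larger inside. -/
theorem exists_growth (hN : 1 < N) (hs : s ∈ Ioo (0 : ℝ) 1) (hp : 1 < p) :
    ∃ δ κ : ℝ, 0 < δ ∧ δ ≤ 1 ∧ 0 < κ ∧ ∀ (U : Set (E N)) (K : ℝ) (u : E N → ℝ) (M : ℝ),
      MeasurableSet U → WeakGE s p U u (-K) → (∀ᵐ x, x ∈ U → |u x| ≤ M) →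
      ∀ (x₀ : E N) (r : ℝ), 0 < r → ball x₀ (4 * r) ⊆ U → ∀ m lam : ℝ, 0 < lam →
      (∀ᵐ x, x ∈ ball x₀ (4 * r) → m ≤ u x) →
      volume.real (ball x₀ (2 * r) \ ball x₀ r) ≤
        2 * volume.real ({x | m + lam ≤ u x} ∩ (ball x₀ (2 * r) \ ball x₀ r)) →
      K ≤ κ * lam ^ (p - 1) * r ^ (-(p * s)) →
      ∫⁻ y in (ball x₀ (4 * r))ᶜ, ENNReal.ofReal (max (m - u y) 0 ^ (p - 1) *
        (1 / ‖y - x₀‖ ^ ((N : ℝ) + p * s))) ≤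
          ENNReal.ofReal (κ * lam ^ (p - 1) * r ^ (-(p * s))) →
      ∀ᵐ x, x ∈ ball x₀ (r / 2) → m + δ * lam ≤ u x := by
  have hD := kernel_exponent_pos (N := N) hs hp
  have hps : 0 < p * s := mul_pos (by linarith) hs.1
  have hq : 0 < p - 1 := by linarith
  -- The exponent of the barrier is taken large enough for the condition of the bump estimates; this
  -- matters as `p` approaches `1`.
  obtain ⟨k, hk⟩ := exists_nat_ge (p / (p - 1))
  have hkm : p ≤ (2 * (k + 1) : ℕ) * (p - 1) := by
    rw [div_le_iff₀ hq] at hk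
    have hk0 : (0 : ℝ) ≤ k := Nat.cast_nonneg k
    push_cast
    nlinarith
  obtain ⟨C, hC, hbump⟩ := exists_weakForm_scaledBump_le (N := N) hN hs hp hkm
  obtain ⟨J, hJ, hJker⟩ := exists_integral_kernel_compl_ball_le N s p
  set C₃ : ℝ := 2 ^ (p - 1) * (4 / 3) ^ ((N : ℝ) + p * s) with hC₃
  have hC₃0 : 0 ≤ C₃ := by positivity
  set v : ℝ := volume.real (ball (0 : E N) 1) with hv
  have hv0 : 0 < v := by
    rw [hv, measureReal_def]
    exact ENNReal.toReal_pos (measure_ball_pos _ _ one_pos).ne' measure_ball_lt_top.ne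
  -- The guaranteed annulus gain: gap `lam / 2`, distance at most `3r`, and half the lower bound `v
  -- r^N` for the volume of the annulus.
  set c₀ : ℝ := (1 / 2) ^ (p - 1) * (1 / 3 ^ ((N : ℝ) + p * s)) * (v / 2) with hc₀
  have hc₀0 : 0 < c₀ := by positivity
  -- The first entry makes the gain outweigh the sum of `K`, the barrier's operator and the tails;
  -- the second gives `L ≤ 1/2`, so the barrier height `l = L lam` stays below half the gap.
  set κ : ℝ := min (c₀ / (1 + C + 2 * C₃ * (J + 1))) ((1 / 2) ^ (p - 1)) with hκ
  have hκ0 : 0 < κ := by rw [hκ]; positivity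
  have hκ1 : κ * (1 + C + 2 * C₃ * (J + 1)) ≤ c₀ := by
    have := min_le_left (c₀ / (1 + C + 2 * C₃ * (J + 1))) ((1 / 2) ^ (p - 1))
    rwa [← hκ, le_div_iff₀ (by positivity)] at this
  set L : ℝ := κ ^ (1 / (p - 1)) with hL
  have hL0 : 0 < L := by positivity
  have hLκ : L ^ (p - 1) = κ := by
    rw [hL, ← Real.rpow_mul hκ0.le, one_div_mul_cancel hq.ne', Real.rpow_one]
  have hL2 : L ≤ 1 / 2 := by
    rw [hL]
    refine (Real.rpow_le_rpow hκ0.le (min_le_right _ _) (by positivity)).trans (le_of_eq ?_)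
    rw [← Real.rpow_mul (by norm_num), mul_one_div_cancel hq.ne', Real.rpow_one]
  -- The factor `1/2` is the lower bound of the bump on the half ball.
  refine ⟨L / 2, κ, by positivity, by linarith, hκ0, ?_⟩
  intro U K u M hUm hweak hub x₀ r hr hU m lam hlam hm hvol hK htail
  obtain ⟨hW, htest⟩ := hweak
  have hum := hW.aestronglyMeasurable
  set l : ℝ := L * lam with hl
  have hl0 : 0 < l := by positivity
  have hl2 : l ≤ lam / 2 := by rw [hl]; nlinarith
  set φ := scaledBump k x₀ r with hφ
  have hφm : Measurable φ := measurable_scaledBump k x₀ r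
  have hφ0 : ∀ x, 0 ≤ φ x := scaledBump_nonneg k x₀ r
  have hφ1 : ∀ x, φ x ≤ 1 := scaledBump_le_one k x₀ r
  have hφs : ∀ x ∉ ball x₀ r, φ x = 0 := fun x hx ↦ scaledBump_eq_zero k hr hx
  have hsub1 : ball x₀ r ⊆ ball x₀ (4 * r) := ball_subset_ball (by linarith)
  set ψ : E N → ℝ := (ball x₀ r).indicator fun x ↦ max (m + l * φ x - u x) 0 with hψ
  have hψ0 : ∀ x, 0 ≤ ψ x := fun x ↦ indicator_nonneg (fun _ _ ↦ le_max_right _ _) x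
  have hψs : ∀ x ∉ ball x₀ r, ψ x = 0 := fun x hx ↦ indicator_of_notMem hx _
  have hψm : AEStronglyMeasurable ψ volume := by
    refine AEStronglyMeasurable.indicator ?_ measurableSet_ball
    exact ((((hφm.const_mul l).const_add m).aestronglyMeasurable).sub hum).sup
      aestronglyMeasurable_const
  have hψb : ∀ᵐ x, |ψ x| ≤ l := by
    filter_upwards [hm] with x hx
    rw [abs_of_nonneg (hψ0 x)]
    by_cases h : x ∈ ball x₀ r
    · rw [hψ, indicator_of_mem h]
      refine max_le ?_ hl0.le
      have := mul_le_of_le_one_right hl0.le (hφ1 x)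
      linarith [hx (hsub1 h)]
    · rw [hψs x h]; exact hl0.le
  have hφL : ∀ x y, |φ x - φ y| ≤ (2 * (k + 1) : ℕ) / r * ‖x - y‖ := abs_scaledBump_sub_le k x₀ hr
  have hφe : IntegrableOn (energyDensity s p φ) (ball x₀ (4 * r) ×ˢ ball x₀ (4 * r)) :=
    integrableOn_energyDensity_of_lipschitz hN hs hp hφm.aestronglyMeasurable (by positivity)
      hφL _ _
  have hue : IntegrableOn (energyDensity s p u) (ball x₀ (4 * r) ×ˢ ball x₀ (4 * r)) :=
    hW.integrableOn_energyDensity.mono_set (prod_mono hU hU)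
  have hm1 : ∀ᵐ z : E N × E N, z.1 ∈ ball x₀ (4 * r) → m ≤ u z.1 :=
    Measure.quasiMeasurePreserving_fst.ae hm
  have hm2 : ∀ᵐ z : E N × E N, z.2 ∈ ball x₀ (4 * r) → m ≤ u z.2 :=
    Measure.quasiMeasurePreserving_snd.ae hm
  have hψe : IntegrableOn (energyDensity s p ψ) (ball x₀ (4 * r) ×ˢ ball x₀ (4 * r)) := by
    refine Integrable.mono' ((hue.add (hφe.const_mul (l ^ p))).const_mul (2 ^ p))
      (aestronglyMeasurable_energyDensity hψm).restrict ?_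
    filter_upwards [ae_restrict_mem (measurableSet_ball.prod measurableSet_ball),
      ae_restrict_of_ae hm1, ae_restrict_of_ae hm2] with z hz h1 h2
    -- Cutting `ψ` off at `B_r` creates no jump inside `B_{4r}`: there `φ` vanishes outside `B_r`
    -- and `u ≥ m`, so the positive part is already zero. Hence `ψ` inherits finite energy from `u`
    -- and `φ`.
    have hform : ∀ x ∈ ball x₀ (4 * r), m ≤ u x → ψ x = max (m + l * φ x - u x) 0 := by
      intro x _ hmx
      by_cases hx1 : x ∈ ball x₀ r
      · rw [hψ, indicator_of_mem hx1]
      · rw [hψs x hx1, hφs x hx1, max_eq_right]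
        linarith
    rw [Real.norm_of_nonneg (energyDensity_nonneg _ _)]
    simp only [energyDensity, Pi.add_apply]
    rw [← mul_div_assoc, ← add_div, ← mul_div_assoc]
    refine div_le_div_of_nonneg_right ?_ (by positivity)
    rw [← Real.mul_rpow hl0.le (abs_nonneg _)]
    refine (Real.rpow_le_rpow (abs_nonneg _) ?_ (by linarith)).trans
      (add_rpow_le_two_rpow (by linarith) (abs_nonneg _) (by positivity))
    rw [hform _ hz.1 (h1 hz.1), hform _ hz.2 (h2 hz.2)]
    refine (abs_max_sub_max_le_abs _ _ _).trans ?_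
    have e : m + l * φ z.1 - u z.1 - (m + l * φ z.2 - u z.2) =
      -(u z.1 - u z.2) + l * (φ z.1 - φ z.2) := by ring
    rw [e]
    refine (abs_add_le _ _).trans ?_
    rw [abs_neg, abs_mul, abs_of_pos hl0]
  have hψW := memW_univ_of_energy hs hp hr hψm hψb hψs hψe
  have hψi : Integrable ψ := by
    have h1 : IntegrableOn ψ (ball x₀ r) := by
      have : IsFiniteMeasure (volume.restrict (ball x₀ r)) := ⟨by simp [measure_ball_lt_top]⟩
      exact Integrable.of_bound hψm.restrict l (ae_restrict_of_ae hψb)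
    have := (integrable_indicator_iff measurableSet_ball).2 h1
    rwa [indicator_eq_self.2] at this
    intro x hx
    by_contra hx'
    exact hx (hψs x hx')
  have hIu := integrable_weakForm_integrand hs hp hr (M := M) hum
    (hub.mono fun x hx h ↦ hx (hU (hsub1 h))) hue (hW.integrableOn_tail hs hp x₀ (by linarith))
    hψm hψb hψs hψe
  have hIφ := integrable_weakForm_integrand hs hp hr (M := 1) (u := φ) hφm.aestronglyMeasurable
    (Filter.Eventually.of_forall fun x _ ↦ by rw [abs_of_nonneg (hφ0 x)]; exact hφ1 x) hφe
    (by
      refine (integrableOn_zero (ε' := ℝ)).congr_fun (fun y hy ↦ ?_) measurableSet_ball.compl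
      rw [hφs y fun h ↦ hy (hsub1 h), abs_zero, Real.zero_rpow hq.ne', zero_mul])
    hψm hψb hψs hψe
  have hwφ := hbump x₀ r hr ψ hψi hψ0 hψs hIφ
  have hAm : NullMeasurableSet ({x | m + lam ≤ u x} ∩ (ball x₀ (2 * r) \ ball x₀ r)) volume :=
    (nullMeasurableSet_le aemeasurable_const hum.aemeasurable).inter
      (measurableSet_ball.diff measurableSet_ball).nullMeasurableSet
  have hAfin : volume ({x | m + lam ≤ u x} ∩ (ball x₀ (2 * r) \ ball x₀ r)) ≠ ∞ :=
    ((measure_mono (inter_subset_right.trans sdiff_subset)).trans_lt measure_ball_lt_top).ne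
  have hker := integrableOn_kernel_compl_ball_center (N := N) hs hp x₀ (by linarith : 0 < 4 * r)
  have htm : AEMeasurable (fun y : E N ↦ max (m - u y) 0 ^ (p - 1) *
      (1 / ‖y - x₀‖ ^ ((N : ℝ) + p * s))) volume := by
    have h1 : Measurable fun t : ℝ ↦ max (m - t) 0 ^ (p - 1) := by fun_prop
    exact (h1.comp_aemeasurable hum.aemeasurable).mul (Measurable.aemeasurable (by fun_prop))
  have htnn : ∀ y : E N, 0 ≤ max (m - u y) 0 ^ (p - 1) * (1 / ‖y - x₀‖ ^ ((N : ℝ) + p * s)) :=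
    fun y ↦ mul_nonneg (Real.rpow_nonneg (le_max_right _ _) _) (by positivity)
  have hti : IntegrableOn (fun y : E N ↦ max (m - u y) 0 ^ (p - 1) *
      (1 / ‖y - x₀‖ ^ ((N : ℝ) + p * s))) (ball x₀ (4 * r))ᶜ := by
    refine ⟨htm.aestronglyMeasurable.restrict, ?_⟩
    rw [hasFiniteIntegral_iff_ofReal (Filter.Eventually.of_forall htnn)]
    exact htail.trans_lt ENNReal.ofReal_lt_top
  have htb : ∫ y in (ball x₀ (4 * r))ᶜ, max (m - u y) 0 ^ (p - 1) *
      (1 / ‖y - x₀‖ ^ ((N : ℝ) + p * s)) ≤ κ * lam ^ (p - 1) * r ^ (-(p * s)) := by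
    rw [integral_eq_lintegral_of_nonneg_ae (Filter.Eventually.of_forall htnn)
      htm.aestronglyMeasurable.restrict]
    exact ENNReal.toReal_le_of_le_ofReal (by positivity) htail
  -- `H` collects the interaction of a point of `B_r` with the outside: the gain on the good part of
  -- the annulus and the loss beyond `B_{4r}`. It vanishes on `B_r`, so each mixed pair is counted
  -- through one coordinate only.
  set H : E N → ℝ := ({x | m + lam ≤ u x} ∩ (ball x₀ (2 * r) \ ball x₀ r)).indicator
        (fun _ ↦ -((lam / 2) ^ (p - 1) * (1 / (3 * r) ^ ((N : ℝ) + p * s)))) +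
      (ball x₀ (4 * r))ᶜ.indicator (fun y ↦ C₃ *
        (l ^ (p - 1) * (1 / ‖y - x₀‖ ^ ((N : ℝ) + p * s)) +
          max (m - u y) 0 ^ (p - 1) * (1 / ‖y - x₀‖ ^ ((N : ℝ) + p * s)))) with hH
  have hH1i : Integrable (({x | m + lam ≤ u x} ∩ (ball x₀ (2 * r) \ ball x₀ r)).indicator
        (fun _ ↦ -((lam / 2) ^ (p - 1) * (1 / (3 * r) ^ ((N : ℝ) + p * s))))) :=
    (integrableOn_const hAfin).integrable_indicator₀ hAm
  have hH2i' : IntegrableOn (fun y ↦ C₃ * (l ^ (p - 1) * (1 / ‖y - x₀‖ ^ ((N : ℝ) + p * s)) +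
      max (m - u y) 0 ^ (p - 1) * (1 / ‖y - x₀‖ ^ ((N : ℝ) + p * s)))) (ball x₀ (4 * r))ᶜ :=
    ((hker.const_mul (l ^ (p - 1))).add hti).const_mul C₃
  have hH2i := (integrable_indicator_iff measurableSet_ball.compl).2 hH2i'
  have hHi : Integrable H := hH1i.add hH2i
  have hlp : l ^ (p - 1) = κ * lam ^ (p - 1) := by rw [hl, Real.mul_rpow hL0.le hlam.le, hLκ]
  have hHint : ∫ y, H y ≤ (-c₀ + C₃ * (κ * (J + 1))) * (lam ^ (p - 1) * r ^ (-(p * s))) := by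
    have e1 : ∫ y, H y = -((lam / 2) ^ (p - 1) * (1 / (3 * r) ^ ((N : ℝ) + p * s))) *
        volume.real ({x | m + lam ≤ u x} ∩ (ball x₀ (2 * r) \ ball x₀ r)) +
        C₃ * (l ^ (p - 1) * (∫ y in (ball x₀ (4 * r))ᶜ, 1 / ‖y - x₀‖ ^ ((N : ℝ) + p * s)) +
          ∫ y in (ball x₀ (4 * r))ᶜ, max (m - u y) 0 ^ (p - 1) *
            (1 / ‖y - x₀‖ ^ ((N : ℝ) + p * s))) := by
      rw [hH, integral_add' hH1i hH2i, integral_indicator₀ hAm,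
        integral_indicator measurableSet_ball.compl, setIntegral_const, integral_const_mul,
        integral_add (hker.const_mul _) hti, integral_const_mul, smul_eq_mul,
        mul_comm (volume.real _)]
    have hvA : v * r ^ N / 2 ≤
        volume.real ({x | m + lam ≤ u x} ∩ (ball x₀ (2 * r) \ ball x₀ r)) := by
      have := volume_real_annulus hN x₀ hr
      linarith
    have hr4 : (4 * r) ^ (-(p * s)) ≤ r ^ (-(p * s)) :=
      Real.rpow_le_rpow_of_nonpos hr (by linarith) (by linarith)
    have hJ4 : ∫ y in (ball x₀ (4 * r))ᶜ, 1 / ‖y - x₀‖ ^ ((N : ℝ) + p * s) ≤ J * r ^ (-(p * s)) :=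
      (hJker x₀ (4 * r) (by linarith)).trans (mul_le_mul_of_nonneg_left hr4 hJ)
    have e2 : (lam / 2) ^ (p - 1) * (1 / (3 * r) ^ ((N : ℝ) + p * s)) * (v * r ^ N / 2) =
        c₀ * (lam ^ (p - 1) * r ^ (-(p * s))) := by
      have e3 : r ^ ((N : ℝ) + p * s) = r ^ N * r ^ (p * s) := by
        rw [Real.rpow_add hr, Real.rpow_natCast]
      rw [div_eq_mul_one_div lam 2, Real.mul_rpow hlam.le (by norm_num),
        Real.mul_rpow (by norm_num) hr.le, e3, Real.rpow_neg hr.le, hc₀]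
      field_simp
    have h1 := mul_le_mul_of_nonneg_left hvA (by positivity :
      0 ≤ (lam / 2) ^ (p - 1) * (1 / (3 * r) ^ ((N : ℝ) + p * s)))
    have h2 := mul_le_mul_of_nonneg_left hJ4 (by positivity : 0 ≤ l ^ (p - 1))
    have h3 := mul_le_mul_of_nonneg_left (add_le_add h2 htb) hC₃0
    rw [e1]
    rw [hlp] at h3 ⊢
    rw [e2] at h1
    linarith
  have hpt : ∀ᵐ z : E N × E N, signedPow p (u z.1 - u z.2) * (ψ z.1 - ψ z.2) /
      ‖z.1 - z.2‖ ^ ((N : ℝ) + p * s) ≤ l ^ (p - 1) * (signedPow p (φ z.1 - φ z.2) *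
        (ψ z.1 - ψ z.2) / ‖z.1 - z.2‖ ^ ((N : ℝ) + p * s)) +
        (ψ z.1 * H z.2 + ψ z.swap.1 * H z.swap.2) := by
    filter_upwards [hm1, hm2] with z h1 h2
    simp only [Prod.fst_swap, Prod.snd_swap]
    by_cases hx : z.1 ∈ ball x₀ r
    · obtain ⟨h3, h4⟩ := weakForm_integrand_le_barrier hs hp hr hlam.le hl0.le hl2 hφ0 hφ1 hφs
        hψ hH hx h2
      rw [h4, mul_zero, add_zero]
      exact h3
    · by_cases hy : z.2 ∈ ball x₀ r
      · obtain ⟨h3, h4⟩ := weakForm_integrand_le_barrier hs hp hr hlam.le hl0.le hl2 hφ0 hφ1 hφs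
          hψ hH hy h1
        rw [h4, mul_zero, zero_add]
        have hflip : ∀ a b c d : ℝ, signedPow p (a - b) * (c - d) =
            signedPow p (b - a) * (d - c) := fun a b c d ↦ by
          rw [← neg_sub b a, signedPow_neg]; ring
        rw [hflip (u z.1), hflip (φ z.1), norm_sub_rev z.1]
        exact h3
      · simp [hψs _ hx, hψs _ hy]
  have hψH : Integrable fun z : E N × E N ↦ ψ z.1 * H z.2 := hψi.mul_prod hHi
  obtain ⟨hsw1, hsw2⟩ := integral_prod_swap_add hψH
  have hint := integral_mono_ae hIu ((hIφ.const_mul (l ^ (p - 1))).add hsw1) hpt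
  have hsum : ∫ z : E N × E N, ((fun z : E N × E N ↦ l ^ (p - 1) * (signedPow p (φ z.1 - φ z.2) *
        (ψ z.1 - ψ z.2) / ‖z.1 - z.2‖ ^ ((N : ℝ) + p * s))) +
        fun z : E N × E N ↦ (ψ z.1 * H z.2 + ψ z.swap.1 * H z.swap.2)) z =
      l ^ (p - 1) * weakForm s p φ ψ + 2 * ((∫ x, ψ x) * ∫ y, H y) := by
    rw [integral_add' (hIφ.const_mul _) hsw1, hsw2, integral_const_mul]
    congr 2
    rw [Measure.volume_eq_prod, integral_prod_mul]
  rw [hsum] at hint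
  have hUint : ∫ x in U, ψ x = ∫ x, ψ x :=
    setIntegral_eq_integral_of_forall_compl_eq_zero fun x hx ↦
      hψs x fun h ↦ hx (hU (hsub1 h))
  have hte := htest ψ ⟨hψW, (ae_restrict_iff' hUm.compl).2 (Filter.Eventually.of_forall fun x hx ↦
    hψs x fun h ↦ hx (hU (hsub1 h)))⟩ (Filter.Eventually.of_forall hψ0)
  rw [hUint] at hte
  have hte' : -K * ∫ x, ψ x ≤ l ^ (p - 1) * weakForm s p φ ψ + 2 * ((∫ x, ψ x) * ∫ y, H y) :=
    hte.trans hint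
  have hΨ0 : 0 ≤ ∫ x, ψ x := integral_nonneg hψ0
  set Λ : ℝ := lam ^ (p - 1) * r ^ (-(p * s)) with hΛ
  have hΛ0 : 0 < Λ := by positivity
  -- After division by `(∫ ψ) Λ` the tested inequality would read `2 c₀ ≤ κ (1 + C + 2 C₃ (J + 1))`,
  -- while the right side is at most `c₀`.
  have hΨ : ∫ x, ψ x = 0 := by
    by_contra hne
    have hpos : 0 < ∫ x, ψ x := lt_of_le_of_ne hΨ0 (Ne.symm hne)
    have h1 := mul_le_mul_of_nonneg_left hwφ (by positivity : 0 ≤ l ^ (p - 1))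
    have h2 := mul_le_mul_of_nonneg_left hHint hΨ0
    have h3 := mul_le_mul_of_nonneg_right hK hΨ0
    rw [hlp] at h1 hte'
    have h4 : 0 ≤ (∫ x, ψ x) * Λ * (κ * (1 + C + 2 * C₃ * (J + 1)) - 2 * c₀) := by
      rw [hΛ] at h2 ⊢
      linarith
    have h5 : (∫ x, ψ x) * Λ * (κ * (1 + C + 2 * C₃ * (J + 1)) - 2 * c₀) < 0 :=
      mul_neg_of_pos_of_neg (by positivity) (by linarith)
    linarith
  have hae : ψ =ᵐ[volume] 0 := (integral_eq_zero_iff_of_nonneg hψ0 hψi).1 hΨ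
  filter_upwards [hae] with x hx hxb
  have hx1 : x ∈ ball x₀ r := ball_subset_ball (by linarith) hxb
  rw [hψ, indicator_of_mem hx1, Pi.zero_apply] at hx
  have h1 : m + l * φ x - u x ≤ 0 := by rw [← hx]; exact le_max_left _ _
  have h2 := mul_le_mul_of_nonneg_left (half_le_scaledBump k hr hxb) hl0.le
  rw [hl] at h1 h2
  linarith

end Growth

/-! ### Bounds at all scales and the tail they control. -/

section Oscillation

variable {N : ℕ} {s p : ℝ}

/-- As `α → 0` the weight `(8‖h‖)^α - 1` tends to zero pointwise, and dominated convergence applies.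
This is what makes the exponent `α` small in the theorem. -/
theorem exists_tail_weight_le (hs : s ∈ Ioo (0 : ℝ) 1) (hp : 1 < p) {η a₀ : ℝ} (hη : 0 < η)
    (ha₀ : 0 < a₀) : ∃ α : ℝ, 0 < α ∧ α ≤ a₀ ∧
      ∫⁻ h in (ball (0 : E N) 1)ᶜ, ENNReal.ofReal (((8 * ‖h‖) ^ α - 1) ^ (p - 1)) *
        ENNReal.ofReal (1 / ‖h‖ ^ ((N : ℝ) + p * s)) ≤ ENNReal.ofReal η := by
  have hq : 0 < p - 1 := by linarith
  have hps : 0 < p * s := mul_pos (by linarith) hs.1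
  set a₁ : ℝ := p * s / (2 * (p - 1)) with ha₁
  have ha₁0 : 0 < a₁ := by positivity
  let a : ℕ → ℝ := fun n ↦ min a₀ a₁ * (1 / ((n : ℝ) + 1))
  have ha0 : ∀ n, 0 < a n := fun n ↦ by positivity
  have hale : ∀ n, a n ≤ min a₀ a₁ := fun n ↦ by
    refine mul_le_of_le_one_right (by positivity) ?_
    rw [div_le_one (by positivity)]
    linarith [(Nat.cast_nonneg n : (0 : ℝ) ≤ n)]
  have halim : Filter.Tendsto a Filter.atTop (nhds 0) := by
    have h := (tendsto_one_div_add_atTop_nhds_zero_nat (𝕜 := ℝ)).const_mul (min a₀ a₁)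
    rwa [mul_zero] at h
  -- Since `α (p - 1) ≤ ps / 2` along the sequence, the weight costs at most half of the decay; the
  -- majorant is a multiple of the kernel of order `s / 2`.
  have hs2 : s / 2 ∈ Ioo (0 : ℝ) 1 := ⟨by linarith [hs.1], by linarith [hs.2, hs.1]⟩
  have hdom := ((integrableOn_kernel_compl_ball (N := N) hs2 hp one_pos).const_mul
    (8 ^ (p * s / 2))).lintegral_lt_top
  have hlim : Filter.Tendsto (fun n ↦ ∫⁻ h in (ball (0 : E N) 1)ᶜ,
      ENNReal.ofReal (((8 * ‖h‖) ^ a n - 1) ^ (p - 1)) *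
        ENNReal.ofReal (1 / ‖h‖ ^ ((N : ℝ) + p * s))) Filter.atTop
      (nhds (∫⁻ h in (ball (0 : E N) 1)ᶜ, 0)) := by
    refine tendsto_lintegral_of_dominated_convergence _ (fun n ↦ by fun_prop) (fun n ↦ ?_)
      hdom.ne ?_
    · filter_upwards [ae_restrict_mem measurableSet_ball.compl] with h hh
      have hh : 1 ≤ ‖h‖ := by simpa using hh
      have hpos : 0 < ‖h‖ := by linarith
      rw [← ENNReal.ofReal_mul' (by positivity)]
      refine ENNReal.ofReal_le_ofReal ?_
      have h8 : 1 ≤ 8 * ‖h‖ := by linarith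
      have h0 : 0 ≤ (8 * ‖h‖) ^ a n - 1 := sub_nonneg.2 (Real.one_le_rpow h8 (ha0 n).le)
      have h1 : ((8 * ‖h‖) ^ a n - 1) ^ (p - 1) ≤ (8 * ‖h‖) ^ (p * s / 2) := by
        calc _ ≤ ((8 * ‖h‖) ^ a₁) ^ (p - 1) := by
              refine Real.rpow_le_rpow h0 ?_ hq.le
              have := Real.rpow_le_rpow_of_exponent_le h8 ((hale n).trans (min_le_right _ _))
              linarith
          _ = _ := by
              rw [← Real.rpow_mul (by positivity), ha₁]
              congr 1; field_simp
      refine (mul_le_mul_of_nonneg_right h1 (by positivity)).trans (le_of_eq ?_)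
      rw [Real.mul_rpow (by norm_num) hpos.le, mul_assoc, mul_one_div, one_div,
        ← Real.rpow_neg hpos.le, ← Real.rpow_sub hpos]
      congr 2; ring
    · filter_upwards [ae_restrict_mem measurableSet_ball.compl] with h hh
      have hh : 1 ≤ ‖h‖ := by simpa using hh
      have hc : Filter.Tendsto (fun n ↦ (8 * ‖h‖) ^ a n) Filter.atTop (nhds 1) := by
        have := (Real.continuousAt_const_rpow (by positivity : 8 * ‖h‖ ≠ 0)).tendsto.comp halim
        rwa [Real.rpow_zero] at this
      have hc2 : Filter.Tendsto (fun n ↦ ((8 * ‖h‖) ^ a n - 1) ^ (p - 1)) Filter.atTop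
          (nhds 0) := by
        have := (hc.sub_const 1).rpow_const (p := p - 1) (Or.inr hq.le)
        simpa [Real.zero_rpow hq.ne'] using this
      have hc3 := ENNReal.tendsto_ofReal hc2
      rw [ENNReal.ofReal_zero] at hc3
      simpa using ENNReal.Tendsto.mul_const hc3
        (Or.inr (ENNReal.ofReal_ne_top (r := 1 / ‖h‖ ^ ((N : ℝ) + p * s))))
  rw [lintegral_zero] at hlim
  obtain ⟨n, hn⟩ := (hlim.eventually_le_const (ENNReal.ofReal_pos.2 hη)).exists
  exact ⟨a n, ha0 n, (hale n).trans (min_le_left _ _), hn⟩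

/-- Bounds on a function on geometrically shrinking balls, all compatible with the interval
`[m, m + ω j]` reached at step `j`. -/
structure OscBound (u : E N → ℝ) (x₀ : E N) (R : ℝ) (ω : ℕ → ℝ) (j : ℕ) (m : ℝ) : Prop where
  bound : ∀ i ≤ j, ∀ᵐ x, x ∈ ball x₀ (R * (1 / 8) ^ i) → m + ω j - ω i ≤ u x ∧ u x ≤ m + ω i
  lower : -(ω 0 / 2) ≤ m
  upper : m + ω j ≤ ω 0 / 2

/-- The bounds at level `i` refer only to the last interval `[m, m + ω j]`. They are what nested
intervals of lengths `ω i` imply, in a form invariant under reflection, so one growth step serves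
both `u` and `-u`. -/
theorem OscBound.neg {u : E N → ℝ} {x₀ : E N} {R : ℝ} {ω : ℕ → ℝ} {j : ℕ} {m : ℝ}
    (h : OscBound u x₀ R ω j m) : OscBound (fun x ↦ -u x) x₀ R ω j (-(m + ω j)) where
  bound i hi := by
    filter_upwards [h.bound i hi] with x hx hxb
    obtain ⟨h1, h2⟩ := hx hxb
    constructor <;> linarith
  lower := by linarith [h.upper]
  upper := by linarith [h.lower]

/-- The structural assumptions under which the oscillation decays, normalised by `Q`. -/
structure DecayData (s p R K Q : ℝ) (x₀ : E N) (u : E N → ℝ) : Prop where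
  weak : WeakGE s p (ball (0 : E N) (2 * R)) u (-K)
  bound : ∀ᵐ x, x ∈ ball (0 : E N) (2 * R) → |u x| ≤ Q
  center : x₀ ∈ ball (0 : E N) R
  rhs : K ≤ Q ^ (p - 1) * R ^ (-(p * s))
  tail : ∫⁻ y in (ball (0 : E N) (2 * R))ᶜ, ENNReal.ofReal (|u y| ^ (p - 1) *
    (1 / ‖y‖ ^ ((N : ℝ) + p * s))) ≤ ENNReal.ofReal (Q ^ (p - 1) * R ^ (-(p * s)))

theorem geometric_ratio (α : ℝ) (i k : ℕ) (A : ℝ) :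
    A * ((1 / 8 : ℝ) ^ α) ^ i = A * ((1 / 8 : ℝ) ^ α) ^ (i + k) * ((8 : ℝ) ^ k) ^ α := by
  have h : ((1 / 8 : ℝ) ^ α) ^ k * ((8 : ℝ) ^ k) ^ α = 1 := by
    rw [← Real.rpow_natCast, ← Real.rpow_mul (by norm_num), mul_comm α, Real.rpow_mul (by norm_num),
      Real.rpow_natCast, ← Real.mul_rpow (by positivity) (by positivity), ← mul_pow]
    norm_num
  rw [pow_add]
  linear_combination (-(A * ((1 / 8 : ℝ) ^ α) ^ i)) * h

/-- A point outside the last ball lies between two consecutive earlier balls or outside the first.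
In the annulus between levels `i` and `i + 1`, `u` drops below `m` by at most `ω i - ω j`, and
geometric decay of `ω` converts this into a power of the distance; the factor `8` pays for the
annulus having two radii. -/
theorem OscBound.sub_le {u : E N → ℝ} {x₀ : E N} {R Q A α : ℝ} {ω : ℕ → ℝ} {j : ℕ} {m : ℝ}
    (hR : 0 < R) (hα : 0 < α) (hQ : 0 ≤ Q) (hA : 2 * Q ≤ A)
    (hω : ω = fun i ↦ A * ((1 / 8 : ℝ) ^ α) ^ i)
    (hub : ∀ᵐ x, x ∈ ball (0 : E N) (2 * R) → |u x| ≤ Q)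
    (h : OscBound u x₀ R ω j m) :
    ∀ᵐ y, y ∉ ball x₀ (R * (1 / 8) ^ j) →
      max (m - u y) 0 ≤ ω j * ((8 * (‖y - x₀‖ / (R * (1 / 8) ^ j))) ^ α - 1) +
        (ball (0 : E N) (2 * R))ᶜ.indicator (fun y ↦ |u y|) y := by
  have hall : ∀ᵐ y, ∀ i, i ≤ j → y ∈ ball x₀ (R * (1 / 8) ^ i) → m + ω j - ω i ≤ u y := by
    rw [ae_all_iff]
    intro i
    by_cases hi : i ≤ j
    · filter_upwards [h.bound i hi] with y hy _ hyb using (hy hyb).1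
    · exact Filter.Eventually.of_forall fun y hi' ↦ absurd hi' hi
  have hωj : 0 ≤ ω j := by
    rw [hω]
    have : 0 ≤ A := by linarith
    positivity
  filter_upwards [hall, hub] with y hy huy hyj
  have hrj : 0 < R * (1 / 8 : ℝ) ^ j := by positivity
  have hind : 0 ≤ (ball (0 : E N) (2 * R))ᶜ.indicator (fun y ↦ |u y|) y :=
    indicator_nonneg (fun _ _ ↦ abs_nonneg _) _
  have hratio : ∀ i k, i + k = j → R * (1 / 8) ^ i ≤ 8 * ‖y - x₀‖ →
      ω i - ω j ≤ ω j * ((8 * (‖y - x₀‖ / (R * (1 / 8) ^ j))) ^ α - 1) := by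
    rintro i k rfl hik
    have h1 : ω i = ω (i + k) * ((8 : ℝ) ^ k) ^ α := by
      simp only [hω]; exact geometric_ratio α i k A
    have h2 : (8 : ℝ) ^ k ≤ 8 * (‖y - x₀‖ / (R * (1 / 8) ^ (i + k))) := by
      rw [← mul_div_assoc, le_div_iff₀ hrj]
      refine le_trans (le_of_eq ?_) hik
      rw [pow_add]
      have : (8 : ℝ) ^ k * (1 / 8) ^ k = 1 := by rw [← mul_pow]; norm_num
      linear_combination (R * (1 / 8) ^ i) * this
    have h3 := Real.rpow_le_rpow (by positivity) h2 hα.le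
    rw [h1, mul_sub, mul_one]
    have := mul_le_mul_of_nonneg_left h3 hωj
    linarith
  have hyj' : R * (1 / 8) ^ j ≤ ‖y - x₀‖ := by simpa [dist_eq_norm] using hyj
  have hmain0 : 0 ≤ ω j * ((8 * (‖y - x₀‖ / (R * (1 / 8) ^ j))) ^ α - 1) := by
    have := hratio j 0 rfl (by linarith)
    linarith
  refine max_le ?_ (by linarith)
  by_cases hy0 : y ∈ ball x₀ (R * (1 / 8) ^ 0)
  · classical
    have hex : ∃ i, y ∉ ball x₀ (R * (1 / 8) ^ i) := ⟨j, hyj⟩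
    obtain ⟨i, hi⟩ : ∃ i, Nat.find hex = i + 1 := Nat.exists_eq_succ_of_ne_zero fun h0 ↦ by
      have := Nat.find_spec hex
      rw [h0] at this
      exact this hy0
    have hi1 : y ∈ ball x₀ (R * (1 / 8) ^ i) := by
      have := Nat.find_min hex (m := i) (by omega)
      simpa using this
    have hi2 : y ∉ ball x₀ (R * (1 / 8) ^ (i + 1)) := by
      have := Nat.find_spec hex
      rwa [hi] at this
    have hij : i + 1 ≤ j := by
      have := Nat.find_min' hex hyj
      omega
    have h4 := hy i (by omega) hi1
    have h5 : R * (1 / 8) ^ i ≤ 8 * ‖y - x₀‖ := by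
      have : R * (1 / 8) ^ (i + 1) ≤ ‖y - x₀‖ := by simpa [dist_eq_norm] using hi2
      rw [pow_succ] at this
      linarith
    have := hratio i (j - i) (by omega) h5
    linarith
  -- Outside the first ball only `m + ω j ≤ ω 0 / 2` is available. With `|u| ≤ Q ≤ A / 2` on
  -- `B_{2R}` it gives `m - u ≤ ω 0 - ω j`; off `B_{2R}` the value `|u y|` is charged separately.
  · have h5 : R * (1 / 8) ^ 0 ≤ 8 * ‖y - x₀‖ := by
      have : R * (1 / 8) ^ 0 ≤ ‖y - x₀‖ := by simpa [dist_eq_norm] using hy0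
      linarith [norm_nonneg (y - x₀)]
    have h6 := hratio 0 j (by omega) h5
    have hω0 : ω 0 = A := by simp [hω]
    have h7 := h.upper
    by_cases hyB : y ∈ ball (0 : E N) (2 * R)
    · have := neg_abs_le (u y)
      have := huy hyB
      linarith
    · rw [indicator_of_mem (show y ∈ (ball (0 : E N) (2 * R))ᶜ from hyB)]
      have := neg_abs_le (u y)
      linarith

/-- The growth weight contributes a scale invariant term with the small factor `η`. The exterior of
`B_{2R}` contributes a term independent of `j`, recentred from `x₀` to `0` by `‖y‖ ≤ 2 ‖y - x₀‖`. -/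
theorem OscBound.lintegral_tail_le (hs : s ∈ Ioo (0 : ℝ) 1) (hp : 1 < p) {u : E N → ℝ} {x₀ : E N}
    {R K Q A α η : ℝ} {ω : ℕ → ℝ} {j : ℕ} {m : ℝ}
    (hR : 0 < R) (hα : 0 < α) (hQ : 0 ≤ Q) (hA : 2 * Q ≤ A) (hη : 0 ≤ η)
    (hω : ω = fun i ↦ A * ((1 / 8 : ℝ) ^ α) ^ i) (hd : DecayData s p R K Q x₀ u)
    (hα' : ∫⁻ h in (ball (0 : E N) 1)ᶜ, ENNReal.ofReal (((8 * ‖h‖) ^ α - 1) ^ (p - 1)) *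
        ENNReal.ofReal (1 / ‖h‖ ^ ((N : ℝ) + p * s)) ≤ ENNReal.ofReal η)
    (h : OscBound u x₀ R ω j m) :
    ∫⁻ y in (ball x₀ (R * (1 / 8) ^ j))ᶜ, ENNReal.ofReal (max (m - u y) 0 ^ (p - 1) *
        (1 / ‖y - x₀‖ ^ ((N : ℝ) + p * s))) ≤
      ENNReal.ofReal (2 ^ (p - 1) * ω j ^ (p - 1) * η * (R * (1 / 8) ^ j) ^ (-(p * s)) +
        2 ^ (p - 1) * 2 ^ ((N : ℝ) + p * s) * (Q ^ (p - 1) * R ^ (-(p * s)))) := by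
  have hD := kernel_exponent_pos (N := N) hs hp
  have hq : 0 < p - 1 := by linarith
  have hωj : 0 ≤ ω j := by
    rw [hω]
    have : 0 ≤ A := by linarith
    positivity
  have hrj : 0 < R * (1 / 8 : ℝ) ^ j := by positivity
  set f : ℝ → ℝ≥0∞ := fun t ↦ ENNReal.ofReal (((8 * t) ^ α - 1) ^ (p - 1)) with hf
  set g : E N → ℝ≥0∞ := fun y ↦ f (‖y - x₀‖ / (R * (1 / 8) ^ j)) *
    ENNReal.ofReal (1 / ‖y - x₀‖ ^ ((N : ℝ) + p * s)) with hg
  have hgm : Measurable g := by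
    rw [hg, hf]; fun_prop
  set k : E N → ℝ≥0∞ := (ball (0 : E N) (2 * R))ᶜ.indicator fun y ↦
    ENNReal.ofReal (|u y| ^ (p - 1) * (1 / ‖y‖ ^ ((N : ℝ) + p * s))) with hk
  have hpt : ∀ᵐ y ∂(volume.restrict (ball x₀ (R * (1 / 8) ^ j))ᶜ),
      ENNReal.ofReal (max (m - u y) 0 ^ (p - 1) * (1 / ‖y - x₀‖ ^ ((N : ℝ) + p * s))) ≤
        ENNReal.ofReal (2 ^ (p - 1) * ω j ^ (p - 1)) * g y +
          ENNReal.ofReal (2 ^ (p - 1) * 2 ^ ((N : ℝ) + p * s)) * k y := by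
    filter_upwards [ae_restrict_mem measurableSet_ball.compl,
      ae_restrict_of_ae (h.sub_le hR hα hQ hA hω hd.bound)] with y hyj hy
    have hyb := hy hyj
    have hyj' : R * (1 / 8) ^ j ≤ ‖y - x₀‖ := by simpa [dist_eq_norm] using hyj
    have hpos : 0 < ‖y - x₀‖ := by linarith
    have h8 : 1 ≤ 8 * (‖y - x₀‖ / (R * (1 / 8) ^ j)) := by
      have : 1 ≤ ‖y - x₀‖ / (R * (1 / 8) ^ j) := by rwa [one_le_div hrj]
      linarith
    have h0 : 0 ≤ (8 * (‖y - x₀‖ / (R * (1 / 8) ^ j))) ^ α - 1 :=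
      sub_nonneg.2 (Real.one_le_rpow h8 hα.le)
    have hind : 0 ≤ (ball (0 : E N) (2 * R))ᶜ.indicator (fun y ↦ |u y|) y :=
      indicator_nonneg (fun _ _ ↦ abs_nonneg _) _
    have h1 := (Real.rpow_le_rpow (le_max_right _ _) hyb hq.le).trans
      (add_rpow_le_two_rpow hq.le (mul_nonneg hωj h0) hind)
    rw [Real.mul_rpow hωj h0] at h1
    have h2 := mul_le_mul_of_nonneg_right h1
      (by positivity : 0 ≤ 1 / ‖y - x₀‖ ^ ((N : ℝ) + p * s))
    have hkl : ENNReal.ofReal (2 ^ (p - 1) * 2 ^ ((N : ℝ) + p * s)) * k y ≥ ENNReal.ofReal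
        (2 ^ (p - 1) * ((ball (0 : E N) (2 * R))ᶜ.indicator (fun y ↦ |u y|) y ^ (p - 1) *
          (1 / ‖y - x₀‖ ^ ((N : ℝ) + p * s)))) := by
      by_cases hyB : y ∈ (ball (0 : E N) (2 * R))ᶜ
      · rw [hk, indicator_of_mem hyB, indicator_of_mem hyB, ← ENNReal.ofReal_mul (by positivity)]
        refine ENNReal.ofReal_le_ofReal ?_
        have hyR : 2 * R ≤ ‖y‖ := by simpa using hyB
        have hxR : ‖x₀‖ < R := by simpa using hd.center
        have hy2 : ‖y‖ ≤ 2 * ‖y - x₀‖ := by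
          have := norm_le_norm_sub_add y x₀
          linarith
        have hypos : 0 < ‖y‖ := by linarith
        have h3 := Real.rpow_le_rpow hypos.le hy2 hD.le
        rw [Real.mul_rpow (by norm_num) hpos.le] at h3
        have h4 : 1 / ‖y - x₀‖ ^ ((N : ℝ) + p * s) ≤
            2 ^ ((N : ℝ) + p * s) * (1 / ‖y‖ ^ ((N : ℝ) + p * s)) := by
          rw [mul_one_div, div_le_div_iff₀ (by positivity) (by positivity)]
          linarith
        calc _ ≤ 2 ^ (p - 1) * (|u y| ^ (p - 1) *
              (2 ^ ((N : ℝ) + p * s) * (1 / ‖y‖ ^ ((N : ℝ) + p * s)))) := by gcongr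
          _ = _ := by ring
      · rw [indicator_of_notMem hyB, Real.zero_rpow hq.ne']
        simp
    have hgl : ENNReal.ofReal (2 ^ (p - 1) * ω j ^ (p - 1)) * g y = ENNReal.ofReal
        (2 ^ (p - 1) * (ω j ^ (p - 1) * ((8 * (‖y - x₀‖ / (R * (1 / 8) ^ j))) ^ α - 1) ^ (p - 1) *
          (1 / ‖y - x₀‖ ^ ((N : ℝ) + p * s)))) := by
      simp only [hg, hf]
      rw [← ENNReal.ofReal_mul (by positivity), ← ENNReal.ofReal_mul (by positivity)]
      congr 1; ring
    refine le_trans ?_ (add_le_add hgl.ge hkl)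
    rw [← ENNReal.ofReal_add (by positivity) (by positivity)]
    refine ENNReal.ofReal_le_ofReal (h2.trans (le_of_eq (by ring)))
  refine (lintegral_mono_ae hpt).trans ?_
  rw [lintegral_add_left (hgm.const_mul _), lintegral_const_mul _ hgm,
    lintegral_const_mul' _ _ ENNReal.ofReal_ne_top]
  rw [ENNReal.ofReal_add (by positivity) (by positivity)]
  have h1 : ∫⁻ y in (ball x₀ (R * (1 / 8) ^ j))ᶜ, g y ≤
      ENNReal.ofReal ((R * (1 / 8) ^ j) ^ (-(p * s))) * ENNReal.ofReal η := by
    rw [hg, lintegral_compl_ball_kernel_scale f x₀ hrj]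
    gcongr
  have h2 : ∫⁻ y in (ball x₀ (R * (1 / 8) ^ j))ᶜ, k y ≤
      ENNReal.ofReal (Q ^ (p - 1) * R ^ (-(p * s))) := by
    refine (setLIntegral_le_lintegral _ _).trans ?_
    rw [hk, lintegral_indicator measurableSet_ball.compl]
    exact hd.tail
  refine add_le_add ?_ ?_
  · refine (mul_le_mul_right h1 _).trans (le_of_eq ?_)
    rw [← ENNReal.ofReal_mul (by positivity), ← ENNReal.ofReal_mul (by positivity)]
    congr 1; ring
  · refine (mul_le_mul_right h2 _).trans (le_of_eq ?_)
    rw [← ENNReal.ofReal_mul (by positivity)]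

end Oscillation

/-! ### Geometric decay of the oscillation. -/

section Decay

variable {N : ℕ} {s p : ℝ}

theorem MemWTilde.neg {U : Set (E N)} {u : E N → ℝ} (h : MemWTilde s p U u) :
    MemWTilde s p U (fun x ↦ -u x) where
  memLp_loc A hA := (h.memLp_loc A hA).neg
  memW_nhds := by
    obtain ⟨V, h1, h2, h3, h4, h5⟩ := h.memW_nhds
    refine ⟨V, h1, h2, h3, h4.neg, ?_⟩
    have e : ∀ z : E N × E N, |-u z.1 - -u z.2| = |u z.1 - u z.2| := fun z ↦ by
      rw [← abs_neg]; congr 1; ring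
    simpa only [gagliardo, e] using h5
  tail_lt_top := by simpa only [abs_neg] using h.tail_lt_top

theorem weakForm_neg (s p : ℝ) (u φ : E N → ℝ) :
    weakForm s p (fun x ↦ -u x) φ = -weakForm s p u φ := by
  unfold weakForm
  rw [← integral_neg]
  congr 1; ext z
  rw [show -u z.1 - -u z.2 = -(u z.1 - u z.2) by ring, signedPow_neg]
  ring

theorem WeakLE.neg {U : Set (E N)} {u : E N → ℝ} {c : ℝ} (h : WeakLE s p U u c) :
    WeakGE s p U (fun x ↦ -u x) (-c) := by
  refine ⟨h.1.neg, fun φ hφ hφ0 ↦ ?_⟩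
  rw [weakForm_neg]
  linarith [h.2 φ hφ hφ0]

theorem DecayData.neg {R K Q : ℝ} {x₀ : E N} {u : E N → ℝ} (h : DecayData s p R K Q x₀ u)
    (hw : WeakLE s p (ball (0 : E N) (2 * R)) u K) : DecayData s p R K Q x₀ (fun x ↦ -u x) where
  weak := hw.neg
  bound := by simpa only [abs_neg] using h.bound
  center := h.center
  rhs := h.rhs
  tail := by simpa only [abs_neg] using h.tail

/-- Geometric decay of the oscillation of a solution. -/
theorem exists_oscBound (hN : 1 < N) (hs : s ∈ Ioo (0 : ℝ) 1) (hp : 1 < p) :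
    ∃ α Λ : ℝ, 0 < α ∧ α ≤ s ∧ 2 ≤ Λ ∧ ∀ (R K Q : ℝ) (x₀ : E N) (u : E N → ℝ), 0 < R → 0 < Q →
      DecayData s p R K Q x₀ u → WeakLE s p (ball (0 : E N) (2 * R)) u K →
      ∀ j : ℕ, ∃ m : ℝ, OscBound u x₀ R (fun i ↦ Λ * Q * ((1 / 8 : ℝ) ^ α) ^ i) j m := by
  have hq : 0 < p - 1 := by linarith
  have hps : 0 < p * s := mul_pos (by linarith) hs.1
  obtain ⟨δ, κ, hδ, hδ1, hκ, hgrow⟩ := exists_growth (N := N) hN hs hp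
  -- With this value the growth weight uses exactly half of the tail allowance of the growth lemma
  -- for `lam = ω j / 2`, measured at the radius `4r`.
  set η : ℝ := κ / (2 * (2 ^ (p - 1) * 2 ^ (p - 1))) with hη
  have hη0 : 0 < η := by positivity
  -- Solves `8 ^ (-a₁) = 1 - δ / 2`, the contraction factor of one growth step.
  set a₁ : ℝ := -Real.log (1 - δ / 2) / Real.log 8 with ha₁
  have hlog8 : 0 < Real.log 8 := Real.log_pos (by norm_num)
  have ha₁0 : 0 < a₁ := div_pos (neg_pos.2 (Real.log_neg (by linarith) (by linarith))) hlog8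
  -- The three upper bounds serve different ends: `s` for the statement, `a₁` so that one step gains
  -- enough, and `ps / (p - 1)` so that `ω j ^ (p - 1) r_j ^ (-ps)` does not decrease with `j`.
  obtain ⟨α, hα, hαle, htail⟩ := exists_tail_weight_le (N := N) hs hp hη0
    (a₀ := min s (min a₁ (p * s / (p - 1)))) (by have := hs.1; positivity)
  have hαs : α ≤ s := hαle.trans (min_le_left _ _)
  have hαa : α ≤ a₁ := hαle.trans ((min_le_right _ _).trans (min_le_left _ _))
  have hαq : α * (p - 1) ≤ p * s := by
    rw [← le_div_iff₀ hq]
    exact hαle.trans ((min_le_right _ _).trans (min_le_right _ _))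
  set θ : ℝ := (1 / 8 : ℝ) ^ α with hθ
  have hθ0 : 0 < θ := by positivity
  have hθ1 : θ ≤ 1 := Real.rpow_le_one (by norm_num) (by norm_num) hα.le
  have hθδ : 1 - δ / 2 ≤ θ := by
    rw [hθ, Real.rpow_def_of_pos (by norm_num), one_div, Real.log_inv,
      ← Real.log_le_iff_le_exp (by linarith)]
    rw [ha₁, le_div_iff₀ hlog8] at hαa
    linarith
  -- The summand `1` covers `K`; the doubled constant makes the exterior tail fit into the other
  -- half of the allowance. `T` then scales the initial oscillation so that `T ^ (p - 1) ≥ B`.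
  set B : ℝ := (2 * (2 ^ (p - 1) * 2 ^ ((N : ℝ) + p * s)) + 1) / κ with hB
  have hB0 : 0 < B := by positivity
  have hκB : κ * B = 2 * (2 ^ (p - 1) * 2 ^ ((N : ℝ) + p * s)) + 1 := by rw [hB]; field_simp
  set T : ℝ := max 1 (B ^ (1 / (p - 1))) with hT
  have hT1 : 1 ≤ T := le_max_left _ _
  have hTB : B ≤ T ^ (p - 1) := by
    calc B = (B ^ (1 / (p - 1))) ^ (p - 1) := by
          rw [← Real.rpow_mul hB0.le, one_div_mul_cancel hq.ne', Real.rpow_one]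
      _ ≤ _ := Real.rpow_le_rpow (by positivity) (le_max_right _ _) hq.le
  refine ⟨α, 2 * T, hα, hαs, by linarith, ?_⟩
  intro R K Q x₀ u hR hQ hd hwle
  set ω : ℕ → ℝ := fun i ↦ 2 * T * Q * θ ^ i with hω
  have hω0 : ∀ i, 0 < ω i := fun i ↦ by simp only [hω]; positivity
  have hωs : ∀ i, ω (i + 1) = θ * ω i := fun i ↦ by simp only [hω]; ring
  have hωa : ∀ i, ω (i + 1) ≤ ω i := fun i ↦ by
    rw [hωs]; exact mul_le_of_le_one_left (hω0 i).le hθ1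
  have hbig : ∀ j : ℕ, B * (Q ^ (p - 1) * R ^ (-(p * s))) ≤
      (ω j / 2) ^ (p - 1) * (R * (1 / 8) ^ j) ^ (-(p * s)) := fun j ↦ by
    have e1 : ω j / 2 = T * Q * θ ^ j := by simp only [hω]; ring
    have e2 : (1 : ℝ) ≤ (θ ^ j) ^ (p - 1) * ((1 / 8 : ℝ) ^ j) ^ (-(p * s)) := by
      have e3 : (θ ^ j) ^ (p - 1) = ((1 / 8 : ℝ) ^ j) ^ (α * (p - 1)) := by
        rw [Real.rpow_mul (by positivity), hθ]
        congr 1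
        rw [← Real.rpow_natCast, ← Real.rpow_natCast, ← Real.rpow_mul (by norm_num),
          ← Real.rpow_mul (by norm_num), mul_comm]
      rw [e3, ← Real.rpow_add (by positivity)]
      exact Real.one_le_rpow_of_pos_of_le_one_of_nonpos (by positivity)
        (pow_le_one₀ (by norm_num) (by norm_num)) (by linarith)
    rw [e1, Real.mul_rpow (by positivity) (by positivity), Real.mul_rpow (by positivity) hQ.le,
      Real.mul_rpow hR.le (by positivity)]
    calc B * (Q ^ (p - 1) * R ^ (-(p * s))) ≤ T ^ (p - 1) * (Q ^ (p - 1) * R ^ (-(p * s))) * 1 := by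
          rw [mul_one]; gcongr
      _ ≤ T ^ (p - 1) * (Q ^ (p - 1) * R ^ (-(p * s))) *
          ((θ ^ j) ^ (p - 1) * ((1 / 8 : ℝ) ^ j) ^ (-(p * s))) := by gcongr
      _ = _ := by ring
  have hstep : ∀ (w : E N → ℝ) (j : ℕ) (m : ℝ), DecayData s p R K Q x₀ w →
      OscBound w x₀ R ω j m →
      volume.real (ball x₀ (2 * (R * (1 / 8) ^ j / 4)) \ ball x₀ (R * (1 / 8) ^ j / 4)) ≤
        2 * volume.real ({x | m + ω j / 2 ≤ w x} ∩
          (ball x₀ (2 * (R * (1 / 8) ^ j / 4)) \ ball x₀ (R * (1 / 8) ^ j / 4))) →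
      ∃ m', OscBound w x₀ R ω (j + 1) m' := by
    intro w j m hdw how hvol
    set r : ℝ := R * (1 / 8) ^ j / 4 with hr
    have hrj : 0 < R * (1 / 8 : ℝ) ^ j := by positivity
    have hr0 : 0 < r := by positivity
    have h4r : 4 * r = R * (1 / 8) ^ j := by rw [hr]; ring
    have hrle : (R * (1 / 8) ^ j) ^ (-(p * s)) ≤ r ^ (-(p * s)) :=
      Real.rpow_le_rpow_of_nonpos hr0 (by linarith) (by linarith)
    have hlam : 0 < ω j / 2 := half_pos (hω0 j)
    have hX0 : 0 ≤ Q ^ (p - 1) * R ^ (-(p * s)) := by positivity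
    have hBX : κ * (B * (Q ^ (p - 1) * R ^ (-(p * s)))) ≤
        κ * (ω j / 2) ^ (p - 1) * (R * (1 / 8) ^ j) ^ (-(p * s)) := by
      rw [mul_assoc κ ((ω j / 2) ^ _)]
      exact mul_le_mul_of_nonneg_left (hbig j) hκ.le
    rw [← mul_assoc, hκB] at hBX
    have hY : κ * (ω j / 2) ^ (p - 1) * (R * (1 / 8) ^ j) ^ (-(p * s)) ≤
        κ * (ω j / 2) ^ (p - 1) * r ^ (-(p * s)) :=
      mul_le_mul_of_nonneg_left hrle (by positivity)
    have hc0 : 0 ≤ (2 : ℝ) ^ (p - 1) * 2 ^ ((N : ℝ) + p * s) * (Q ^ (p - 1) * R ^ (-(p * s))) := by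
      positivity
    have hsub : ball x₀ (4 * r) ⊆ ball (0 : E N) (2 * R) := by
      have hxR : dist x₀ 0 < R := hdw.center
      refine ball_subset_ball' ?_
      have : R * (1 / 8 : ℝ) ^ j ≤ R :=
        mul_le_of_le_one_right hR.le (pow_le_one₀ (by norm_num) (by norm_num))
      linarith
    have hbase : ∀ᵐ x, x ∈ ball x₀ (4 * r) → m ≤ w x := by
      rw [h4r]
      filter_upwards [how.bound j le_rfl] with x hx hxb
      linarith [(hx hxb).1]
    have hgain := hgrow _ K w Q measurableSet_ball hdw.weak hdw.bound x₀ r hr0 hsub m (ω j / 2) hlam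
      hbase hvol (hdw.rhs.trans (by linarith)) (by
        rw [h4r]
        refine (how.lintegral_tail_le hs hp hR hα hQ.le (by nlinarith) hη0.le hω hdw htail).trans
          (ENNReal.ofReal_le_ofReal ?_)
        have e1 : 2 ^ (p - 1) * ω j ^ (p - 1) * η * (R * (1 / 8) ^ j) ^ (-(p * s)) =
            κ * (ω j / 2) ^ (p - 1) * (R * (1 / 8) ^ j) ^ (-(p * s)) / 2 := by
          rw [Real.div_rpow (hω0 j).le (by norm_num), hη]
          field_simp
        rw [e1]
        linarith)
    have hr2 : r / 2 = R * (1 / 8) ^ (j + 1) := by rw [hr, pow_succ]; ring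
    rw [hr2] at hgain
    have hdec : ω j - ω (j + 1) ≤ δ * (ω j / 2) := by
      rw [hωs]
      have := mul_le_mul_of_nonneg_right hθδ (hω0 j).le
      linarith
    -- The growth lemma raises the lower end, so the top of the interval stays fixed and the bottom
    -- moves up.
    refine ⟨m + ω j - ω (j + 1), fun i hi ↦ ?_, ?_, ?_⟩
    · rcases Nat.lt_or_ge j i with h | h
      · obtain rfl : i = j + 1 := by omega
        filter_upwards [hgain, how.bound j le_rfl] with x h1 h2 hx
        have hx' : x ∈ ball x₀ (R * (1 / 8) ^ j) := by
          refine ball_subset_ball ?_ hx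
          exact mul_le_mul_of_nonneg_left
            (pow_le_pow_of_le_one (by norm_num) (by norm_num) (by omega)) hR.le
        have := h1 hx
        have := (h2 hx').2
        constructor <;> linarith
      · filter_upwards [how.bound i h] with x h1 hx
        obtain ⟨h2, h3⟩ := h1 hx
        have := hωa j
        constructor <;> linarith
    · linarith [how.lower, hωa j]
    · linarith [how.upper]
  intro j
  induction j with
  | zero =>
    refine ⟨-(ω 0 / 2), fun i hi ↦ ?_, le_rfl, by linarith⟩
    obtain rfl : i = 0 := by omega
    have hω0Q : ω 0 = 2 * T * Q := by simp [hω]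
    have hxR : dist x₀ 0 < R := hd.center
    filter_upwards [hd.bound] with x hx hxb
    have h1 := hx (by
      rw [pow_zero, mul_one] at hxb
      exact ball_subset_ball' (by linarith) hxb)
    have h2 := abs_le.1 h1
    have h3 : Q ≤ T * Q := le_mul_of_one_le_left hQ.le hT1
    constructor <;> linarith
  | succ j ih =>
    obtain ⟨m, hm⟩ := ih
    set S : Set (E N) :=
      ball x₀ (2 * (R * (1 / 8) ^ j / 4)) \ ball x₀ (R * (1 / 8) ^ j / 4) with hS
    have hSfin : volume S ≠ ∞ := ((measure_mono sdiff_subset).trans_lt measure_ball_lt_top).ne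
    -- Every point of the annulus lies above or below the midpoint, so one of the two sets fills at
    -- least half of it; the second is the first one for `-u`.
    have hcover : S ⊆ ({x | m + ω j / 2 ≤ u x} ∩ S) ∪
        ({x | -(m + ω j) + ω j / 2 ≤ -u x} ∩ S) := fun x hx ↦ by
      rcases le_total (m + ω j / 2) (u x) with h | h
      · exact Or.inl ⟨h, hx⟩
      · refine Or.inr ⟨?_, hx⟩
        simp only [mem_ofPred_eq]
        linarith
    have hle := (measureReal_mono hcover
      (measure_union_lt_top (measure_inter_lt_top_of_right_ne_top hSfin)
        (measure_inter_lt_top_of_right_ne_top hSfin)).ne).trans (measureReal_union_le _ _)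
    rcases le_total (volume.real ({x | m + ω j / 2 ≤ u x} ∩ S))
      (volume.real ({x | -(m + ω j) + ω j / 2 ≤ -u x} ∩ S)) with h | h
    · obtain ⟨m', hm'⟩ := hstep (fun x ↦ -u x) j (-(m + ω j)) (hd.neg hwle) hm.neg (by linarith)
      have := hm'.neg
      simp only [neg_neg] at this
      exact ⟨_, this⟩
    · exact hstep u j m hd hm (by linarith)

end Decay

/-! ### From oscillation decay to a Hölder representative. -/

section Holder

variable {N : ℕ} {s p : ℝ}

theorem exists_mem_ball_of_ae {P : E N → Prop} (h : ∀ᵐ x, P x) (c : E N) {ρ : ℝ} (hρ : 0 < ρ) :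
    ∃ x ∈ ball c ρ, P x := by
  by_contra! hcon
  have h1 : volume (ball c ρ) = 0 := measure_mono_null (fun x hx ↦ hcon x hx) h
  exact (measure_ball_pos volume c hρ).ne' h1

theorem exists_pow_le_lt_pow {t : ℝ} (ht : 0 < t) (ht1 : t < 1) :
    ∃ n : ℕ, (1 / 8 : ℝ) ^ (n + 1) ≤ t ∧ t < (1 / 8) ^ n := by
  classical
  have hex : ∃ n : ℕ, (1 / 8 : ℝ) ^ (n + 1) ≤ t := by
    obtain ⟨n, hn⟩ := exists_pow_lt_of_lt_one ht (by norm_num : (1 / 8 : ℝ) < 1)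
    exact ⟨n, (pow_le_pow_of_le_one (by norm_num) (by norm_num) (Nat.le_succ n)).trans hn.le⟩
  refine ⟨Nat.find hex, Nat.find_spec hex, ?_⟩
  rcases h : Nat.find hex with _ | k
  · simpa using ht1
  · exact not_le.1 (Nat.find_min hex (m := k) (by omega))

/-- Geometric oscillation decay around a point yields a pointwise modulus of continuity there. -/
theorem exists_value_of_osc_decay (hN : 1 < N) {u : E N → ℝ} {x₀ : E N} {R A α : ℝ} (hR : 0 < R)
    (hα : 0 < α) (hA : 0 ≤ A)
    (h : ∀ j : ℕ, ∃ c : ℝ, ∀ᵐ x, x ∈ ball x₀ (R * (1 / 8) ^ j) →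
      c ≤ u x ∧ u x ≤ c + A * ((1 / 8 : ℝ) ^ α) ^ j) :
    ∃ w : ℝ, ∀ᵐ x, x ∈ ball x₀ R → |u x - w| ≤ A * 8 ^ α * (‖x - x₀‖ / R) ^ α := by
  choose c hc using h
  have hcross : ∀ i j, c i ≤ c j + A * ((1 / 8 : ℝ) ^ α) ^ j := fun i j ↦ by
    obtain ⟨x, hx, h1, h2⟩ := exists_mem_ball_of_ae ((hc i).and (hc j)) x₀
      (ρ := R * (1 / 8) ^ (i + j)) (by positivity)
    have hi := h1 (ball_subset_ball (mul_le_mul_of_nonneg_left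
      (pow_le_pow_of_le_one (by norm_num) (by norm_num) (by omega)) hR.le) hx)
    have hj := h2 (ball_subset_ball (mul_le_mul_of_nonneg_left
      (pow_le_pow_of_le_one (by norm_num) (by norm_num) (by omega)) hR.le) hx)
    linarith [hi.1, hj.2]
  have hbdd : BddAbove (range c) := ⟨_, by rintro _ ⟨i, rfl⟩; exact hcross i 0⟩
  -- The intervals `[c j, c j + A θ ^ j]`, with `θ = (1/8) ^ α`, pairwise intersect because the
  -- balls share a common smaller ball; the supremum of the left ends lies in all of them.
  refine ⟨⨆ j, c j, ?_⟩
  -- At `x₀` itself the estimate would force `u x₀ = w`, which need not hold for the given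
  -- representative.
  have hne : ∀ᵐ x : E N, x ≠ x₀ := by
    have : Nontrivial (E N) := Module.nontrivial_of_finrank_pos (R := ℝ) (by rw [finrank_E]; omega)
    rw [ae_iff]
    simp
  filter_upwards [ae_all_iff.2 hc, hne] with x hx hxne hxR
  have hpos : 0 < ‖x - x₀‖ := norm_sub_pos_iff.2 hxne
  have hlt : ‖x - x₀‖ / R < 1 := by
    rw [div_lt_one hR, ← dist_eq_norm]; exact hxR
  obtain ⟨n, hn1, hn2⟩ := exists_pow_le_lt_pow (by positivity : 0 < ‖x - x₀‖ / R) hlt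
  have hn : A * ((1 / 8 : ℝ) ^ α) ^ (n + 1) ≤ A * (‖x - x₀‖ / R) ^ α := by
    refine mul_le_mul_of_nonneg_left ?_ hA
    rw [← Real.rpow_natCast, ← Real.rpow_mul (by norm_num), mul_comm α,
      Real.rpow_mul (by norm_num), Real.rpow_natCast]
    exact Real.rpow_le_rpow (by positivity) hn1 hα.le
  have h8 : A * ((1 / 8 : ℝ) ^ α) ^ n = A * ((1 / 8 : ℝ) ^ α) ^ (n + 1) * 8 ^ α := by
    have := geometric_ratio α n 1 A
    rwa [pow_one] at this
  have hfin : |u x - ⨆ j, c j| ≤ A * ((1 / 8 : ℝ) ^ α) ^ n := by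
    have h1 := hx n (by
      rw [mem_ball, dist_eq_norm, mul_comm, ← div_lt_iff₀ hR]; exact hn2)
    have h2 : c n ≤ ⨆ j, c j := le_ciSup hbdd n
    have h3 : ⨆ j, c j ≤ c n + A * ((1 / 8 : ℝ) ^ α) ^ n := ciSup_le fun i ↦ hcross i n
    rw [abs_le]
    constructor <;> linarith [h1.1, h1.2]
  rw [h8] at hfin
  have := mul_le_mul_of_nonneg_right hn (by positivity : (0 : ℝ) ≤ 8 ^ α)
  linarith

/-- A pointwise modulus of continuity at every point yields a Hölder representative. -/
theorem exists_holder_representative {u : E N → ℝ} {R A α Q : ℝ} (hR : 0 < R) (hα : 0 < α)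
    (hα1 : α ≤ 1) (hA : 0 ≤ A) (hQ : 0 ≤ Q) (hu : ∀ᵐ x, x ∈ ball (0 : E N) R → |u x| ≤ Q)
    (h : ∀ x₀ ∈ ball (0 : E N) R, ∃ w : ℝ, ∀ᵐ x, x ∈ ball x₀ R →
      |u x - w| ≤ A * (‖x - x₀‖ / R) ^ α) :
    ∃ v : E N → ℝ, (∀ᵐ x, x ∈ ball (0 : E N) R → v x = u x) ∧
      ∀ x ∈ ball (0 : E N) R, ∀ y ∈ ball (0 : E N) R,
        |v x - v y| ≤ (3 * A + 2 * Q) * (‖x - y‖ / R) ^ α := by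
  classical
  have h' : ∀ x₀ : E N, ∃ w : ℝ, x₀ ∈ ball (0 : E N) R → ∀ᵐ x, x ∈ ball x₀ R →
      |u x - w| ≤ A * (‖x - x₀‖ / R) ^ α := fun x₀ ↦ by
    by_cases hx₀ : x₀ ∈ ball (0 : E N) R
    · obtain ⟨w, hw⟩ := h x₀ hx₀
      exact ⟨w, fun _ ↦ hw⟩
    · exact ⟨0, fun hx ↦ absurd hx hx₀⟩
  choose v hv using h'
  have hvQ : ∀ x ∈ ball (0 : E N) R, |v x| ≤ Q + A := fun x hx ↦ by
    have hpos : 0 < R - dist x 0 := sub_pos.2 hx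
    obtain ⟨z, hz, h1, h2⟩ := exists_mem_ball_of_ae (hu.and (hv x hx)) x (ρ := R - dist x 0) hpos
    have hzR : z ∈ ball (0 : E N) R := by
      have : dist z x < R - dist x 0 := hz
      rw [mem_ball]
      linarith [dist_triangle z x 0]
    have hzx : z ∈ ball x R := ball_subset_ball (by linarith [dist_nonneg (x := x) (y := 0)]) hz
    have h3 := h2 hzx
    have h4 : (‖z - x‖ / R) ^ α ≤ 1 := by
      refine Real.rpow_le_one (by positivity) ?_ hα.le
      rw [div_le_one hR, ← dist_eq_norm]
      exact (mem_ball.1 hzx).le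
    have h5 := mul_le_mul_of_nonneg_left h4 hA
    have h6 := abs_le.1 (h1 hzR)
    have h7 := abs_le.1 h3
    rw [abs_le]
    constructor <;> linarith
  have hHolder : ∀ x ∈ ball (0 : E N) R, ∀ y ∈ ball (0 : E N) R,
      |v x - v y| ≤ (3 * A + 2 * Q) * (‖x - y‖ / R) ^ α := fun x hx y hy ↦ by
    rcases eq_or_ne x y with rfl | hxy
    · simp only [sub_self, abs_zero]; positivity
    have hd : 0 < ‖x - y‖ := norm_sub_pos_iff.2 hxy
    rcases lt_or_ge ‖x - y‖ R with hlt | hge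
    · obtain ⟨z, hz, h1, h2⟩ := exists_mem_ball_of_ae ((hv x hx).and (hv y hy)) y
        (ρ := min ‖x - y‖ (R - ‖x - y‖)) (lt_min hd (by linarith))
      have hz1 : ‖z - y‖ < ‖x - y‖ := by
        rw [← dist_eq_norm z]; exact (mem_ball.1 hz).trans_le (min_le_left _ _)
      have hz2 : ‖z - y‖ < R - ‖x - y‖ := by
        rw [← dist_eq_norm z]; exact (mem_ball.1 hz).trans_le (min_le_right _ _)
      have hzx : ‖z - x‖ ≤ ‖z - y‖ + ‖x - y‖ := by
        rw [norm_sub_rev x y]; exact norm_sub_le_norm_sub_add_norm_sub z y x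
      have h3 := h1 (by rw [mem_ball, dist_eq_norm]; linarith)
      have h4 := h2 (by rw [mem_ball, dist_eq_norm]; linarith)
      have h5 : (‖z - y‖ / R) ^ α ≤ (‖x - y‖ / R) ^ α :=
        Real.rpow_le_rpow (by positivity) (by gcongr) hα.le
      have h6 : (‖z - x‖ / R) ^ α ≤ 2 * (‖x - y‖ / R) ^ α := by
        calc (‖z - x‖ / R) ^ α ≤ (2 * (‖x - y‖ / R)) ^ α := by
              refine Real.rpow_le_rpow (by positivity) ?_ hα.le
              rw [← mul_div_assoc]
              exact div_le_div_of_nonneg_right (by linarith) hR.le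
          _ = 2 ^ α * (‖x - y‖ / R) ^ α := Real.mul_rpow (by norm_num) (by positivity)
          _ ≤ 2 * (‖x - y‖ / R) ^ α := by
              refine mul_le_mul_of_nonneg_right ?_ (by positivity)
              calc (2 : ℝ) ^ α ≤ 2 ^ (1 : ℝ) :=
                    Real.rpow_le_rpow_of_exponent_le (by norm_num) hα1
                _ = 2 := Real.rpow_one 2
      have h7 := mul_le_mul_of_nonneg_left h5 hA
      have h8 := mul_le_mul_of_nonneg_left h6 hA
      have h9 : 0 ≤ 2 * Q * (‖x - y‖ / R) ^ α := by positivity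
      have h10 := abs_le.1 h3
      have h11 := abs_le.1 h4
      rw [abs_le]
      constructor <;> linarith
    -- Distant pairs are settled by the supremum bound, `2 (Q + A) ≤ 3A + 2Q`.
    · have h1 : 1 ≤ (‖x - y‖ / R) ^ α :=
        Real.one_le_rpow (by rwa [one_le_div hR]) hα.le
      have h2 := mul_le_mul_of_nonneg_left h1 (by positivity : 0 ≤ 3 * A + 2 * Q)
      have h3 := abs_le.1 (hvQ x hx)
      have h4 := abs_le.1 (hvQ y hy)
      rw [abs_le]
      constructor <;> linarith
  refine ⟨v, ?_, hHolder⟩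
  -- The exceptional null set depends on the centre, so only countably many centres can be used at
  -- once. A dense sequence suffices because `v` is already continuous on the ball.
  have hdense : ∀ᵐ x, ∀ n : ℕ, TopologicalSpace.denseSeq (E N) n ∈ ball (0 : E N) R →
      x ∈ ball (TopologicalSpace.denseSeq (E N) n) R →
      |u x - v (TopologicalSpace.denseSeq (E N) n)| ≤
        A * (‖x - TopologicalSpace.denseSeq (E N) n‖ / R) ^ α := by
    rw [ae_all_iff]
    intro n
    by_cases hn : TopologicalSpace.denseSeq (E N) n ∈ ball (0 : E N) R
    · filter_upwards [hv _ hn] with x hx _ using hx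
    · exact Filter.Eventually.of_forall fun x hx ↦ absurd hx hn
  filter_upwards [hdense] with x hx hxR
  by_contra hne
  have hpos : 0 < |v x - u x| := abs_pos.2 (sub_ne_zero.2 hne)
  have hcont : Filter.Tendsto (fun t : ℝ ↦ (4 * A + 2 * Q) * (t / R) ^ α) (nhds 0) (nhds 0) := by
    have h1 : Continuous fun t : ℝ ↦ (4 * A + 2 * Q) * (t / R) ^ α :=
      continuous_const.mul ((continuous_id.div_const R).rpow_const fun _ ↦ Or.inr hα.le)
    have h2 := h1.tendsto 0
    rwa [zero_div, Real.zero_rpow hα.ne', mul_zero] at h2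
  obtain ⟨t₀, ht₀, ht⟩ := Metric.eventually_nhds_iff.1 (hcont.eventually_lt_const hpos)
  obtain ⟨y, hy, n, rfl⟩ := (TopologicalSpace.denseRange_denseSeq (E N)).inter_open_nonempty
    (ball x (min t₀ R) ∩ ball 0 R) (isOpen_ball.inter isOpen_ball)
    ⟨x, mem_ball_self (lt_min ht₀ hR), hxR⟩
  obtain ⟨hy1, hy2⟩ := hy
  rw [mem_ball, dist_eq_norm', lt_min_iff] at hy1
  have h1 := hx n hy2 (by rw [mem_ball, dist_eq_norm]; exact hy1.2)
  have h2 := hHolder x hxR _ hy2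
  have h3 := ht (y := ‖x - TopologicalSpace.denseSeq (E N) n‖)
    (by rw [dist_zero_right, norm_norm]; exact hy1.1)
  have h4 : |v x - u x| ≤ |v x - v (TopologicalSpace.denseSeq (E N) n)| +
      |u x - v (TopologicalSpace.denseSeq (E N) n)| := by
    rw [abs_sub_comm (u x)]
    exact abs_sub_le _ _ _
  linarith

theorem holderSeminorm_le {α C : ℝ} {S : Set (E N)} {v : E N → ℝ}
    (h : ∀ x ∈ S, ∀ y ∈ S, |v x - v y| ≤ C * ‖x - y‖ ^ α) :
    holderSeminorm α S v ≤ ENNReal.ofReal C := by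
  refine iSup₂_le fun x hx ↦ iSup₂_le fun y hy ↦ iSup_le fun hxy ↦ ENNReal.ofReal_le_ofReal ?_
  have : 0 < ‖x - y‖ := norm_sub_pos_iff.2 hxy
  rw [div_le_iff₀ (by positivity)]
  exact h x hx y hy

theorem tail_lt_top (hs : s ∈ Ioo (0 : ℝ) 1) (hp : 1 < p) {U : Set (E N)} {u : E N → ℝ}
    (h : MemWTilde s p U u) {ρ : ℝ} (hρ : 0 < ρ) : tail s p u 0 ρ < ∞ := by
  have h1 := (h.integrableOn_tail hs hp 0 hρ).lintegral_lt_top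
  unfold tail
  refine ENNReal.rpow_lt_top_of_nonneg (one_div_nonneg.2 (by linarith))
    (ENNReal.mul_lt_top ENNReal.ofReal_lt_top ?_).ne
  simpa only [sub_zero, zero_sub, norm_neg, mul_one_div] using h1

theorem lintegral_le_of_tail_le (hp : 1 < p) (hs : s ∈ Ioo (0 : ℝ) 1) {u : E N → ℝ} {R Q : ℝ}
    (hR : 0 < R) (hQ : 0 ≤ Q) (h : tail s p u 0 (2 * R) ≤ ENNReal.ofReal Q) :
    ∫⁻ y in (ball (0 : E N) (2 * R))ᶜ, ENNReal.ofReal (|u y| ^ (p - 1) *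
      (1 / ‖y‖ ^ ((N : ℝ) + p * s))) ≤ ENNReal.ofReal (Q ^ (p - 1) * R ^ (-(p * s))) := by
  have hq : 0 < p - 1 := by linarith
  have hps : 0 < p * s := mul_pos (by linarith) hs.1
  unfold tail at h
  have h1 := ENNReal.rpow_le_rpow h hq.le
  rw [← ENNReal.rpow_mul, one_div_mul_cancel hq.ne', ENNReal.rpow_one,
    ENNReal.ofReal_rpow_of_nonneg hQ hq.le] at h1
  simp only [zero_sub, norm_neg, ← mul_one_div (|u _| ^ (p - 1))] at h1
  have h2 := mul_le_mul_right h1 (ENNReal.ofReal ((2 * R) ^ (-(p * s))))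
  rw [← mul_assoc, ← ENNReal.ofReal_mul (by positivity), ← ENNReal.ofReal_mul (by positivity),
    ← Real.rpow_add (by positivity), neg_add_cancel, Real.rpow_zero, ENNReal.ofReal_one,
    one_mul] at h2
  refine h2.trans (ENNReal.ofReal_le_ofReal ?_)
  rw [mul_comm]
  exact mul_le_mul_of_nonneg_left
    (Real.rpow_le_rpow_of_nonpos hR (by linarith) (by linarith)) (by positivity)

end Holder

end FracPLaplacian

end

/-! ### Assembly: normalisation by the sum of the three data terms. -/

theorem theorem3p3 (N : ℕ) (hN : 1 < N) (s p : ℝ) (hs : s ∈ Ioo (0 : ℝ) 1) (hp : 1 < p) :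
    ∃ α : ℝ, ∃ C : ℝ, 0 < α ∧ α ≤ s ∧ 0 < C ∧
      ∀ (R : ℝ), 0 < R → ∀ (K : ℝ), 0 ≤ K →
        ∀ u : EuclideanSpace ℝ (Fin N) → ℝ,
          FracPLaplacian.MemWTilde s p (ball 0 (2 * R)) u →
          MemLp u ∞ (volume.restrict (ball 0 (2 * R))) →
          FracPLaplacian.WeakAbsLE s p (ball 0 (2 * R)) u K →
          ∃ v : EuclideanSpace ℝ (Fin N) → ℝ,
            (∀ᵐ x ∂(volume.restrict (ball 0 R)), v x = u x) ∧
            FracPLaplacian.holderSeminorm α (ball 0 R) v ≤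
              ENNReal.ofReal C *
                (ENNReal.ofReal ((K * R ^ (p * s)) ^ (1 / (p - 1)))
                  + eLpNorm u ∞ (volume.restrict (ball 0 (2 * R)))
                  + FracPLaplacian.tail s p u 0 (2 * R)) *
                ENNReal.ofReal (R ^ (-α)) := by
  have hq : 0 < p - 1 := by linarith
  obtain ⟨α, Λ, hα, hαs, hΛ, hosc⟩ := FracPLaplacian.exists_oscBound (N := N) hN hs hp
  -- This is `3A + 2Q` for `A = Λ Q 8 ^ α`, divided by `Q`.
  refine ⟨α, 3 * (Λ * 8 ^ α) + 2, hα, hαs, by positivity, ?_⟩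
  intro R hR K hK u hW hL hweak
  set a : ℝ := (K * R ^ (p * s)) ^ (1 / (p - 1)) with ha
  have ha0 : 0 ≤ a := by positivity
  have hbtop : eLpNorm u ∞ (volume.restrict (ball (0 : EuclideanSpace ℝ (Fin N)) (2 * R))) ≠ ∞ :=
    hL.eLpNorm_ne_top
  have hctop : FracPLaplacian.tail s p u 0 (2 * R) ≠ ∞ :=
    (FracPLaplacian.tail_lt_top hs hp hW (by linarith)).ne
  set b : ℝ := (eLpNorm u ∞ (volume.restrict (ball (0 : EuclideanSpace ℝ (Fin N)) (2 * R)))).toReal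
    with hb
  set c : ℝ := (FracPLaplacian.tail s p u 0 (2 * R)).toReal with hc
  have hb0 : 0 ≤ b := ENNReal.toReal_nonneg
  have hc0 : 0 ≤ c := ENNReal.toReal_nonneg
  have hsum : ENNReal.ofReal a +
      eLpNorm u ∞ (volume.restrict (ball (0 : EuclideanSpace ℝ (Fin N)) (2 * R))) +
      FracPLaplacian.tail s p u 0 (2 * R) = ENNReal.ofReal (a + b + c) := by
    rw [ENNReal.ofReal_add (by positivity) hc0, ENNReal.ofReal_add ha0 hb0,
      ENNReal.ofReal_toReal hbtop, ENNReal.ofReal_toReal hctop]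
  have hub : ∀ᵐ x, x ∈ ball (0 : EuclideanSpace ℝ (Fin N)) (2 * R) → |u x| ≤ b := by
    rw [← ae_restrict_iff' measurableSet_ball]
    filter_upwards [ae_le_eLpNormEssSup (f := u)
      (μ := volume.restrict (ball (0 : EuclideanSpace ℝ (Fin N)) (2 * R)))] with x hx
    rw [← eLpNorm_exponent_top] at hx
    have := ENNReal.toReal_mono hbtop hx
    rwa [toReal_enorm, Real.norm_eq_abs] at this
  rw [hsum, ← ENNReal.ofReal_mul (by positivity), ← ENNReal.ofReal_mul (by positivity)]
  have hsub : ball (0 : EuclideanSpace ℝ (Fin N)) R ⊆ ball 0 (2 * R) :=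
    ball_subset_ball (by linarith)
  -- The decay statement needs a positive normalisation. If the sum is zero, `u` vanishes almost
  -- everywhere in the ball.
  rcases (by positivity : 0 ≤ a + b + c).eq_or_lt with hQ | hQ
  · have hbz : b = 0 := by linarith
    refine ⟨fun _ ↦ 0, ?_, FracPLaplacian.holderSeminorm_le fun x _ y _ ↦ ?_⟩
    · rw [ae_restrict_iff' measurableSet_ball]
      filter_upwards [hub] with x hx hxR
      have := hx (hsub hxR)
      rw [hbz] at this
      exact (abs_nonpos_iff.1 this).symm
    · rw [← hQ]; simp
  set Q : ℝ := a + b + c with hQdef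
  have huQ : ∀ᵐ x, x ∈ ball (0 : EuclideanSpace ℝ (Fin N)) (2 * R) → |u x| ≤ Q := by
    filter_upwards [hub] with x hx hxR
    linarith [hx hxR]
  have hrhs : K ≤ Q ^ (p - 1) * R ^ (-(p * s)) := by
    have h1 : a ^ (p - 1) = K * R ^ (p * s) := by
      rw [ha, ← Real.rpow_mul (by positivity), one_div_mul_cancel hq.ne', Real.rpow_one]
    have h2 : a ^ (p - 1) ≤ Q ^ (p - 1) := Real.rpow_le_rpow ha0 (by linarith) hq.le
    rw [h1] at h2
    rwa [Real.rpow_neg hR.le, ← div_eq_mul_inv, le_div_iff₀ (by positivity)]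
  have htl := FracPLaplacian.lintegral_le_of_tail_le hp hs (u := u) hR hQ.le (by
    rw [← ENNReal.ofReal_toReal hctop]
    exact ENNReal.ofReal_le_ofReal (by linarith))
  obtain ⟨v, hv1, hv2⟩ := FracPLaplacian.exists_holder_representative (u := u) (A := Λ * Q * 8 ^ α)
    (Q := Q) hR hα (hαs.trans hs.2.le) (by positivity) hQ.le
    (huQ.mono fun x hx hxR ↦ hx (hsub hxR)) (fun x₀ hx₀ ↦
      FracPLaplacian.exists_value_of_osc_decay hN hR hα (by positivity) fun j ↦ by
        obtain ⟨m, hm⟩ := hosc R K Q x₀ u hR hQ ⟨hweak.1, huQ, hx₀, hrhs, htl⟩ hweak.2 j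
        refine ⟨m, ?_⟩
        filter_upwards [hm.bound j le_rfl] with x hx hxb
        have := hx hxb
        constructor <;> linarith [this.1, this.2])
  refine ⟨v, (ae_restrict_iff' measurableSet_ball).2 hv1,
    FracPLaplacian.holderSeminorm_le fun x hx y hy ↦ (hv2 x hx y hy).trans (le_of_eq ?_)⟩
  rw [Real.div_rpow (norm_nonneg _) hR.le, Real.rpow_neg hR.le]
  ring
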